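/- Let $n\ge 1$ and let $\Omega\subset\mathbb H^n$ be a domain (non-empty, open, connected). A function $u:\Omega\to[-\infty,\infty)$ is called quaternionic plurisubharmonic (psh) if it is upper semi-continuous and its restriction to every right quaternionic line $\{a+\xi q: q\in\mathbb H\}$, $\xi\neq 0$, is subharmonic (the constant $-\infty$ is allowed as a psh or subharmonic function). For real-valued $f$ of class $C^2$ put $\frac{\partial^2 f}{\partial q_i\partial\bar q_j}=\frac{\partial}{\partial q_i}\left(\frac{\partial f}{\partial\bar q_j}\right)$, where, for $\mathbb H$-valued $F$ and $q=t+xi+yj+zk$, $\frac{\partial F}{\partial\bar q}=\frac{\partial F}{\partial t}+i\frac{\partial F}{\partial x}+j\frac{\partial F}{\partial y}+k\frac{\partial F}{\partial z}$ and $\frac{\partial F}{\partial q}=\frac{\partial F}{\partial t}-\frac{\partial F}{\partial x}i-\frac{\partial F}{\partial y}j-\frac{\partial F}{\partial z}k$. For a psh function $u\in L^1_{loc}(\Omega)$, the measure $\left(\frac{\partial^2 u}{\partial q_i\partial\bar q_j}\right)$ on $\Omega$, with values in the hyperhermitian $n\times n$ matrices, is the weak limit as $\varepsilon\to0^+$ of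 $\left(\frac{\partial^2 u_\varepsilon}{\partial q_i\partial\bar q_j}\right)d\mathrm{vol}$, where $u_\varepsilon=u\star\chi_\varepsilon$, $\chi_\varepsilon(z)=\varepsilon^{-4n}\chi(z/\varepsilon)$, and $\chi\ge0$ is any smooth radial function supported in the unit ball with $\int\chi=1$. Weak convergence of measures on $\Omega$ means convergence of the integrals of every continuous function with compact support in $\Omega$. (i) Let $\{u_N\}$ be a sequence of psh functions on $\Omega$ which is uniformly bounded from above on every compact subset of $\Omega$. Then either $u_N\to-\infty$ uniformly on compact subsets of $\Omega$, or else there is a subsequence $\{u_{N_k}\}$ which converges in $L^1_{loc}(\Omega)$. If $u_N\not\equiv-\infty$ for all $N$ and $u_N$ converges in the sense of distributions to a distribution $U$ on $\Omega$, then $U$ is defined by a psh function $u$, and $u_N\to u$ in $L^1_{loc}(\Omega)$. (ii) Assume that a sequence $\{u_N\}$ of psh functions on $\Omega$ converges in $L^1_{loc}(\Omega)$ to a psh function $u$. Then the matrix measures $\left(\frac{\partial^2 u_N}{\partial q_i\partial\bar q_j}\right)$ and $\left(\frac{\partial^2 u}{\partial q_i\partial\bar q_j}\right)$ exist, and $$\left(\frac{\partial^2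 u_N}{\partial q_i\partial\bar q_j}\right)\longrightarrow\left(\frac{\partial^2 u}{\partial q_i\partial\bar q_j}\right)$$ weakly as measures on $\Omega$. -/

import Mathlib

open MeasureTheory Metric Set Filter Topology
open scoped ENNReal ContDiff Distributions Quaternion

noncomputable section

/-! ### The space `ℍⁿ` -/

instance quaternionMeasurableSpace : MeasurableSpace (Quaternion ℝ) := borel _

instance quaternionBorelSpace : BorelSpace (Quaternion ℝ) := ⟨rfl⟩

/-- The space `ℍⁿ` of quaternionic columns, with its Euclidean norm (so that it is isometric to
`ℝ⁴ⁿ`, and `volume` is Lebesgue measure). -/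
abbrev QSpace (n : ℕ) : Type := PiLp 2 (fun _ : Fin n => Quaternion ℝ)

/-- The point `a + ξ q` of the right quaternionic line through `a` with direction `ξ`. -/
def rightLine {n : ℕ} (a ξ : QSpace n) (q : Quaternion ℝ) : QSpace n :=
  WithLp.toLp 2 (fun i => a i + ξ i * q)

/-! ### Subharmonic and quaternionic plurisubharmonic functions with values in `[-∞, ∞)` -/

/-- The integral `∫ f⁺ - ∫ f⁻` of an extended real valued function (used below only for functions
that are bounded above on a space of finite mass, so that it is a well-defined element
of `[-∞, ∞)`). -/
def erealIntegral {α : Type*} [MeasurableSpace α] (μ : Measure α) (f : α → EReal) : EReal :=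
  ((∫⁻ x, (f x).toENNReal ∂μ : ℝ≥0∞) : EReal) - ((∫⁻ x, (-f x).toENNReal ∂μ : ℝ≥0∞) : EReal)

section Subharmonic

variable {F : Type*} [NormedAddCommGroup F] [InnerProductSpace ℝ F] [FiniteDimensional ℝ F]
  [MeasurableSpace F] [BorelSpace F]

/-- The rotation invariant probability measure on the unit sphere. -/
def unitSphereMeasure (F : Type*) [NormedAddCommGroup F] [InnerProductSpace ℝ F]
    [FiniteDimensional ℝ F] [MeasurableSpace F] [BorelSpace F] : Measure (sphere (0 : F) 1) :=
  ((volume : Measure F).toSphere univ)⁻¹ • (volume : Measure F).toSphere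

/-- The mean value of `f` over the sphere of centre `c` and radius `r`. -/
def sphereMean (f : F → EReal) (c : F) (r : ℝ) : EReal :=
  erealIntegral (unitSphereMeasure F) (fun θ => f (c + r • (θ : F)))

/-- `f` is subharmonic in `G`: it is upper semi-continuous with values in `[-∞, ∞)` and satisfies
the sub-mean-value inequality for all closed balls in `G`. The constant `-∞` is allowed. -/
structure IsSubharmonicOn (f : F → EReal) (G : Set F) : Prop where
  upperSemicontinuousOn : UpperSemicontinuousOn f G
  ne_top : ∀ x ∈ G, f x ≠ ⊤
  le_sphereMean : ∀ (c : F) (r : ℝ), 0 < r → closedBall c r ⊆ G → f c ≤ sphereMean f c r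

end Subharmonic

/-- `u` is quaternionic plurisubharmonic in `Ω`: it is upper semi-continuous with values in
`[-∞, ∞)` and its restriction to every right quaternionic line is subharmonic. Only the values
of `u` on `Ω` matter. -/
structure IsQPsh {n : ℕ} (Ω : Set (QSpace n)) (u : QSpace n → EReal) : Prop where
  upperSemicontinuousOn : UpperSemicontinuousOn u Ω
  ne_top : ∀ x ∈ Ω, u x ≠ ⊤
  subharmonic_line : ∀ a ξ : QSpace n, ξ ≠ 0 →
    IsSubharmonicOn (fun q => u (rightLine a ξ q)) {q | rightLine a ξ q ∈ Ω}

/-! ### Local integrability and convergence -/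

/-- `u ∈ L¹_loc(Ω)` (in particular `u` is finite almost everywhere in `Ω`). -/
def InL1Loc {n : ℕ} (Ω : Set (QSpace n)) (u : QSpace n → EReal) : Prop :=
  (∀ᵐ x ∂(volume.restrict Ω), u x ≠ ⊥ ∧ u x ≠ ⊤) ∧
    ∀ K : Set (QSpace n), IsCompact K → K ⊆ Ω → IntegrableOn (fun x => (u x).toReal) K

/-- `u_N → v` in `L¹_loc(Ω)`. -/
def TendstoL1Loc {n : ℕ} (Ω : Set (QSpace n)) (u : ℕ → QSpace n → EReal) (v : QSpace n → EReal) :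
    Prop :=
  (∀ N, InL1Loc Ω (u N)) ∧ InL1Loc Ω v ∧
    ∀ K : Set (QSpace n), IsCompact K → K ⊆ Ω →
      Tendsto (fun N => ∫ x in K, |(u N x).toReal - (v x).toReal|) atTop (𝓝 0)

/-- `u_N` is bounded above, uniformly in `N`, on every compact subset of `Ω`. -/
def LocUniformlyBddAbove {n : ℕ} (Ω : Set (QSpace n)) (u : ℕ → QSpace n → EReal) : Prop :=
  ∀ K : Set (QSpace n), IsCompact K → K ⊆ Ω → ∃ M : ℝ, ∀ N, ∀ x ∈ K, u N x ≤ (M : EReal)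

/-- `u_N → -∞` uniformly on every compact subset of `Ω`. -/
def TendstoBotLocUniformly {n : ℕ} (Ω : Set (QSpace n)) (u : ℕ → QSpace n → EReal) : Prop :=
  ∀ K : Set (QSpace n), IsCompact K → K ⊆ Ω →
    ∀ c : ℝ, ∀ᶠ N in atTop, ∀ x ∈ K, u N x < (c : EReal)

/-- `∫_Ω u φ` for a real test function `φ`, where `u` is locally integrable in `Ω`. -/
def pairing {n : ℕ} (Ω : Set (QSpace n)) (u : QSpace n → EReal) (φ : QSpace n → ℝ) : ℝ :=
  ∫ x in Ω, (u x).toReal * φ x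

/-! ### The matrix `(∂²f / ∂q_i ∂q̄_j)` -/

/-- The vector of `ℍⁿ` with `i`-th coordinate `e` and all other coordinates `0`. -/
def coordVec {n : ℕ} (i : Fin n) (e : Quaternion ℝ) : QSpace n :=
  WithLp.toLp 2 (Pi.single i e)

/-- The quaternion units `1, i, j, k`. -/
def qUnit : Fin 4 → Quaternion ℝ := ![⟨1, 0, 0, 0⟩, ⟨0, 1, 0, 0⟩, ⟨0, 0, 1, 0⟩, ⟨0, 0, 0, 1⟩]

/-- `∂f/∂q̄_j = ∂f/∂t_j + i ∂f/∂x_j + j ∂f/∂y_j + k ∂f/∂z_j`. -/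
def dqBar {n : ℕ} (j : Fin n) (f : QSpace n → Quaternion ℝ) (x : QSpace n) : Quaternion ℝ :=
  ∑ a : Fin 4, qUnit a * fderiv ℝ f x (coordVec j (qUnit a))

/-- `∂f/∂q_i = ∂f/∂t_i - (∂f/∂x_i) i - (∂f/∂y_i) j - (∂f/∂z_i) k`. -/
def dq {n : ℕ} (i : Fin n) (f : QSpace n → Quaternion ℝ) (x : QSpace n) : Quaternion ℝ :=
  ∑ a : Fin 4, fderiv ℝ f x (coordVec i (qUnit a)) * star (qUnit a)

/-- The quaternionic matrix `(∂²f / ∂q_i ∂q̄_j)` of a real valued function. -/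
def qHessian {n : ℕ} (f : QSpace n → ℝ) (x : QSpace n) : Matrix (Fin n) (Fin n) (Quaternion ℝ) :=
  Matrix.of fun i j => dq i (dqBar j (fun y => (f y : Quaternion ℝ))) x

/-! ### Measures with values in the hyperhermitian matrices -/

/-- A (Radon) measure on `Ω` with values in the space of hyperhermitian `n × n` matrices, given as
`dμ = h dλ` with a non-negative measure `λ`, finite on the compact subsets of `Ω`, and a density
`h` with values in the hyperhermitian matrices, locally integrable with respect to `λ`. -/
structure HermMeasure {n : ℕ} (Ω : Set (QSpace n)) where
  base : Measure (QSpace n)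
  density : QSpace n → Matrix (Fin n) (Fin n) (Quaternion ℝ)
  base_lt_top : ∀ K : Set (QSpace n), IsCompact K → K ⊆ Ω → base K < ⊤
  isHermitian : ∀ x, (density x).IsHermitian
  integrableOn : ∀ K : Set (QSpace n), IsCompact K → K ⊆ Ω →
    ∀ i j, IntegrableOn (fun x => density x i j) K base

/-- The matrix `∫_Ω φ dμ`. -/
def HermMeasure.integral {n : ℕ} {Ω : Set (QSpace n)} (μ : HermMeasure Ω) (φ : QSpace n → ℝ) :
    Matrix (Fin n) (Fin n) (Quaternion ℝ) :=
  Matrix.of fun i j => ∫ x in Ω, φ x • μ.density x i j ∂μ.base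

/-- `φ` is a continuous real function with compact support in `Ω`. -/
structure IsCcTest {n : ℕ} (Ω : Set (QSpace n)) (φ : QSpace n → ℝ) : Prop where
  continuous : Continuous φ
  hasCompactSupport : HasCompactSupport φ
  tsupport_subset : tsupport φ ⊆ Ω

/-- Weak convergence `μ_N → μ` of matrix valued measures on `Ω`: convergence (of all entries) of
the integrals of every continuous function with compact support in `Ω`. -/
def HermMeasure.TendstoWeakly {n : ℕ} {Ω : Set (QSpace n)} (ν : ℕ → HermMeasure Ω)
    (μ : HermMeasure Ω) : Prop :=
  ∀ φ : QSpace n → ℝ, IsCcTest Ω φ → ∀ i j,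
    Tendsto (fun N => (ν N).integral φ i j) atTop (𝓝 (μ.integral φ i j))

/-! ### The matrix measure of a psh function -/

/-- A standard smoothing kernel: smooth, non-negative, depending only on the norm, supported in
the unit ball, of integral one. -/
structure IsSmoothingKernel {n : ℕ} (χ : QSpace n → ℝ) : Prop where
  contDiff : ContDiff ℝ ∞ χ
  nonneg : ∀ x, 0 ≤ χ x
  radial : ∀ x y, ‖x‖ = ‖y‖ → χ x = χ y
  tsupport_subset : tsupport χ ⊆ closedBall 0 1
  integral_eq_one : ∫ x, χ x = 1

/-- The regularization `u_ε = u ⋆ χ_ε`, `χ_ε(z) = ε⁻⁴ⁿ χ(z / ε)`, of `u ∈ L¹_loc(Ω)`; meaningful at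
the points whose closed `ε`-ball lies in `Ω`. -/
def regularize {n : ℕ} (χ : QSpace n → ℝ) (Ω : Set (QSpace n)) (u : QSpace n → EReal) (ε : ℝ)
    (x : QSpace n) : ℝ :=
  ∫ y in Ω, (u y).toReal * ((ε ^ (4 * n))⁻¹ * χ (ε⁻¹ • (x - y)))

/-- `μ` is the matrix measure `(∂²u / ∂q_i ∂q̄_j)` on `Ω`: the weak limit, as `ε → 0`, of the
measures `(∂²u_ε / ∂q_i ∂q̄_j) dvol`, for every choice of the smoothing kernel. (For a test function
`φ`, the functions `u_ε` are smooth near the support of `φ` as soon as `ε` is small.) -/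
def IsHessianMeasure {n : ℕ} (Ω : Set (QSpace n)) (u : QSpace n → EReal) (μ : HermMeasure Ω) :
    Prop :=
  ∀ χ : QSpace n → ℝ, IsSmoothingKernel χ → ∀ φ : QSpace n → ℝ, IsCcTest Ω φ → ∀ i j,
    Tendsto (fun ε : ℝ => ∫ x in Ω, φ x • qHessian (regularize χ Ω u ε) x i j)
      (𝓝[>] (0 : ℝ)) (𝓝 (μ.integral φ i j))

end

/-!
Everything rests on one inequality. Write `x + ξ q` for the points of the right quaternionic line
through `x` with direction `ξ`. Averaging the sub-mean value inequality on the spheres of these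
lines over all directions `ξ`, weighted by a function `w(ξ)` that is invariant under right
multiplication by unit quaternions, shows that a psh function `u` lies below its mean with respect
to `w` (`IsQPsh.lintegral_mul_gap_le`); in particular it is subharmonic on `ℍⁿ`. The integrals are
taken of the gap `M - u ≥ 0`, with values in `[0, ∞]`, where `M` is an upper bound of `u`.

*Compactness.* If the `u_N` are locally uniformly bounded above, a lower bound at one point of
every `u_N` bounds the `L¹` norms near that point, and hence, by connectedness, on all compact
subsets (`locGapBdd_of_le`, `locGapBdd_of_isPreconnected`). Along a subsequence all mollifications
`u_N ⋆ κ_k` converge pointwise. Since `u_N ≤ u_N ⋆ κ`, the integral of `|u_N ⋆ κ - u_N|` over a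
compact set is essentially the difference of the masses of `u_N ⋆ κ` and `u_N`, which is small
uniformly in `N` (`setIntegral_abs_convolution_sub_le`); so the subsequence is Cauchy in `L¹_loc`
(`exists_tendstoL1Loc`). A limit in `L¹_loc` of psh functions agrees almost everywhere with the
infimum of its mollifications, which is psh (`isQPsh_regularizedInf`). This gives both claims
of (i).

*Hessian measures.* The second differences of a psh function along the lines of direction `ξ`,
averaged over unit quaternions, are non-negative. Hence the Laplacian of `u` along these lines is
a positive distribution (`IsQPsh.integral_cut_mul_lineLap_nonneg`), that is, a measure `m ξ`
(`exists_measure_of_nonneg`). Polarization writes every entry of the quaternionic Hessian as a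
combination of such Laplacians (`qHessian_eq_sum_lineLap`), so that the Hessian measure exists and
its entries are combinations of the `m ξ` (`IsLineMeasure.isHessianMeasure`). Convergence in
`L¹_loc` gives convergence of the integrals of smooth test functions against `m ξ`, and positivity
upgrades this to weak convergence (`tendsto_integral_of_smoothTest`).
-/

open scoped Convolution

/-! ### Right multiplication on `ℍⁿ` and the measure of the unit sphere of `ℍ` -/

section RightMultiplication

variable {n : ℕ}

/-- The column `ξ q`, for a column `ξ` and a quaternion `q`. -/
noncomputable def rightMul (ξ : QSpace n) (q : Quaternion ℝ) : QSpace n :=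
  WithLp.toLp 2 (fun i => ξ i * q)

@[simp] lemma rightMul_apply (ξ : QSpace n) (q : Quaternion ℝ) (i : Fin n) :
    rightMul ξ q i = ξ i * q := rfl

lemma rightLine_eq_add (a ξ : QSpace n) (q : Quaternion ℝ) :
    rightLine a ξ q = a + rightMul ξ q := rfl

lemma norm_rightMul (ξ : QSpace n) (q : Quaternion ℝ) : ‖rightMul ξ q‖ = ‖ξ‖ * ‖q‖ := by
  rw [PiLp.norm_eq_of_L2, PiLp.norm_eq_of_L2]
  simp only [rightMul_apply, norm_mul, mul_pow]
  rw [← Finset.sum_mul, Real.sqrt_mul (Finset.sum_nonneg fun i _ => sq_nonneg _),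
    Real.sqrt_sq (norm_nonneg q)]

lemma rightMul_add_left (x y : QSpace n) (q : Quaternion ℝ) :
    rightMul (x + y) q = rightMul x q + rightMul y q := by ext1 i; simp [add_mul]

lemma rightMul_add_right (x : QSpace n) (p q : Quaternion ℝ) :
    rightMul x (p + q) = rightMul x p + rightMul x q := by ext1 i; simp [mul_add]

lemma rightMul_smul_left (c : ℝ) (x : QSpace n) (q : Quaternion ℝ) :
    rightMul (c • x) q = c • rightMul x q := by ext1 i; simp

lemma rightMul_smul_right (c : ℝ) (x : QSpace n) (q : Quaternion ℝ) :
    rightMul x (c • q) = c • rightMul x q := by ext1 i; simp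

lemma rightMul_mul (x : QSpace n) (p q : Quaternion ℝ) :
    rightMul x (p * q) = rightMul (rightMul x p) q := by ext1 i; simp [mul_assoc]

lemma rightMul_one (x : QSpace n) : rightMul x 1 = x := by ext1 i; simp

lemma rightMul_zero_left (q : Quaternion ℝ) : rightMul (0 : QSpace n) q = 0 := by ext1 i; simp

lemma rightMul_zero_right (x : QSpace n) : rightMul x 0 = 0 := by ext1 i; simp

@[fun_prop]
lemma Continuous.rightMul {X : Type*} [TopologicalSpace X] {f : X → QSpace n}
    {g : X → Quaternion ℝ} (hf : Continuous f) (hg : Continuous g) :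
    Continuous fun x => rightMul (f x) (g x) := by
  unfold _root_.rightMul
  fun_prop

/-- Right multiplication by a unit quaternion is an isometry of `ℍⁿ`. -/
noncomputable def rightMulIsometry (q : Quaternion ℝ) (hq : ‖q‖ = 1) : QSpace n ≃ₗᵢ[ℝ] QSpace n :=
  have h0 : q ≠ 0 := by rintro rfl; simp at hq
  { toFun := fun ξ => rightMul ξ q
    invFun := fun ξ => rightMul ξ q⁻¹
    map_add' := fun x y => rightMul_add_left x y q
    map_smul' := fun c x => rightMul_smul_left c x q
    left_inv := fun x => by
      change rightMul (rightMul x q) q⁻¹ = x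
      rw [← rightMul_mul, mul_inv_cancel₀ h0, rightMul_one]
    right_inv := fun x => by
      change rightMul (rightMul x q⁻¹) q = x
      rw [← rightMul_mul, inv_mul_cancel₀ h0, rightMul_one]
    norm_map' := fun x => by
      change ‖rightMul x q‖ = ‖x‖
      rw [norm_rightMul, hq, mul_one] }

lemma measurePreserving_rightMul (q : Quaternion ℝ) (hq : ‖q‖ = 1) :
    MeasurePreserving (fun ξ : QSpace n => rightMul ξ q) volume volume :=
  (rightMulIsometry q hq).measurePreserving

lemma measurableEmbedding_rightMul (q : Quaternion ℝ) (hq : ‖q‖ = 1) :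
    MeasurableEmbedding (fun ξ : QSpace n => rightMul ξ q) :=
  (rightMulIsometry q hq).toHomeomorph.measurableEmbedding

end RightMultiplication

section SphereMeasure

/-- The rotation invariant probability measure on the unit sphere of `ℍ`. -/
noncomputable abbrev unitQuaternionMeasure : Measure (sphere (0 : Quaternion ℝ) 1) :=
  unitSphereMeasure (Quaternion ℝ)

instance : IsProbabilityMeasure unitQuaternionMeasure := by
  constructor
  rw [unitQuaternionMeasure, unitSphereMeasure, Measure.smul_apply, smul_eq_mul]
  refine ENNReal.inv_mul_cancel ?_ (measure_ne_top _ _)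
  rw [Ne, Measure.measure_univ_eq_zero]
  exact Measure.toSphere_ne_zero _

lemma norm_unitQuaternion (θ : sphere (0 : Quaternion ℝ) 1) : ‖(θ : Quaternion ℝ)‖ = 1 :=
  mem_sphere_zero_iff_norm.1 θ.2

open scoped Pointwise in
/-- Right multiplication by a unit quaternion preserves the measure of the unit sphere. -/
lemma measurePreserving_mul_unitQuaternion (p : sphere (0 : Quaternion ℝ) 1) :
    MeasurePreserving (fun θ : sphere (0 : Quaternion ℝ) 1 => θ * p)
      unitQuaternionMeasure unitQuaternionMeasure := by
  have hp : (p : Quaternion ℝ) ≠ 0 := by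
    intro h; have := norm_unitQuaternion p; simp [h] at this
  let A : Quaternion ℝ ≃ₗᵢ[ℝ] Quaternion ℝ :=
    { toFun := fun x => x * p
      invFun := fun x => x * (p : Quaternion ℝ)⁻¹
      map_add' := fun x y => add_mul x y _
      map_smul' := fun c x => by simp
      left_inv := fun x => by
        change x * (p : Quaternion ℝ) * (p : Quaternion ℝ)⁻¹ = x
        rw [mul_assoc, mul_inv_cancel₀ hp, mul_one]
      right_inv := fun x => by
        change x * (p : Quaternion ℝ)⁻¹ * (p : Quaternion ℝ) = x
        rw [mul_assoc, inv_mul_cancel₀ hp, mul_one]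
      norm_map' := fun x => by
        change ‖x * (p : Quaternion ℝ)‖ = ‖x‖
        rw [norm_mul, norm_unitQuaternion, mul_one] }
  have hA : ∀ x, A x = x * p := fun _ => rfl
  have hc : Continuous (fun θ : sphere (0 : Quaternion ℝ) 1 => θ * p) :=
    continuous_id.mul continuous_const
  have key : MeasurePreserving (fun θ : sphere (0 : Quaternion ℝ) 1 => θ * p)
      (volume : Measure (Quaternion ℝ)).toSphere (volume : Measure (Quaternion ℝ)).toSphere := by
    refine ⟨hc.measurable, ?_⟩
    ext s hs
    rw [Measure.map_apply hc.measurable hs, Measure.toSphere_apply' _ (hc.measurable hs),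
      Measure.toSphere_apply' _ hs]
    congr 1
    have hset : Ioo (0 : ℝ) 1 • (Subtype.val '' ((fun θ => θ * p) ⁻¹' s)) =
        A ⁻¹' (Ioo (0 : ℝ) 1 • (Subtype.val '' s)) := by
      ext x
      simp only [Set.mem_smul, mem_image, mem_preimage, hA]
      constructor
      · rintro ⟨r, hr, _, ⟨θ, hθ, rfl⟩, rfl⟩
        exact ⟨r, hr, _, ⟨_, hθ, rfl⟩, by simp⟩
      · rintro ⟨r, hr, _, ⟨θ, hθ, rfl⟩, h⟩
        refine ⟨r, hr, _, ⟨θ * p⁻¹, ?_, rfl⟩, ?_⟩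
        · simpa using hθ
        · have : x = (r • (θ : Quaternion ℝ)) * (p : Quaternion ℝ)⁻¹ := by
            rw [h, mul_assoc, mul_inv_cancel₀ hp, mul_one]
          rw [this, smul_mul_assoc]
          rfl
    rw [hset]
    exact A.measurePreserving.measure_preimage_equiv (f := A.toMeasurableEquiv) _
  refine ⟨hc.measurable, ?_⟩
  rw [unitQuaternionMeasure, unitSphereMeasure, Measure.map_smul, key.map_eq]

end SphereMeasure

/-! ### Integrals of extended real valued functions -/

section ERealIntegral

/-- For functions bounded above by a non-negative constant `M`, the integral `∫ f⁺ - ∫ f⁻` is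
`M - ∫ (M - f)`: all statements about it reduce to the Lebesgue integral of `M - f ≥ 0`. -/
lemma erealIntegral_eq_sub {α : Type*} [MeasurableSpace α] (μ : Measure α) [IsProbabilityMeasure μ]
    {f : α → EReal} (hf : Measurable f) {M : ℝ} (hM : 0 ≤ M) (hfM : ∀ x, f x ≤ M) :
    erealIntegral μ f = (M : EReal) - ((∫⁻ x, ((M : EReal) - f x).toENNReal ∂μ : ℝ≥0∞) : EReal) := by
  have hpt : ∀ x, (f x).toENNReal + ((M : EReal) - f x).toENNReal
      = ENNReal.ofReal M + (-f x).toENNReal := by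
    intro x
    have := hfM x
    induction h : f x with
    | bot => simp
    | top => rw [h] at this; simp at this
    | coe y =>
      rw [h] at this
      have hy : y ≤ M := by exact_mod_cast this
      rw [← EReal.coe_sub, ← EReal.coe_neg, EReal.real_coe_toENNReal, EReal.real_coe_toENNReal,
        EReal.real_coe_toENNReal]
      rcases le_total 0 y with h0 | h0
      · rw [ENNReal.ofReal_of_nonpos (by linarith : -y ≤ 0),
          ← ENNReal.ofReal_add h0 (by linarith)]
        simp
      · rw [ENNReal.ofReal_of_nonpos h0, ← ENNReal.ofReal_add hM (by linarith)]
        rw [zero_add, sub_eq_add_neg]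
  have hm : Measurable fun x => (f x).toENNReal := hf.ereal_toENNReal
  have hI := lintegral_congr (μ := μ) hpt
  rw [lintegral_add_left hm, lintegral_add_left measurable_const, lintegral_const, measure_univ,
    mul_one] at hI
  have hA : ∫⁻ x, (f x).toENNReal ∂μ ≠ ⊤ := by
    refine ne_top_of_le_ne_top (ENNReal.ofReal_ne_top (r := M)) ?_
    calc ∫⁻ x, (f x).toENNReal ∂μ ≤ ∫⁻ _, ENNReal.ofReal M ∂μ := by
          refine lintegral_mono fun x => ?_
          exact (EReal.toENNReal_le_toENNReal (hfM x)).trans_eq (EReal.real_coe_toENNReal M)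
      _ = ENNReal.ofReal M := by simp
  unfold erealIntegral
  generalize ∫⁻ x, (f x).toENNReal ∂μ = A at hI hA ⊢
  generalize ∫⁻ x, (-f x).toENNReal ∂μ = B at hI ⊢
  generalize ∫⁻ x, ((M : EReal) - f x).toENNReal ∂μ = I at hI ⊢
  by_cases hB : B = ⊤
  · have : I = ⊤ := by
      rw [hB, add_top] at hI
      exact (ENNReal.add_eq_top.1 hI).resolve_left hA
    rw [hB, this]
    lift A to NNReal using hA
    simp only [EReal.coe_ennreal_top]
    rfl
  · have hI' : I ≠ ⊤ := by
      intro h; rw [h, add_top] at hI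
      exact ENNReal.add_ne_top.2 ⟨ENNReal.ofReal_ne_top, hB⟩ hI.symm
    lift A to NNReal using hA
    lift B to NNReal using hB
    lift I to NNReal using hI'
    have : (A : ℝ) + I = M + B := by
      have := congrArg ENNReal.toReal hI
      rwa [ENNReal.toReal_add (by simp) (by simp), ENNReal.toReal_add (by simp) (by simp),
        ENNReal.toReal_ofReal hM] at this
    have h2 : ∀ z : NNReal, (((z : ℝ≥0∞) : EReal)) = ((z : ℝ) : EReal) := fun _ => rfl
    rw [h2, h2, h2, ← EReal.coe_sub, ← EReal.coe_sub]
    congr 1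
    linarith

lemma le_erealIntegral_iff {α : Type*} [MeasurableSpace α] (μ : Measure α) [IsProbabilityMeasure μ]
    {f : α → EReal} (hf : Measurable f) {M : ℝ} (hM : 0 ≤ M) (hfM : ∀ x, f x ≤ M) {c : EReal}
    (hc : c ≤ M) :
    c ≤ erealIntegral μ f ↔
      ∫⁻ x, ((M : EReal) - f x).toENNReal ∂μ ≤ ((M : EReal) - c).toENNReal := by
  rw [erealIntegral_eq_sub μ hf hM hfM]
  generalize ∫⁻ x, ((M : EReal) - f x).toENNReal ∂μ = I
  induction c with
  | bot => simp
  | top => simp at hc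
  | coe y =>
    have hy : y ≤ M := by exact_mod_cast hc
    rw [← EReal.coe_sub, EReal.real_coe_toENNReal]
    by_cases hI : I = ⊤
    · rw [hI]
      simp
    · lift I to NNReal using hI
      have h2 : (((I : ℝ≥0∞) : EReal)) = ((I : ℝ) : EReal) := rfl
      rw [h2, ← EReal.coe_sub, EReal.coe_le_coe_iff, ← ENNReal.ofReal_coe_nnreal,
        ENNReal.ofReal_le_ofReal_iff (by linarith)]
      constructor <;> intro h <;> linarith

end ERealIntegral

/-! ### Sub-mean value inequalities for psh functions -/

section MeanValue

variable {n : ℕ} {Ω : Set (QSpace n)} {u : QSpace n → EReal} {M : ℝ}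

/-- The non-negative function `M - u` on `Ω`, extended by zero. For a psh function `u ≤ M` it is
measurable and superharmonic along right quaternionic lines. -/
noncomputable def gap (Ω : Set (QSpace n)) (u : QSpace n → EReal) (M : ℝ) : QSpace n → ℝ≥0∞ :=
  Ω.indicator fun x => ((M : EReal) - u x).toENNReal

lemma gap_of_mem {x : QSpace n} (hx : x ∈ Ω) :
    gap Ω u M x = ((M : EReal) - u x).toENNReal := indicator_of_mem hx _

lemma UpperSemicontinuousOn.measurable_domRestrict {u : QSpace n → EReal}
    (hu : UpperSemicontinuousOn u Ω) : Measurable (Ω.domRestrict u) := by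
  refine UpperSemicontinuous.measurable fun x y hy => ?_
  have := hu x x.2 y hy
  rw [← map_nhds_subtype_val, eventually_map] at this
  exact this

lemma UpperSemicontinuousOn.measurable_comp {X : Type*} [TopologicalSpace X] [MeasurableSpace X]
    [OpensMeasurableSpace X] {u : QSpace n → EReal} (hu : UpperSemicontinuousOn u Ω)
    {g : X → QSpace n} (hg : Continuous g) (hgΩ : ∀ x, g x ∈ Ω) : Measurable fun x => u (g x) := by
  have hc : Continuous fun x => (⟨g x, hgΩ x⟩ : Ω) := Continuous.subtype_mk hg _
  exact hu.measurable_domRestrict.comp hc.measurable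

lemma measurable_gap (hΩ : IsOpen Ω) (hu : UpperSemicontinuousOn u Ω) :
    Measurable (gap Ω u M) := by
  refine measurable_of_restrict_of_restrict_compl hΩ.measurableSet ?_ ?_
  · have : Ω.domRestrict (gap Ω u M) = fun x => ((M : EReal) - Ω.domRestrict u x).toENNReal := by
      ext x; exact gap_of_mem x.2
    rw [this]
    exact (measurable_const.sub hu.measurable_domRestrict).ereal_toENNReal
  · have : Ωᶜ.domRestrict (gap Ω u M) = fun _ => 0 := by
      ext x; change gap Ω u M x = 0; exact indicator_of_notMem (s := Ω) x.2 _
    rw [this]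
    exact measurable_const

lemma toENNReal_sub_le_add (M M' : ℝ) (a : EReal) :
    ((M' : EReal) - a).toENNReal ≤ ((M : EReal) - a).toENNReal + ENNReal.ofReal (M' - M) := by
  induction a with
  | bot => simp
  | top => simp
  | coe y =>
    rw [← EReal.coe_sub, ← EReal.coe_sub, EReal.real_coe_toENNReal, EReal.real_coe_toENNReal]
    have : M' - y = (M - y) + (M' - M) := by ring
    rw [this]
    exact ENNReal.ofReal_add_le

lemma enorm_toReal_le (M : ℝ) (hM : 0 ≤ M) (a : EReal) (ha : a ≤ M) :
    ‖a.toReal‖ₑ ≤ ((M : EReal) - a).toENNReal + ENNReal.ofReal M := by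
  induction a with
  | bot => simp
  | top => simp
  | coe y =>
    have hy : y ≤ M := by exact_mod_cast ha
    rw [← EReal.coe_sub, EReal.real_coe_toENNReal, ← ENNReal.ofReal_add (by linarith) hM,
      Real.enorm_eq_ofReal_abs, EReal.toReal_coe]
    refine ENNReal.ofReal_le_ofReal ?_
    rw [abs_le]; constructor <;> linarith

/-- The sub-mean value inequality on the discs of right quaternionic lines. -/
lemma IsQPsh.lintegral_gap_line_le (hu : IsQPsh Ω u) {x ξ : QSpace n}
    (hb : ∀ q : Quaternion ℝ, ‖q‖ ≤ 1 → x + rightMul ξ q ∈ Ω) (hM : 0 ≤ M)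
    (huM : ∀ q : Quaternion ℝ, ‖q‖ ≤ 1 → u (x + rightMul ξ q) ≤ M) :
    ∫⁻ θ, gap Ω u M (x + rightMul ξ (θ : Quaternion ℝ)) ∂unitQuaternionMeasure
      ≤ gap Ω u M x := by
  have hx : x ∈ Ω := by simpa [rightMul_zero_right] using hb 0 (by simp)
  have hxM : u x ≤ M := by simpa [rightMul_zero_right] using huM 0 (by simp)
  have hmem : ∀ θ : sphere (0 : Quaternion ℝ) 1, x + rightMul ξ (θ : Quaternion ℝ) ∈ Ω :=
    fun θ => hb _ (norm_unitQuaternion θ).le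
  by_cases hξ : ξ = 0
  · simp [hξ, rightMul_zero_left]
  have h := (hu.subharmonic_line x ξ hξ).le_sphereMean 0 1 one_pos (by
    intro q hq
    exact hb q (by simpa using hq))
  rw [sphereMean] at h
  have hmeas : Measurable fun θ : sphere (0 : Quaternion ℝ) 1 =>
      u (rightLine x ξ (0 + (1 : ℝ) • (θ : Quaternion ℝ))) := by
    have := hu.upperSemicontinuousOn.measurable_comp
      (g := fun θ : sphere (0 : Quaternion ℝ) 1 => x + rightMul ξ (θ : Quaternion ℝ))
      (by fun_prop) hmem
    simpa [rightLine_eq_add] using this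
  rw [le_erealIntegral_iff unitQuaternionMeasure hmeas hM
    (by intro θ; simpa [rightLine_eq_add] using huM _ (norm_unitQuaternion θ).le)
    (by simpa [rightLine_eq_add, rightMul_zero_right] using hxM)] at h
  simp only [zero_add, one_smul, rightLine_eq_add, rightMul_zero_right, add_zero] at h
  rw [gap_of_mem hx]
  refine le_trans (le_of_eq (lintegral_congr fun θ => ?_)) h
  exact gap_of_mem (hmem θ)

/-- The sub-mean value inequality for the means over `ℍⁿ` with a weight that is invariant under
right multiplication by unit quaternions: the mean over `ξ` is the mean over `ξ` of the means
over the spheres `x + ξ q`, `|q| = 1`. -/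
lemma IsQPsh.lintegral_mul_gap_le (hΩ : IsOpen Ω) (hu : IsQPsh Ω u) {x : QSpace n} {r : ℝ}
    (hb : closedBall x r ⊆ Ω) (hM : 0 ≤ M) (huM : ∀ y ∈ closedBall x r, u y ≤ M)
    {w : QSpace n → ℝ≥0∞} (hw : Measurable w)
    (hinv : ∀ ξ, ∀ θ : sphere (0 : Quaternion ℝ) 1, w (rightMul ξ (θ : Quaternion ℝ)) = w ξ)
    (hsupp : ∀ ξ, w ξ ≠ 0 → ‖ξ‖ ≤ r) :
    ∫⁻ ξ, w ξ * gap Ω u M (x + ξ) ≤ (∫⁻ ξ, w ξ) * gap Ω u M x := by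
  have hg : Measurable (gap Ω u M) := measurable_gap hΩ hu.upperSemicontinuousOn
  calc ∫⁻ ξ, w ξ * gap Ω u M (x + ξ)
      = ∫⁻ θ : sphere (0 : Quaternion ℝ) 1, (∫⁻ ξ, w ξ * gap Ω u M (x + ξ))
          ∂unitQuaternionMeasure := by simp
    _ = ∫⁻ θ : sphere (0 : Quaternion ℝ) 1,
          (∫⁻ ξ, w ξ * gap Ω u M (x + rightMul ξ (θ : Quaternion ℝ)))
          ∂unitQuaternionMeasure := by
        refine lintegral_congr fun θ => ?_
        rw [← (measurePreserving_rightMul (n := n) (θ : Quaternion ℝ)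
          (norm_unitQuaternion θ)).lintegral_comp_emb
          (measurableEmbedding_rightMul _ (norm_unitQuaternion θ))]
        simp only [hinv]
    _ = ∫⁻ ξ, ∫⁻ θ : sphere (0 : Quaternion ℝ) 1,
          w ξ * gap Ω u M (x + rightMul ξ (θ : Quaternion ℝ)) ∂unitQuaternionMeasure := by
        refine lintegral_lintegral_swap (Measurable.aemeasurable ?_)
        refine (hw.comp measurable_snd).mul (hg.comp ?_)
        have : Continuous fun z : sphere (0 : Quaternion ℝ) 1 × QSpace n =>
          x + rightMul z.2 (z.1 : Quaternion ℝ) := by fun_prop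
        exact this.measurable
    _ ≤ ∫⁻ ξ, w ξ * gap Ω u M x := by
        refine lintegral_mono fun ξ => ?_
        have hm : Measurable fun θ : sphere (0 : Quaternion ℝ) 1 =>
            gap Ω u M (x + rightMul ξ (θ : Quaternion ℝ)) :=
          hg.comp (Continuous.measurable (by fun_prop))
        change (∫⁻ θ : sphere (0 : Quaternion ℝ) 1,
          w ξ * gap Ω u M (x + rightMul ξ (θ : Quaternion ℝ)) ∂unitQuaternionMeasure) ≤ _
        rw [lintegral_const_mul _ hm]
        by_cases h0 : w ξ = 0
        · simp [h0]
        have hmem : ∀ q : Quaternion ℝ, ‖q‖ ≤ 1 → x + rightMul ξ q ∈ closedBall x r := by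
          intro q hq
          rw [mem_closedBall, dist_self_add_left, norm_rightMul]
          exact (mul_le_of_le_one_right (norm_nonneg _) hq).trans (hsupp ξ h0)
        gcongr
        exact hu.lintegral_gap_line_le (fun q hq => hb (hmem q hq)) hM
          (fun q hq => huM _ (hmem q hq))
    _ = (∫⁻ ξ, w ξ) * gap Ω u M x := lintegral_mul_const _ hw

/-- The sub-mean value inequality on balls of `ℍⁿ`. -/
lemma IsQPsh.setLIntegral_gap_closedBall_le (hΩ : IsOpen Ω) (hu : IsQPsh Ω u) {x : QSpace n} {r : ℝ}
    (hb : closedBall x r ⊆ Ω) (hM : 0 ≤ M) (huM : ∀ y ∈ closedBall x r, u y ≤ M) :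
    ∫⁻ y in closedBall x r, gap Ω u M y
      ≤ volume (closedBall (0 : QSpace n) r) * gap Ω u M x := by
  have h := hu.lintegral_mul_gap_le hΩ hb hM huM
    (w := (closedBall (0 : QSpace n) r).indicator 1)
    (measurable_one.indicator measurableSet_closedBall)
    (fun ξ θ => by
      simp only [indicator, mem_closedBall, dist_zero_right, norm_rightMul, norm_unitQuaternion,
        mul_one, Pi.one_apply])
    (fun ξ hξ => by simpa using mem_of_indicator_ne_zero hξ)
  rw [lintegral_indicator_one measurableSet_closedBall] at h
  refine le_trans (le_of_eq ?_) h
  rw [← lintegral_indicator measurableSet_closedBall, ← lintegral_add_left_eq_self _ x]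
  refine lintegral_congr fun ξ => ?_
  by_cases hξ : ξ ∈ closedBall (0 : QSpace n) r
  · rw [indicator_of_mem hξ, indicator_of_mem (by simpa using hξ)]; simp
  · rw [indicator_of_notMem hξ, indicator_of_notMem (by simpa using hξ)]; simp

end MeanValue

/-! ### Uniform bounds in `L¹_loc` -/

section LocalBounds

variable {n : ℕ} {Ω : Set (QSpace n)} {u : ℕ → QSpace n → EReal}

/-- Near `x`, the functions `u N` are uniformly bounded above and in `L¹`. -/
def LocGapBdd (Ω : Set (QSpace n)) (u : ℕ → QSpace n → EReal) (x : QSpace n) : Prop :=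
  ∃ r > 0, ∃ M : ℝ, 0 ≤ M ∧ closedBall x r ⊆ Ω ∧ (∀ N, ∀ y ∈ closedBall x r, u N y ≤ M) ∧
    ∃ C : ℝ≥0∞, C ≠ ⊤ ∧ ∀ N, ∫⁻ y in closedBall x r, gap Ω (u N) M y ≤ C

/-- Bounded families in `L¹_loc(Ω)`. -/
def L1LocBdd (Ω : Set (QSpace n)) (u : ℕ → QSpace n → EReal) : Prop :=
  ∀ K : Set (QSpace n), IsCompact K → K ⊆ Ω →
    ∃ C : ℝ≥0∞, C ≠ ⊤ ∧ ∀ N, ∫⁻ y in K, ‖(u N y).toReal‖ₑ ≤ C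

lemma LocUniformlyBddAbove.exists_nonneg (hb : LocUniformlyBddAbove Ω u) {K : Set (QSpace n)}
    (hK : IsCompact K) (hKΩ : K ⊆ Ω) : ∃ M : ℝ, 0 ≤ M ∧ ∀ N, ∀ y ∈ K, u N y ≤ M := by
  obtain ⟨M, hM⟩ := hb K hK hKΩ
  refine ⟨max M 0, le_max_right _ _, fun N y hy => (hM N y hy).trans ?_⟩
  exact_mod_cast le_max_left M 0

lemma exists_closedBall_subset_of_isOpen (hΩ : IsOpen Ω) {x : QSpace n} (hx : x ∈ Ω) :
    ∃ r > 0, closedBall x r ⊆ Ω :=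
  nhds_basis_closedBall.mem_iff.1 (hΩ.mem_nhds hx)

/-- If the values of `u N` at the points of a sequence converging to `x` are bounded below, then
the sub-mean value inequality on balls bounds the `u N` near `x`. -/
lemma locGapBdd_of_le (hΩ : IsOpen Ω) (hu : ∀ N, IsQPsh Ω (u N)) {x : QSpace n} {r M c : ℝ}
    (hr : 0 < r) (hM : 0 ≤ M) (hb : closedBall x (5 * r) ⊆ Ω)
    (huM : ∀ N, ∀ y ∈ closedBall x (5 * r), u N y ≤ M)
    (hc : ∀ N, ∃ y ∈ closedBall x (2 * r), (c : EReal) ≤ u N y) : LocGapBdd Ω u x := by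
  have hsub : closedBall x r ⊆ closedBall x (5 * r) := closedBall_subset_closedBall (by linarith)
  refine ⟨r, hr, M, hM, hsub.trans hb, fun N y hy => huM N y (hsub hy),
    volume (closedBall (0 : QSpace n) (3 * r)) * ENNReal.ofReal (M - c),
    ENNReal.mul_ne_top (measure_closedBall_lt_top).ne ENNReal.ofReal_ne_top, fun N => ?_⟩
  obtain ⟨y, hy, hcy⟩ := hc N
  have hyx : dist y x ≤ 2 * r := hy
  -- the radii are chosen so that `B(x, r) ⊆ B(y, 3r) ⊆ B(x, 5r)` for every `y ∈ B(x, 2r)`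
  have h1 : closedBall x r ⊆ closedBall y (3 * r) :=
    closedBall_subset_closedBall' (by rw [dist_comm]; linarith)
  have h2 : closedBall y (3 * r) ⊆ closedBall x (5 * r) :=
    closedBall_subset_closedBall' (by linarith)
  calc ∫⁻ z in closedBall x r, gap Ω (u N) M z
      ≤ ∫⁻ z in closedBall y (3 * r), gap Ω (u N) M z := lintegral_mono_set h1
    _ ≤ volume (closedBall (0 : QSpace n) (3 * r)) * gap Ω (u N) M y :=
        (hu N).setLIntegral_gap_closedBall_le hΩ (h2.trans hb) hM fun z hz => huM N z (h2 hz)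
    _ ≤ _ := by
        gcongr
        rw [gap_of_mem (hb (closedBall_subset_closedBall (by linarith) hy))]
        rw [← EReal.real_coe_toENNReal, EReal.coe_sub]
        exact EReal.toENNReal_le_toENNReal (EReal.sub_le_sub le_rfl hcy)

/-- Local bounds propagate through the connected open set `Ω`. -/
lemma locGapBdd_of_isPreconnected (hΩ : IsOpen Ω) (hconn : IsPreconnected Ω)
    (hu : ∀ N, IsQPsh Ω (u N)) (hb : LocUniformlyBddAbove Ω u) {x₀ : QSpace n} (hx₀ : x₀ ∈ Ω)
    (h₀ : LocGapBdd Ω u x₀) : ∀ x ∈ Ω, LocGapBdd Ω u x := by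
  have hopen : IsOpen {x | LocGapBdd Ω u x} := by
    rw [Metric.isOpen_iff]
    rintro x ⟨r, hr, M, hM, hball, huM, C, hC, hint⟩
    refine ⟨r / 2, half_pos hr, fun y hy => ?_⟩
    have hsub : closedBall y (r / 2) ⊆ closedBall x r :=
      closedBall_subset_closedBall' (by rw [mem_ball] at hy; linarith)
    exact ⟨r / 2, half_pos hr, M, hM, hsub.trans hball, fun N z hz => huM N z (hsub hz), C, hC,
      fun N => (lintegral_mono_set hsub).trans (hint N)⟩
  refine hconn.subset_of_closure_inter_subset hopen ⟨x₀, hx₀, h₀⟩ ?_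
  rintro x ⟨hxc, hxΩ⟩
  -- Near a limit point `x` of the good points there is a ball `V` on which the means of the gaps
  -- are bounded. Every `u N` is then bounded below at some point of `V`, where its gap is at most
  -- the mean.
  obtain ⟨r₀, hr₀, hball₀⟩ := exists_closedBall_subset_of_isOpen hΩ hxΩ
  obtain ⟨r, hr, rfl⟩ : ∃ r > 0, r₀ = 5 * r := ⟨r₀ / 5, by positivity, by ring⟩
  obtain ⟨M, hM, huM⟩ := hb.exists_nonneg (isCompact_closedBall x (5 * r)) hball₀
  obtain ⟨y, ⟨s, hs, M₁, hM₁, hball, hyM, C, hC, hint⟩, hxy⟩ := Metric.mem_closure_iff.1 hxc r hr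
  set V := closedBall y (min s r)
  have hVpos : volume V ≠ 0 := (measure_closedBall_pos volume y (lt_min hs hr)).ne'
  have hVtop : volume V ≠ ⊤ := measure_closedBall_lt_top.ne
  have hVx : V ⊆ closedBall x (2 * r) := closedBall_subset_closedBall' (by
    rw [dist_comm y x]; linarith [min_le_right s r])
  set C₂ := C + ENNReal.ofReal (M - M₁) * volume V
  have hC₂ : C₂ ≠ ⊤ := ENNReal.add_ne_top.2 ⟨hC, ENNReal.mul_ne_top ENNReal.ofReal_ne_top hVtop⟩
  have hB : C₂ / volume V ≠ ⊤ := ENNReal.div_ne_top hC₂ hVpos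
  refine locGapBdd_of_le hΩ hu hr hM hball₀ huM (c := M - (C₂ / volume V).toReal) fun N => ?_
  have hmeas := measurable_gap (M := M) hΩ (hu N).upperSemicontinuousOn
  obtain ⟨z, hzV, hz⟩ := exists_le_setLAverage hVpos hVtop (f := gap Ω (u N) M)
    hmeas.aemeasurable
  refine ⟨z, hVx hzV, ?_⟩
  have hzΩ : z ∈ Ω := hball₀ (closedBall_subset_closedBall (by linarith) (hVx hzV))
  have h1 : ∫⁻ y in V, gap Ω (u N) M y ≤ C₂ := by
    calc ∫⁻ y in V, gap Ω (u N) M y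
        ≤ ∫⁻ y in V, (gap Ω (u N) M₁ y + ENNReal.ofReal (M - M₁)) := by
          refine lintegral_mono fun y => ?_
          by_cases hy : y ∈ Ω
          · rw [gap_of_mem hy, gap_of_mem hy]; exact toENNReal_sub_le_add _ _ _
          · simp [gap, hy]
      _ = (∫⁻ y in V, gap Ω (u N) M₁ y) + ENNReal.ofReal (M - M₁) * volume V := by
          rw [lintegral_add_right _ measurable_const, setLIntegral_const]
      _ ≤ C₂ := by
          refine add_le_add ?_ le_rfl
          exact (lintegral_mono_set (closedBall_subset_closedBall (min_le_left _ _))).trans (hint N)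
  have h2 : gap Ω (u N) M z ≤ C₂ / volume V := by
    refine hz.trans ?_
    rw [setLAverage_eq]
    exact ENNReal.div_le_div_right h1 _
  rw [gap_of_mem hzΩ] at h2
  have h3 := ENNReal.toReal_mono hB h2
  have huz : u N z ≤ M := huM N z (closedBall_subset_closedBall (by linarith) (hVx hzV))
  cases hval : u N z with
  | bot => rw [hval] at h2; simp [hB] at h2
  | top => simp
  | coe t =>
    rw [hval, ← EReal.coe_sub, EReal.real_coe_toENNReal] at h3
    have h4 : M - t ≤ (C₂ / volume V).toReal := ((le_max_left _ _).trans_eq ENNReal.toReal_ofReal'.symm).trans h3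
    exact_mod_cast (by linarith : M - (C₂ / volume V).toReal ≤ t)

lemma l1LocBdd_of_locGapBdd (h : ∀ x ∈ Ω, LocGapBdd Ω u x) : L1LocBdd Ω u := by
  intro K hK hKΩ
  refine hK.induction_on (p := fun K => ∃ C : ℝ≥0∞, C ≠ ⊤ ∧
    ∀ N, ∫⁻ y in K, ‖(u N y).toReal‖ₑ ≤ C) ⟨0, by simp⟩ ?_ ?_ ?_
  · rintro s t hst ⟨C, hC, h⟩
    exact ⟨C, hC, fun N => (lintegral_mono_set hst).trans (h N)⟩
  · rintro s t ⟨C, hC, h⟩ ⟨C', hC', h'⟩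
    exact ⟨C + C', ENNReal.add_ne_top.2 ⟨hC, hC'⟩, fun N =>
      (lintegral_union_le _ _ _).trans (add_le_add (h N) (h' N))⟩
  · intro x hx
    obtain ⟨r, hr, M, hM, hball, huM, C, hC, hint⟩ := h x (hKΩ hx)
    refine ⟨closedBall x r, mem_nhdsWithin_of_mem_nhds (closedBall_mem_nhds x hr),
      C + ENNReal.ofReal M * volume (closedBall x r),
      ENNReal.add_ne_top.2 ⟨hC, ENNReal.mul_ne_top ENNReal.ofReal_ne_top
        measure_closedBall_lt_top.ne⟩, fun N => ?_⟩
    calc ∫⁻ y in closedBall x r, ‖(u N y).toReal‖ₑ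
        ≤ ∫⁻ y in closedBall x r, (gap Ω (u N) M y + ENNReal.ofReal M) := by
          refine setLIntegral_mono' measurableSet_closedBall fun y hy => ?_
          rw [gap_of_mem (hball hy)]
          exact enorm_toReal_le M hM _ (huM N y hy)
      _ = (∫⁻ y in closedBall x r, gap Ω (u N) M y)
            + ENNReal.ofReal M * volume (closedBall x r) := by
          rw [lintegral_add_right _ measurable_const, setLIntegral_const]
      _ ≤ _ := by gcongr; exact hint N

lemma aestronglyMeasurable_toReal (hΩ : IsOpen Ω) {v : QSpace n → EReal}
    (hv : UpperSemicontinuousOn v Ω) {K : Set (QSpace n)} (hKΩ : K ⊆ Ω) :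
    AEStronglyMeasurable (fun x => (v x).toReal) (volume.restrict K) := by
  refine AEStronglyMeasurable.mono_measure ?_ (Measure.restrict_mono hKΩ le_rfl)
  refine (AEMeasurable.aestronglyMeasurable ?_)
  rw [aemeasurable_restrict_iff_comap_subtype hΩ.measurableSet]
  exact (hv.measurable_domRestrict.ereal_toReal).aemeasurable

lemma inL1Loc_of_locGapBdd (hΩ : IsOpen Ω) (hu : ∀ N, IsQPsh Ω (u N))
    (h : ∀ x ∈ Ω, LocGapBdd Ω u x) (N : ℕ) : InL1Loc Ω (u N) := by
  constructor
  · rw [ae_restrict_iff' hΩ.measurableSet]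
    have hnull : volume {x | x ∈ Ω ∧ u N x = ⊥} = 0 := by
      refine measure_null_of_locally_null _ fun x hx => ?_
      obtain ⟨r, hr, M, hM, hball, huM, C, hC, hint⟩ := h x hx.1
      refine ⟨_, inter_mem_nhdsWithin _ (closedBall_mem_nhds x hr), ?_⟩
      have hmeas := measurable_gap (M := M) hΩ (hu N).upperSemicontinuousOn
      have hfin := ae_lt_top' hmeas.aemeasurable
        (ne_top_of_le_ne_top hC (hint N))
      rw [ae_restrict_iff' measurableSet_closedBall] at hfin
      refine measure_mono_null ?_ hfin
      rintro y ⟨⟨hyΩ, hy⟩, hyb⟩ hcon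
      have := hcon hyb
      rw [gap_of_mem hyΩ, hy] at this
      simp at this
    filter_upwards [measure_eq_zero_iff_ae_notMem.1 hnull] with x hx hxΩ
    exact ⟨fun hb => hx ⟨hxΩ, hb⟩, (hu N).ne_top x hxΩ⟩
  · intro K hK hKΩ
    obtain ⟨C, hC, hb⟩ := l1LocBdd_of_locGapBdd h K hK hKΩ
    exact ⟨aestronglyMeasurable_toReal hΩ (hu N).upperSemicontinuousOn hKΩ,
      (hb N).trans_lt hC.lt_top⟩

end LocalBounds

/-! ### Radial smoothing kernels -/

section Kernels

variable {n : ℕ}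

/-- A smooth radial probability density on `ℍⁿ` supported in the closed ball of radius `ε`. -/
structure IsRadialKernel (ε : ℝ) (κ : QSpace n → ℝ) : Prop where
  pos : 0 < ε
  contDiff : ContDiff ℝ ∞ κ
  nonneg : ∀ x, 0 ≤ κ x
  radial : ∀ x y, ‖x‖ = ‖y‖ → κ x = κ y
  tsupport_subset : tsupport κ ⊆ closedBall 0 ε
  integral_eq_one : ∫ x, κ x = 1

lemma finrank_QSpace (n : ℕ) : Module.finrank ℝ (QSpace n) = 4 * n := by
  have e : QSpace n ≃ₗ[ℝ] (Fin n → Quaternion ℝ) := WithLp.linearEquiv 2 ℝ _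
  rw [e.finrank_eq, Module.finrank_pi_fintype]
  simp [Quaternion.finrank_eq_four, mul_comm]

/-- The kernel `χ_ε`. -/
noncomputable def scaledKernel (χ : QSpace n → ℝ) (ε : ℝ) (z : QSpace n) : ℝ :=
  (ε ^ (4 * n))⁻¹ * χ (ε⁻¹ • z)

lemma IsSmoothingKernel.isRadialKernel {χ : QSpace n → ℝ} (h : IsSmoothingKernel χ) {ε : ℝ}
    (hε : 0 < ε) : IsRadialKernel ε (scaledKernel χ ε) where
  pos := hε
  contDiff := contDiff_const.mul (h.contDiff.comp (contDiff_const_smul _))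
  nonneg x := mul_nonneg (by positivity) (h.nonneg _)
  radial x y hxy := by
    unfold scaledKernel
    rw [h.radial (ε⁻¹ • x) (ε⁻¹ • y) (by rw [norm_smul, norm_smul, hxy])]
  tsupport_subset := by
    refine closure_minimal (fun x hx => ?_) isClosed_closedBall
    have h1 : χ (ε⁻¹ • x) ≠ 0 := right_ne_zero_of_mul hx
    have h2 := h.tsupport_subset (subset_tsupport _ h1)
    rw [mem_closedBall_zero_iff, norm_smul, norm_inv, Real.norm_of_nonneg hε.le,
      inv_mul_le_iff₀ hε, mul_one] at h2
    simpa using h2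
  integral_eq_one := by
    unfold scaledKernel
    rw [integral_const_mul, Measure.integral_comp_inv_smul, finrank_QSpace, h.integral_eq_one]
    rw [abs_of_pos (by positivity), smul_eq_mul, mul_one]
    exact inv_mul_cancel₀ (by positivity)

lemma regularize_eq (χ : QSpace n → ℝ) (Ω : Set (QSpace n)) (u : QSpace n → EReal) (ε : ℝ)
    (x : QSpace n) :
    regularize χ Ω u ε x = ∫ y in Ω, (u y).toReal * scaledKernel χ ε (x - y) := rfl

lemma exists_isSmoothingKernel (n : ℕ) : ∃ χ : QSpace n → ℝ, IsSmoothingKernel χ := by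
  set g : QSpace n → ℝ := fun x => Real.smoothTransition (1 - ‖x‖ ^ 2)
  have hg : ContDiff ℝ ∞ g :=
    Real.smoothTransition.contDiff.comp (contDiff_const.sub (contDiff_norm_sq ℝ))
  have hg0 : ∀ x, 0 ≤ g x := fun x => Real.smoothTransition.nonneg _
  have hsupp : tsupport g ⊆ closedBall 0 1 := by
    refine closure_minimal (fun x hx => ?_) isClosed_closedBall
    rw [mem_closedBall_zero_iff]
    by_contra hcon
    refine hx (Real.smoothTransition.zero_of_nonpos ?_)
    nlinarith [norm_nonneg x]
  have hcs : HasCompactSupport g :=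
    HasCompactSupport.of_support_subset_isCompact (isCompact_closedBall 0 1)
      ((subset_tsupport _).trans hsupp)
  have hpos : 0 < ∫ x, g x := by
    refine hg.continuous.integral_pos_of_hasCompactSupport_nonneg_nonzero hcs hg0 (x := 0) ?_
    simp [g]
  refine ⟨fun x => (∫ x, g x)⁻¹ * g x, contDiff_const.mul hg,
    fun x => mul_nonneg (inv_nonneg.2 hpos.le) (hg0 x), fun x y h => by simp only [g, h], ?_, ?_⟩
  · refine (closure_mono fun x hx => ?_).trans hsupp
    exact right_ne_zero_of_mul hx
  · rw [integral_const_mul, inv_mul_cancel₀ hpos.ne']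

namespace IsRadialKernel

variable {ε : ℝ} {κ : QSpace n → ℝ}

lemma norm_le (h : IsRadialKernel ε κ) {x : QSpace n} (hx : κ x ≠ 0) : ‖x‖ ≤ ε := by
  simpa using h.tsupport_subset (subset_tsupport _ hx)

lemma hasCompactSupport (h : IsRadialKernel ε κ) : HasCompactSupport κ :=
  HasCompactSupport.of_support_subset_isCompact (isCompact_closedBall 0 ε)
    ((subset_tsupport _).trans h.tsupport_subset)

lemma neg (h : IsRadialKernel ε κ) (x : QSpace n) : κ (-x) = κ x := h.radial _ _ (norm_neg x)

lemma integrable (h : IsRadialKernel ε κ) : Integrable κ :=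
  h.contDiff.continuous.integrable_of_hasCompactSupport h.hasCompactSupport

end IsRadialKernel

/-- Smooth cutoff functions. -/
lemma exists_cutoff {Ω K : Set (QSpace n)} (hΩ : IsOpen Ω) (hK : IsCompact K) (hKΩ : K ⊆ Ω) :
    ∃ η : QSpace n → ℝ, ContDiff ℝ ∞ η ∧ HasCompactSupport η ∧ tsupport η ⊆ Ω ∧
      (∀ x, 0 ≤ η x) ∧ (∀ x, η x ≤ 1) ∧ ∀ x ∈ K, η x = 1 := by
  obtain ⟨L, hL, hKL, hLΩ⟩ := exists_compact_between hK hΩ hKΩ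
  obtain ⟨f, h1, h0, hf⟩ := exists_contMDiffMap_one_nhds_of_subset_interior
    (modelWithCornersSelf ℝ (QSpace n)) (n := ⊤) hK.isClosed hKL
  have hsub : tsupport f ⊆ L := closure_minimal (fun x hx => by
    by_contra hxL; exact hx (h0 x hxL)) hL.isClosed
  exact ⟨f, f.contMDiff.contDiff, hL.of_isClosed_subset (isClosed_tsupport _) hsub,
    hsub.trans hLΩ, fun x => (hf x).1, fun x => (hf x).2,
    fun x hx => (h1.self_of_nhdsSet x hx)⟩

/-- Neighbourhoods of compact subsets of open sets. -/
lemma exists_cthickening_subset {Ω K : Set (QSpace n)} (hΩ : IsOpen Ω) (hK : IsCompact K)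
    (hKΩ : K ⊆ Ω) : ∃ ε > 0, IsCompact (cthickening ε K) ∧ cthickening ε K ⊆ Ω := by
  obtain ⟨δ, hδ, hsub⟩ := hK.exists_cthickening_subset_open hΩ hKΩ
  exact ⟨δ, hδ, hK.cthickening, hsub⟩

end Kernels

/-! ### Convolutions -/

section Convolution

variable {n : ℕ} {f φ h κ : QSpace n → ℝ} {ε : ℝ}

lemma convolution_apply (f h : QSpace n → ℝ) (x : QSpace n) :
    (f ⋆ h) x = ∫ y, f y * h (x - y) := rfl

/-- Only the values of `u` in the `ε`-ball around `x` enter the regularization at `x`. -/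
lemma setIntegral_mul_eq_convolution {Ω K : Set (QSpace n)} (hΩ : MeasurableSet Ω)
    (hKΩ : K ⊆ Ω) {x : QSpace n} (hx : closedBall x ε ⊆ K)
    (hh : tsupport h ⊆ closedBall 0 ε) (g : QSpace n → ℝ) :
    ∫ y in Ω, g y * h (x - y) = (K.indicator g ⋆ h) x := by
  rw [convolution_apply, ← integral_indicator hΩ]
  refine integral_congr_ae (Eventually.of_forall fun y => ?_)
  by_cases h0 : h (x - y) = 0
  · simp [indicator, h0]
  · have hy : y ∈ K := hx (by
      have := hh (subset_tsupport _ h0)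
      rwa [mem_closedBall_zero_iff, ← dist_eq_norm, dist_comm] at this)
    simp [indicator, hy, hKΩ hy]

lemma integrable_mul_comp_sub (hf : Integrable f) (hh : Continuous h) (hhc : HasCompactSupport h)
    (x : QSpace n) : Integrable fun y => f y * h (x - y) := by
  obtain ⟨C, hC⟩ := hh.bounded_above_of_compact_support hhc
  exact hf.mul_bdd (c := C) (hh.comp (continuous_const.sub continuous_id)).aestronglyMeasurable
    (Eventually.of_forall fun y => hC _)

lemma abs_convolution_le (hf : Integrable f) {C : ℝ} (hC : ∀ x, |h x| ≤ C) (x : QSpace n) :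
    |(f ⋆ h) x| ≤ (∫ y, |f y|) * C := by
  rw [convolution_apply, ← Real.norm_eq_abs, ← integral_mul_const]
  refine norm_integral_le_of_norm_le (hf.abs.mul_const C) (Eventually.of_forall fun y => ?_)
  rw [norm_mul, Real.norm_eq_abs, Real.norm_eq_abs]
  exact mul_le_mul_of_nonneg_left (hC _) (abs_nonneg _)

/-- Fubini's theorem: convolution with an even function is symmetric. -/
lemma integral_mul_convolution (hf : Integrable f) (hφ : Integrable φ) (hh : Continuous h)
    (hhc : HasCompactSupport h) (heven : ∀ x, h (-x) = h x) :
    ∫ x, φ x * (f ⋆ h) x = ∫ y, f y * (φ ⋆ h) y := by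
  obtain ⟨C, hC⟩ := hh.bounded_above_of_compact_support hhc
  have hint : Integrable (fun z : QSpace n × QSpace n => φ z.1 * (f z.2 * h (z.1 - z.2)))
      (volume.prod volume) := by
    have h1 : Integrable (fun z : QSpace n × QSpace n => φ z.1 * f z.2) (volume.prod volume) :=
      hφ.mul_prod hf
    have h2 := h1.mul_bdd (c := C) (g := fun z : QSpace n × QSpace n => h (z.1 - z.2))
      (hh.comp (continuous_fst.sub continuous_snd)).aestronglyMeasurable
      (Eventually.of_forall fun y => hC _)
    simpa only [mul_assoc] using h2
  simp only [convolution_apply, ← integral_const_mul]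
  rw [integral_integral_swap hint]
  refine integral_congr_ae (Eventually.of_forall fun y => ?_)
  refine integral_congr_ae (Eventually.of_forall fun x => ?_)
  simp only
  rw [← heven (x - y), neg_sub]
  ring

/-- Mollifications of a continuous function with compact support converge uniformly. -/
lemma exists_forall_abs_convolution_sub_le (hφ : Continuous φ) (hφc : HasCompactSupport φ) {δ : ℝ}
    (hδ : 0 < δ) : ∃ ε₀ > 0, ∀ ε ≤ ε₀, ∀ κ : QSpace n → ℝ, IsRadialKernel ε κ →
      ∀ x, |(φ ⋆ κ) x - φ x| ≤ δ := by
  obtain ⟨ρ, hρ, huc⟩ := Metric.uniformContinuous_iff.1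
    (hφc.uniformContinuous_of_continuous hφ) δ hδ
  refine ⟨ρ / 2, half_pos hρ, fun ε hε κ hκ x => ?_⟩
  have hswap : (φ ⋆ κ) x = (κ ⋆ φ) x := by
    rw [convolution_lsmul_swap, convolution_apply]
    refine integral_congr_ae (Eventually.of_forall fun t => ?_)
    simp [mul_comm]
  rw [hswap, ← Real.dist_eq]
  refine dist_convolution_le (R := ρ) hδ.le (fun y hy => ?_) hκ.nonneg hκ.integral_eq_one
    hφ.aestronglyMeasurable (fun y hy => (huc hy).le)
  rw [mem_ball_zero_iff]
  linarith [hκ.norm_le hy]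

lemma tsupport_convolution_subset (hκ : tsupport h ⊆ closedBall 0 ε) :
    tsupport (φ ⋆ h) ⊆ cthickening ε (tsupport φ) := by
  refine closure_minimal (fun x hx => ?_) isClosed_cthickening
  obtain ⟨y, hy, z, hz, rfl⟩ := support_convolution_subset _ hx
  refine mem_cthickening_of_dist_le _ y ε _ (subset_tsupport _ hy) ?_
  simpa using hκ (subset_tsupport _ hz)

lemma hasCompactSupport_convolution (hφc : HasCompactSupport φ) (hhc : HasCompactSupport h) :
    HasCompactSupport (φ ⋆ h) := HasCompactSupport.convolution _ hφc hhc

/-- The second derivative of `f` in the directions `v` and `w`. -/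
noncomputable def secondDeriv (v w : QSpace n) (f : QSpace n → ℝ) (x : QSpace n) : ℝ :=
  fderiv ℝ (fun y => fderiv ℝ f y w) x v

lemma fderiv_convolution_apply (hf : LocallyIntegrable f) (hh : ContDiff ℝ ∞ h)
    (hhc : HasCompactSupport h) (w x : QSpace n) :
    fderiv ℝ (f ⋆ h) x w = (f ⋆ fun y => fderiv ℝ h y w) x := by
  rw [(hhc.hasFDerivAt_convolution_right (ContinuousLinearMap.lsmul ℝ ℝ) hf
    (hh.of_le (by simp)) x).fderiv]
  exact convolution_precompR_apply _ hf (hhc.fderiv ℝ) (hh.continuous_fderiv (by simp)) x w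

lemma contDiff_fderiv_apply (hh : ContDiff ℝ ∞ h) (w : QSpace n) :
    ContDiff ℝ ∞ fun y => fderiv ℝ h y w :=
  (hh.fderiv_right (m := ∞) (by simp)).clm_apply contDiff_const

lemma contDiff_secondDeriv (hh : ContDiff ℝ ∞ h) (v w : QSpace n) :
    ContDiff ℝ ∞ (secondDeriv v w h) :=
  contDiff_fderiv_apply (contDiff_fderiv_apply hh w) v

lemma tsupport_secondDeriv_subset (h : QSpace n → ℝ) (v w : QSpace n) :
    tsupport (secondDeriv v w h) ⊆ tsupport h :=
  (tsupport_fderiv_apply_subset ℝ v).trans (tsupport_fderiv_apply_subset ℝ w)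

lemma secondDeriv_convolution (hf : LocallyIntegrable f) (hh : ContDiff ℝ ∞ h)
    (hhc : HasCompactSupport h) (v w : QSpace n) :
    secondDeriv v w (f ⋆ h) = f ⋆ secondDeriv v w h := by
  ext x
  have h1 : (fun y => fderiv ℝ (f ⋆ h) y w) = f ⋆ fun y => fderiv ℝ h y w :=
    funext fun y => fderiv_convolution_apply hf hh hhc w y
  rw [secondDeriv, h1]
  exact fderiv_convolution_apply hf (contDiff_fderiv_apply hh w)
    (hhc.mono' ((subset_tsupport _).trans (tsupport_fderiv_apply_subset ℝ w))) v x

lemma fderiv_neg_arg (g : QSpace n → ℝ) (x : QSpace n) :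
    fderiv ℝ (fun z => g (-z)) x = -fderiv ℝ g (-x) := by
  have := fderiv_comp_smul (f := g) (x := x) (-1 : ℝ)
  simpa using this

lemma secondDeriv_neg_of_even (heven : ∀ x, h (-x) = h x) (v w x : QSpace n) :
    secondDeriv v w h (-x) = secondDeriv v w h x := by
  have h1 : (fun y => fderiv ℝ h (-y) w) = fun y => -fderiv ℝ h y w := by
    ext y
    have := fderiv_neg_arg h y
    rw [show (fun z => h (-z)) = h from funext heven] at this
    rw [this]; simp
  have h3 := fderiv_neg_arg (fun z => fderiv ℝ h z w) x
  rw [h1, fderiv_fun_neg, neg_inj] at h3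
  rw [secondDeriv, secondDeriv, h3]

end Convolution

/-! ### Psh functions against test functions and kernels -/

section Testing

variable {n : ℕ} {Ω K : Set (QSpace n)} {u : QSpace n → EReal} {ψ φ κ : QSpace n → ℝ} {M ε : ℝ}

/-- The real function equal to `u` on `K` and to zero elsewhere. For `u ∈ L¹_loc(Ω)` and a compact
subset `K` of `Ω` it is integrable on the whole space. -/
noncomputable def cut (K : Set (QSpace n)) (u : QSpace n → EReal) : QSpace n → ℝ :=
  K.indicator fun y => (u y).toReal

lemma cut_of_mem {x : QSpace n} (hx : x ∈ K) : cut K u x = (u x).toReal := indicator_of_mem hx _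

lemma InL1Loc.integrable_cut (hL : InL1Loc Ω u) (hK : IsCompact K) (hKΩ : K ⊆ Ω) :
    Integrable (cut K u) :=
  (integrable_indicator_iff hK.measurableSet).2 (hL.2 K hK hKΩ)

lemma InL1Loc.ae_ne (hΩ : IsOpen Ω) (hL : InL1Loc Ω u) :
    ∀ᵐ x, x ∈ Ω → u x ≠ ⊥ ∧ u x ≠ ⊤ := (ae_restrict_iff' hΩ.measurableSet).1 hL.1

lemma IsQPsh.exists_bound (hu : IsQPsh Ω u) (hK : IsCompact K) (hKΩ : K ⊆ Ω) :
    ∃ M : ℝ, 0 ≤ M ∧ ∀ y ∈ K, u y ≤ M := by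
  rcases K.eq_empty_or_nonempty with rfl | hne
  · exact ⟨0, le_rfl, by simp⟩
  obtain ⟨x, hx, hmax⟩ :=
    (hu.upperSemicontinuousOn.mono hKΩ).exists_isMaxOn hne hK
  refine ⟨max (u x).toReal 0, le_max_right _ _, fun y hy => (hmax hy).trans ?_⟩
  refine (EReal.le_coe_toReal (hu.ne_top x (hKΩ hx))).trans ?_
  exact_mod_cast le_max_left _ _

/-- The integral of `M - u` against a test function, as a Lebesgue and as a Bochner integral. -/
lemma InL1Loc.lintegral_mul_gap (hΩ : IsOpen Ω) (hL : InL1Loc Ω u) (hK : IsCompact K) (hKΩ : K ⊆ Ω)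
    (huM : ∀ y ∈ K, u y ≤ M) (hψ : Continuous ψ) (hψc : HasCompactSupport ψ) (hψ0 : ∀ y, 0 ≤ ψ y)
    (hψK : ∀ y, ψ y ≠ 0 → y ∈ K) :
    ∫⁻ y, ENNReal.ofReal (ψ y) * gap Ω u M y
        = ENNReal.ofReal (M * (∫ y, ψ y) - ∫ y, cut K u y * ψ y) ∧
      ∫ y, cut K u y * ψ y ≤ M * ∫ y, ψ y := by
  obtain ⟨C, hC⟩ := hψ.bounded_above_of_compact_support hψc
  have hfi := hL.integrable_cut hK hKΩ
  have hψi : Integrable ψ := hψ.integrable_of_hasCompactSupport hψc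
  have hi1 : Integrable fun y => M * ψ y := hψi.const_mul M
  have hi2 : Integrable fun y => cut K u y * ψ y :=
    hfi.mul_bdd (c := C) hψ.aestronglyMeasurable (Eventually.of_forall fun y => hC _)
  have hi12 : Integrable fun y => M * ψ y - cut K u y * ψ y := hi1.sub hi2
  have hae : ∀ᵐ y, ENNReal.ofReal (ψ y) * gap Ω u M y
        = ENNReal.ofReal (M * ψ y - cut K u y * ψ y) ∧ 0 ≤ M * ψ y - cut K u y * ψ y := by
    filter_upwards [hL.ae_ne hΩ] with y hy
    by_cases h0 : ψ y = 0
    · simp [h0]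
    have hyK := hψK y h0
    have hy' := hy (hKΩ hyK)
    have hle := huM y hyK
    rw [gap_of_mem (hKΩ hyK), cut_of_mem hyK, ← sub_mul]
    lift u y to ℝ using ⟨hy'.2, hy'.1⟩ with t
    have ht : t ≤ M := by exact_mod_cast hle
    rw [← EReal.coe_sub, EReal.real_coe_toENNReal, EReal.toReal_coe,
      ← ENNReal.ofReal_mul (hψ0 y), mul_comm]
    exact ⟨rfl, mul_nonneg (by linarith) (hψ0 y)⟩
  have hsub : ∫ y, (M * ψ y - cut K u y * ψ y) = M * (∫ y, ψ y) - ∫ y, cut K u y * ψ y := by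
    rw [integral_sub hi1 hi2, integral_const_mul]
  constructor
  · rw [lintegral_congr_ae (hae.mono fun y hy => hy.1), ← hsub,
      ofReal_integral_eq_lintegral_ofReal hi12 (hae.mono fun y hy => hy.2)]
  · have := integral_nonneg_of_ae (hae.mono fun y hy => hy.2)
    rw [hsub] at this
    linarith

/-- A psh function lies below its regularizations. -/
lemma IsQPsh.le_convolution (hΩ : IsOpen Ω) (hu : IsQPsh Ω u) (hL : InL1Loc Ω u)
    (hκ : IsRadialKernel ε κ) (hK : IsCompact K) (hKΩ : K ⊆ Ω) {x : QSpace n}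
    (hx : closedBall x ε ⊆ K) : u x ≤ ((cut K u ⋆ κ) x : ℝ) := by
  obtain ⟨M, hM, huM⟩ := hu.exists_bound hK hKΩ
  have hxK : x ∈ K := hx (mem_closedBall_self hκ.pos.le)
  have h := hu.lintegral_mul_gap_le hΩ (hx.trans hKΩ) hM (fun y hy => huM y (hx hy))
    (w := fun ξ => ENNReal.ofReal (κ ξ)) hκ.contDiff.continuous.measurable.ennreal_ofReal
    (fun ξ θ => by
      rw [hκ.radial (rightMul ξ θ) ξ (by rw [norm_rightMul, norm_unitQuaternion, mul_one])])
    (fun ξ hξ => hκ.norm_le fun h0 => hξ (by simp [h0]))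
  have h1 : ∫⁻ ξ, ENNReal.ofReal (κ ξ) = 1 := by
    rw [← ofReal_integral_eq_lintegral_ofReal hκ.integrable (Eventually.of_forall hκ.nonneg),
      hκ.integral_eq_one, ENNReal.ofReal_one]
  have h2 : ∫⁻ ξ, ENNReal.ofReal (κ ξ) * gap Ω u M (x + ξ)
      = ∫⁻ y, ENNReal.ofReal (κ (x - y)) * gap Ω u M y := by
    rw [← lintegral_add_left_eq_self (fun y => ENNReal.ofReal (κ (x - y)) * gap Ω u M y) x]
    refine lintegral_congr fun ξ => ?_
    rw [sub_add_cancel_left, hκ.neg]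
  obtain ⟨h3, h4⟩ := hL.lintegral_mul_gap hΩ hK hKΩ huM (ψ := fun y => κ (x - y))
    (hκ.contDiff.continuous.comp (continuous_const.sub continuous_id))
    (hκ.hasCompactSupport.comp_homeomorph (Homeomorph.subLeft x))
    (fun y => hκ.nonneg _)
    (fun y hy => hx (by
      have := hκ.norm_le hy
      rwa [mem_closedBall, dist_comm, dist_eq_norm]))
  have h5 : ∫ y, κ (x - y) = 1 := by
    rw [integral_sub_left_eq_self κ volume x, hκ.integral_eq_one]
  rw [h1, one_mul, h2, h3, h5, mul_one, gap_of_mem (hKΩ hxK)] at h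
  rw [h5, mul_one] at h4
  rw [convolution_apply]
  have hxM := huM x hxK
  induction hux : u x with
  | bot => simp
  | top => exact absurd hux (hu.ne_top x (hKΩ hxK))
  | coe t =>
    rw [hux] at h hxM
    have ht : t ≤ M := by exact_mod_cast hxM
    rw [← EReal.coe_sub, EReal.real_coe_toENNReal,
      ENNReal.ofReal_le_ofReal_iff (by linarith)] at h
    exact_mod_cast (by linarith : t ≤ _)

lemma continuous_integral_mul_comp_sub {f : QSpace n → ℝ} (hf : Integrable f) (hφ : Continuous φ)
    (hφc : HasCompactSupport φ) : Continuous fun v => ∫ y, f y * φ (y - v) := by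
  have h := HasCompactSupport.continuous_convolution_right (ContinuousLinearMap.lsmul ℝ ℝ)
    (μ := volume) (hφc.comp_homeomorph (Homeomorph.neg _)) hf.locallyIntegrable
    (hφ.comp continuous_neg)
  convert h using 2 with v
  rw [convolution_apply]
  simp

/-- The sub-mean value inequality along right quaternionic lines, tested against `φ ≥ 0`. -/
lemma IsQPsh.integral_le_integral_line (hΩ : IsOpen Ω) (hu : IsQPsh Ω u) (hL : InL1Loc Ω u)
    (hK : IsCompact K) (hKΩ : K ⊆ Ω) (hφ : Continuous φ) (hφc : HasCompactSupport φ)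
    (hφ0 : ∀ y, 0 ≤ φ y) {ξ : QSpace n}
    (hφK : ∀ y, φ y ≠ 0 → ∀ q : Quaternion ℝ, ‖q‖ ≤ 1 → y + rightMul ξ q ∈ K) :
    ∫ y, cut K u y * φ y ≤
      ∫ θ : sphere (0 : Quaternion ℝ) 1,
        (∫ y, cut K u y * φ (y - rightMul ξ (θ : Quaternion ℝ))) ∂unitQuaternionMeasure := by
  obtain ⟨M, hM, huM⟩ := hu.exists_bound hK hKΩ
  have hg : Measurable (gap Ω u M) := measurable_gap hΩ hu.upperSemicontinuousOn
  have hφK0 : ∀ y, φ y ≠ 0 → y ∈ K := fun y hy => by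
    simpa [rightMul_zero_right] using hφK y hy 0 (by simp)
  obtain ⟨h1, h1'⟩ := hL.lintegral_mul_gap hΩ hK hKΩ huM hφ hφc hφ0 hφK0
  have h2 : ∀ θ : sphere (0 : Quaternion ℝ) 1, _ := fun θ =>
    hL.lintegral_mul_gap hΩ hK hKΩ huM
    (ψ := fun y => φ (y - rightMul ξ (θ : Quaternion ℝ)))
    (hφ.comp (continuous_id.sub continuous_const))
    (hφc.comp_homeomorph (Homeomorph.subRight _))
    (fun y => hφ0 _) (fun y hy => by
      simpa using hφK _ hy θ (norm_unitQuaternion θ).le)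
  set F : sphere (0 : Quaternion ℝ) 1 → ℝ := fun θ =>
    ∫ y, cut K u y * φ (y - rightMul ξ (θ : Quaternion ℝ))
  have hI : ∀ θ : sphere (0 : Quaternion ℝ) 1,
      ∫ y, φ (y - rightMul ξ (θ : Quaternion ℝ)) = ∫ y, φ y := fun θ =>
    integral_sub_right_eq_self φ _
  have hFc : Continuous F :=
    (continuous_integral_mul_comp_sub (hL.integrable_cut hK hKΩ) hφ hφc).comp
      (show Continuous fun θ : sphere (0 : Quaternion ℝ) 1 => rightMul ξ (θ : Quaternion ℝ)
        by fun_prop)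
  have hFi : Integrable F unitQuaternionMeasure := by
    have : HasCompactSupport F := HasCompactSupport.of_compactSpace F
    exact hFc.integrable_of_hasCompactSupport this
  have key : ∫⁻ θ : sphere (0 : Quaternion ℝ) 1,
      (∫⁻ y, ENNReal.ofReal (φ (y - rightMul ξ (θ : Quaternion ℝ))) * gap Ω u M y)
        ∂unitQuaternionMeasure ≤ ∫⁻ y, ENNReal.ofReal (φ y) * gap Ω u M y := by
    calc _ = ∫⁻ θ : sphere (0 : Quaternion ℝ) 1,
          (∫⁻ y, ENNReal.ofReal (φ y) * gap Ω u M (y + rightMul ξ (θ : Quaternion ℝ)))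
            ∂unitQuaternionMeasure := by
          refine lintegral_congr fun θ => ?_
          rw [← lintegral_add_right_eq_self _ (rightMul ξ (θ : Quaternion ℝ))]
          simp
      _ = ∫⁻ y, (∫⁻ θ : sphere (0 : Quaternion ℝ) 1,
            ENNReal.ofReal (φ y) * gap Ω u M (y + rightMul ξ (θ : Quaternion ℝ))
              ∂unitQuaternionMeasure) := by
          refine lintegral_lintegral_swap (Measurable.aemeasurable ?_)
          refine (hφ.measurable.ennreal_ofReal.comp measurable_snd).mul (hg.comp ?_)
          have : Continuous fun z : sphere (0 : Quaternion ℝ) 1 × QSpace n =>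
            z.2 + rightMul ξ (z.1 : Quaternion ℝ) := by fun_prop
          exact this.measurable
      _ ≤ _ := by
          refine lintegral_mono fun y => ?_
          have hm : Measurable fun θ : sphere (0 : Quaternion ℝ) 1 =>
              gap Ω u M (y + rightMul ξ (θ : Quaternion ℝ)) :=
            hg.comp (Continuous.measurable (by fun_prop))
          change (∫⁻ θ : sphere (0 : Quaternion ℝ) 1, ENNReal.ofReal (φ y) *
            gap Ω u M (y + rightMul ξ (θ : Quaternion ℝ)) ∂unitQuaternionMeasure) ≤ _
          rw [lintegral_const_mul _ hm]
          by_cases h0 : φ y = 0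
          · simp [h0]
          gcongr
          exact hu.lintegral_gap_line_le (fun q hq => hKΩ (hφK y h0 q hq)) hM
            (fun q hq => huM _ (hφK y h0 q hq))
  rw [h1, lintegral_congr fun θ => (h2 θ).1] at key
  simp only [hI] at key
  have hMF : Integrable (fun θ => M * (∫ y, φ y) - F θ) unitQuaternionMeasure :=
    (integrable_const _).sub hFi
  rw [← ofReal_integral_eq_lintegral_ofReal hMF
    (Eventually.of_forall fun θ => by
      have := (h2 θ).2
      simp only [hI] at this
      simpa using this), ENNReal.ofReal_le_ofReal_iff (by linarith)] at key
  have h3 : ∫ θ, (M * (∫ y, φ y) - F θ) ∂unitQuaternionMeasure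
      = M * (∫ y, φ y) - ∫ θ, F θ ∂unitQuaternionMeasure := by
    rw [integral_sub (integrable_const _) hFi]
    simp
  have h4 := h3 ▸ key
  linarith

end Testing

/-! ### Convergence in `L¹_loc` -/

section Convergence

variable {n : ℕ}

/-- If `f ≤ f ⋆ κ`, the `L¹` distance of `f` and `f ⋆ κ` is controlled by the uniform distance of
a cutoff function to its regularization: `∫ η (f ⋆ κ - f) = ∫ f (η ⋆ κ - η)`. -/
lemma setIntegral_abs_convolution_sub_le {f η κ : QSpace n → ℝ} {ε δ : ℝ} {K : Set (QSpace n)}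
    (hK : MeasurableSet K) (hf : Integrable f) (hκ : IsRadialKernel ε κ) (hη : Continuous η)
    (hηc : HasCompactSupport η) (hη0 : ∀ x, 0 ≤ η x) (hη1 : ∀ x ∈ K, η x = 1)
    (hle : ∀ᵐ x, η x ≠ 0 → f x ≤ (f ⋆ κ) x) (hδ : ∀ x, |(η ⋆ κ) x - η x| ≤ δ) :
    ∫ x in K, |(f ⋆ κ) x - f x| ≤ δ * ∫ x, |f x| := by
  obtain ⟨C, hC⟩ := hη.bounded_above_of_compact_support hηc
  have hcont : Continuous (f ⋆ κ) :=
    HasCompactSupport.continuous_convolution_right _ hκ.hasCompactSupport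
      hf.locallyIntegrable hκ.contDiff.continuous
  have hηκ : Continuous (η ⋆ κ) :=
    HasCompactSupport.continuous_convolution_right _ hκ.hasCompactSupport
      (hη.integrable_of_hasCompactSupport hηc).locallyIntegrable hκ.contDiff.continuous
  have hi1 : Integrable fun x => η x * (f ⋆ κ) x :=
    (hη.mul hcont).integrable_of_hasCompactSupport hηc.mul_right
  have hi2 : Integrable fun x => f x * η x :=
    hf.mul_bdd (c := C) hη.aestronglyMeasurable (Eventually.of_forall fun y => hC _)
  have hi2' : Integrable fun x => η x * f x := by simpa only [mul_comm] using hi2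
  have hi3 : Integrable fun x => f x * (η ⋆ κ) x := by
    have hc := hasCompactSupport_convolution hηc hκ.hasCompactSupport
    obtain ⟨D, hD⟩ := hηκ.bounded_above_of_compact_support hc
    exact hf.mul_bdd (c := D) hηκ.aestronglyMeasurable (Eventually.of_forall fun y => hD _)
  calc ∫ x in K, |(f ⋆ κ) x - f x|
      ≤ ∫ x, (η x * (f ⋆ κ) x - η x * f x) := by
        rw [← integral_indicator hK]
        refine integral_mono_of_nonneg (Eventually.of_forall fun x =>
          indicator_nonneg (fun _ _ => abs_nonneg _) x) (hi1.sub hi2') ?_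
        filter_upwards [hle] with x hx
        rw [← mul_sub]
        by_cases hxK : x ∈ K
        · have h1 := hη1 x hxK
          rw [indicator_of_mem hxK, h1, one_mul,
            abs_of_nonneg (sub_nonneg.2 (hx (by simp [h1])))]
        · rw [indicator_of_notMem hxK]
          by_cases h0 : η x = 0
          · simp [h0]
          · exact mul_nonneg (hη0 x) (sub_nonneg.2 (hx h0))
    _ = ∫ x, f x * ((η ⋆ κ) x - η x) := by
        simp only [mul_sub]
        rw [integral_sub hi1 hi2', integral_sub hi3 hi2,
          integral_mul_convolution hf (hη.integrable_of_hasCompactSupport hηc)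
            hκ.contDiff.continuous hκ.hasCompactSupport hκ.neg]
        simp only [mul_comm]
    _ ≤ ∫ x, δ * |f x| := by
        have hi32 : Integrable fun x => f x * (η ⋆ κ) x - f x * η x := hi3.sub hi2
        refine integral_mono (by simpa only [mul_sub] using hi32) (hf.abs.const_mul δ)
          fun x => ?_
        refine (le_abs_self _).trans ?_
        rw [abs_mul, mul_comm]
        exact mul_le_mul_of_nonneg_right (hδ x) (abs_nonneg _)
    _ = δ * ∫ x, |f x| := integral_const_mul _ _

end Convergence

section LimitExistence

variable {n : ℕ} {Ω : Set (QSpace n)}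

/-- Completeness of `L¹` of a measure, for sequences of functions. -/
lemma exists_tendsto_integral_abs_sub {α : Type*} [MeasurableSpace α] {μ : Measure α}
    {g : ℕ → α → ℝ} (hg : ∀ N, Integrable (g N) μ)
    (hc : ∀ δ > 0, ∃ N₀, ∀ N ≥ N₀, ∀ M ≥ N₀, ∫ x, |g N x - g M x| ∂μ ≤ δ) :
    ∃ w : α → ℝ, Integrable w μ ∧ Tendsto (fun N => ∫ x, |g N x - w x| ∂μ) atTop (𝓝 0) := by
  have hnorm : ∀ {a b : α → ℝ} (ha : Integrable a μ) (hb : Integrable b μ),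
      ‖ha.toL1 a - hb.toL1 b‖ = ∫ x, |a x - b x| ∂μ := by
    intro a b ha hb
    rw [← Integrable.toL1_sub, L1.norm_of_fun_eq_integral_norm]
    rfl
  have hcs : CauchySeq fun N => (hg N).toL1 (g N) := by
    rw [Metric.cauchySeq_iff]
    intro δ hδ
    obtain ⟨N₀, h⟩ := hc (δ / 2) (half_pos hδ)
    refine ⟨N₀, fun N hN M hM => ?_⟩
    rw [dist_eq_norm, hnorm]
    linarith [h N hN M hM]
  obtain ⟨W, hW⟩ := cauchySeq_tendsto_of_complete hcs
  refine ⟨W, L1.integrable_coeFn W, ?_⟩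
  have h := tendsto_iff_norm_sub_tendsto_zero.1 hW
  refine h.congr fun N => ?_
  conv_lhs => rw [← Integrable.toL1_coeFn W (L1.integrable_coeFn W)]
  exact hnorm _ _

/-- A sequence that is Cauchy in `L¹(K)` for every compact subset `K` of `Ω` has a limit. -/
lemma exists_l1Loc_limit (hΩ : IsOpen Ω) {g : ℕ → QSpace n → ℝ}
    (hg : ∀ N, ∀ K : Set (QSpace n), IsCompact K → K ⊆ Ω → IntegrableOn (g N) K)
    (hc : ∀ K : Set (QSpace n), IsCompact K → K ⊆ Ω → ∀ δ > 0, ∃ N₀, ∀ N ≥ N₀, ∀ M ≥ N₀,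
      ∫ x in K, |g N x - g M x| ≤ δ) :
    ∃ w : QSpace n → ℝ, ∀ K : Set (QSpace n), IsCompact K → K ⊆ Ω → IntegrableOn w K ∧
      Tendsto (fun N => ∫ x in K, |g N x - w x|) atTop (𝓝 0) := by
  have : LocallyCompactSpace Ω := hΩ.locallyCompactSpace
  let E : CompactExhaustion Ω := default
  set L : ℕ → Set (QSpace n) := fun j => Subtype.val '' E j
  have hL : ∀ j, IsCompact (L j) := fun j => (E.isCompact j).image continuous_subtype_val
  have hLΩ : ∀ j, L j ⊆ Ω := fun j => by rintro _ ⟨x, -, rfl⟩; exact x.2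
  have hex : ∀ K : Set (QSpace n), IsCompact K → K ⊆ Ω → ∃ j, K ⊆ L j := by
    intro K hK hKΩ
    have hK' : IsCompact (Subtype.val ⁻¹' K : Set Ω) :=
      Topology.IsInducing.subtypeVal.isCompact_preimage' hK (by simpa using hKΩ)
    obtain ⟨j, hj⟩ := E.exists_superset_of_isCompact hK'
    exact ⟨j, fun x hx => ⟨⟨x, hKΩ hx⟩, hj hx, rfl⟩⟩
  choose W hWi hW using fun j => exists_tendsto_integral_abs_sub
    (fun N => hg N (L j) (hL j) (hLΩ j)) (hc (L j) (hL j) (hLΩ j))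
  -- the limits on two members of the exhaustion agree on their intersection
  have hagree : ∀ i j, ∀ᵐ x, x ∈ L i → x ∈ L j → W i x = W j x := by
    intro i j
    have hm : MeasurableSet (L i ∩ L j) := (hL i).measurableSet.inter (hL j).measurableSet
    have hi : IntegrableOn (W i) (L i ∩ L j) := IntegrableOn.mono_set (hWi i) inter_subset_left
    have hj : IntegrableOn (W j) (L i ∩ L j) := IntegrableOn.mono_set (hWi j) inter_subset_right
    have hzero : ∫ x in L i ∩ L j, |W i x - W j x| = 0 := by
      refine le_antisymm ?_ (integral_nonneg fun _ => abs_nonneg _)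
      refine ge_of_tendsto' (x := atTop) (b := ∫ x in L i ∩ L j, |W i x - W j x|)
        (by simpa using (hW i).add (hW j)) fun N => ?_
      have hgi := hg N (L i) (hL i) (hLΩ i)
      have hgj := hg N (L j) (hL j) (hLΩ j)
      have hgij : IntegrableOn (g N) (L i ∩ L j) := hgi.mono_set inter_subset_left
      calc ∫ x in L i ∩ L j, |W i x - W j x|
          ≤ ∫ x in L i ∩ L j, (|g N x - W i x| + |g N x - W j x|) := by
            refine integral_mono (hi.sub hj).abs ((hgij.sub hi).abs.add (hgij.sub hj).abs)
              fun x => ?_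
            change |W i x - W j x| ≤ |g N x - W i x| + |g N x - W j x|
            rw [abs_sub_comm (g N x) (W i x)]
            exact abs_sub_le _ _ _
        _ = (∫ x in L i ∩ L j, |g N x - W i x|) + ∫ x in L i ∩ L j, |g N x - W j x| :=
            integral_add (hgij.sub hi).abs (hgij.sub hj).abs
        _ ≤ _ := add_le_add
            (setIntegral_mono_set (hgi.sub (hWi i)).abs
              (Eventually.of_forall fun _ => abs_nonneg _) inter_subset_left.eventuallyLE)
            (setIntegral_mono_set (hgj.sub (hWi j)).abs
              (Eventually.of_forall fun _ => abs_nonneg _) inter_subset_right.eventuallyLE)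
    have hij : Integrable (fun x => |W i x - W j x|) (volume.restrict (L i ∩ L j)) :=
      (hi.sub hj).abs
    rw [integral_eq_zero_iff_of_nonneg (fun _ => abs_nonneg _) hij] at hzero
    filter_upwards [(ae_restrict_iff' hm).1 hzero] with x hx hxi hxj
    have := hx ⟨hxi, hxj⟩
    exact sub_eq_zero.1 (abs_eq_zero.1 this)
  classical
  set w : QSpace n → ℝ := fun x => if h : ∃ j, x ∈ L j then W (Nat.find h) x else 0
  have hw : ∀ j, ∀ᵐ x, x ∈ L j → w x = W j x := by
    intro j
    filter_upwards [ae_all_iff.2 fun i => hagree i j] with x hx hxj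
    have hex : ∃ j, x ∈ L j := ⟨j, hxj⟩
    simp only [w, dif_pos hex]
    exact hx _ (Nat.find_spec hex) hxj
  refine ⟨w, fun K hK hKΩ => ?_⟩
  obtain ⟨j, hj⟩ := hex K hK hKΩ
  have hae : W j =ᵐ[volume.restrict (L j)] w := by
    refine (ae_restrict_iff' (hL j).measurableSet).2 ?_
    filter_upwards [hw j] with x hx hxj using (hx hxj).symm
  have hwi : IntegrableOn w (L j) := Integrable.congr (hWi j) hae
  refine ⟨hwi.mono_set hj, squeeze_zero (fun N => integral_nonneg fun _ => abs_nonneg _)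
    (fun N => ?_) (hW j)⟩
  have hgj := hg N (L j) (hL j) (hLΩ j)
  calc ∫ x in K, |g N x - w x| ≤ ∫ x in L j, |g N x - w x| :=
        setIntegral_mono_set (hgj.sub hwi).abs
              (Eventually.of_forall fun _ => abs_nonneg _) hj.eventuallyLE
    _ = ∫ x in L j, |g N x - W j x| := by
        refine integral_congr_ae ?_
        filter_upwards [hae] with x hx
        rw [hx]

variable {u : ℕ → QSpace n → EReal} {κ : ℕ → QSpace n → ℝ} {ε : ℕ → ℝ}

lemma L1LocBdd.exists_integral_abs_cut_le (hB : L1LocBdd Ω u) (hL : ∀ N, InL1Loc Ω (u N))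
    {K : Set (QSpace n)} (hK : IsCompact K) (hKΩ : K ⊆ Ω) :
    ∃ C : ℝ, 0 ≤ C ∧ ∀ N, ∫ x, |cut K (u N) x| ≤ C := by
  obtain ⟨C, hC, h⟩ := hB K hK hKΩ
  refine ⟨C.toReal, ENNReal.toReal_nonneg, fun N => ?_⟩
  have : ∫ x, |cut K (u N) x| = (∫⁻ y in K, ‖(u N y).toReal‖ₑ).toReal := by
    have h1 : ∀ x, |cut K (u N) x| = K.indicator (fun y => ‖(u N y).toReal‖) x := fun x => by
      by_cases hx : x ∈ K <;> simp [cut, hx]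
    simp only [h1]
    rw [integral_indicator hK.measurableSet, integral_norm_eq_lintegral_enorm]
    exact ((hL N).2 K hK hKΩ).1
  rw [this]
  exact ENNReal.toReal_mono hC (h N)

lemma IsQPsh.cut_le_convolution_ae {v : QSpace n → EReal} (hΩ : IsOpen Ω) (hv : IsQPsh Ω v)
    (hL : InL1Loc Ω v) {κ : QSpace n → ℝ} {ε : ℝ} (hκ : IsRadialKernel ε κ) {K : Set (QSpace n)}
    (hK : IsCompact K) (hKΩ : K ⊆ Ω) :
    ∀ᵐ x, closedBall x ε ⊆ K → cut K v x ≤ (cut K v ⋆ κ) x := by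
  filter_upwards [hL.ae_ne hΩ] with x hx hball
  have hxK : x ∈ K := hball (mem_closedBall_self hκ.pos.le)
  have h := hv.le_convolution hΩ hL hκ hK hKΩ hball
  have hx' := hx (hKΩ hxK)
  rw [cut_of_mem hxK]
  rw [← EReal.coe_toReal hx'.2 hx'.1] at h
  exact_mod_cast h

/-- A bounded family of psh functions in `L¹_loc(Ω)` whose regularizations converge pointwise is
Cauchy in `L¹_loc(Ω)`: it is uniformly close to its regularizations, and these converge in
`L¹_loc(Ω)` by dominated convergence. -/
lemma exists_tendstoL1Loc (hΩ : IsOpen Ω) (hu : ∀ N, IsQPsh Ω (u N))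
    (hL : ∀ N, InL1Loc Ω (u N)) (hB : L1LocBdd Ω u) (hκ : ∀ k, IsRadialKernel (ε k) (κ k))
    (hε : Tendsto ε atTop (𝓝 0))
    (hconv : ∀ k x, closedBall x (ε k) ⊆ Ω →
      ∃ l, Tendsto (fun N => ∫ y in Ω, (u N y).toReal * κ k (x - y)) atTop (𝓝 l)) :
    ∃ w : QSpace n → ℝ, TendstoL1Loc Ω u (fun x => (w x : EReal)) := by
  suffices hc : ∀ K : Set (QSpace n), IsCompact K → K ⊆ Ω → ∀ δ > 0, ∃ N₀, ∀ N ≥ N₀, ∀ M ≥ N₀,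
      ∫ x in K, |(u N x).toReal - (u M x).toReal| ≤ δ by
    obtain ⟨w, hw⟩ := exists_l1Loc_limit hΩ (fun N => (hL N).2) hc
    refine ⟨w, hL, ⟨Eventually.of_forall fun x => by simp, fun K hK hKΩ => ?_⟩,
      fun K hK hKΩ => ?_⟩
    · simpa using (hw K hK hKΩ).1
    · simpa using (hw K hK hKΩ).2
  intro K hK hKΩ δ hδ
  obtain ⟨η, hη, hηc, hηΩ, hη0, -, hη1⟩ := exists_cutoff hΩ hK hKΩ
  obtain ⟨ρ, hρ, hK₂, hK₂Ω⟩ := exists_cthickening_subset hΩ hηc.isCompact hηΩ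
  set K₂ := cthickening ρ (tsupport η)
  obtain ⟨C, hC0, hC⟩ := hB.exists_integral_abs_cut_le hL hK₂ hK₂Ω
  obtain ⟨ε₁, hε₁, happ⟩ := exists_forall_abs_convolution_sub_le hη.continuous hηc
    (δ := δ / (4 * (C + 1))) (by positivity)
  obtain ⟨k, hk⟩ := (hε.eventually (gt_mem_nhds (lt_min hρ hε₁))).exists
  have hball : ∀ x ∈ tsupport η, closedBall x (ε k) ⊆ K₂ := fun x hx =>
    (closedBall_subset_closedBall (hk.le.trans (min_le_left _ _))).trans
      (closedBall_subset_cthickening hx ρ)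
  have hKη : K ⊆ tsupport η := fun x hx => subset_tsupport _ (by simp [hη1 x hx])
  have hKK₂ : K ⊆ K₂ := hKη.trans (self_subset_cthickening _)
  have hcut : ∀ N, Integrable (cut K₂ (u N)) := fun N => (hL N).integrable_cut hK₂ hK₂Ω
  set G : ℕ → QSpace n → ℝ := fun N => cut K₂ (u N) ⋆ κ k
  have hGc : ∀ N, Continuous (G N) := fun N =>
    HasCompactSupport.continuous_convolution_right _ (hκ k).hasCompactSupport
      (hcut N).locallyIntegrable (hκ k).contDiff.continuous
  have hGi : ∀ N, IntegrableOn (G N) K := fun N => (hGc N).continuousOn.integrableOn_compact hK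
  -- uniformly in `N`, the function `u N` is close to its mollification
  have h1 : ∀ N, ∫ x in K, |G N x - cut K₂ (u N) x| ≤ δ / 4 := by
    intro N
    refine (setIntegral_abs_convolution_sub_le hK.measurableSet (hcut N) (hκ k) hη.continuous hηc
      hη0 hη1 ?_ (happ (ε k) (hk.le.trans (min_le_right _ _)) (κ k) (hκ k))).trans ?_
    · filter_upwards [(hu N).cut_le_convolution_ae hΩ (hL N) (hκ k) hK₂ hK₂Ω] with x hx hx0
      exact hx (hball x (subset_tsupport _ hx0))
    · calc δ / (4 * (C + 1)) * ∫ x, |cut K₂ (u N) x| ≤ δ / (4 * (C + 1)) * (C + 1) := by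
            gcongr
            linarith [hC N]
        _ = δ / 4 := by field_simp
  have hGl : ∀ x ∈ K, ∃ l, Tendsto (fun N => G N x) atTop (𝓝 l) := by
    intro x hx
    obtain ⟨l, hl⟩ := hconv k x ((hball x (hKη hx)).trans hK₂Ω)
    refine ⟨l, hl.congr fun N => ?_⟩
    exact setIntegral_mul_eq_convolution hΩ.measurableSet hK₂Ω (hball x (hKη hx))
      (hκ k).tsupport_subset _
  choose! l hl using hGl
  obtain ⟨B, hB'⟩ := (hκ k).contDiff.continuous.bounded_above_of_compact_support
    (hκ k).hasCompactSupport
  have hGb : ∀ N x, |G N x| ≤ C * B := fun N x =>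
    (abs_convolution_le (hcut N) hB' x).trans
      (mul_le_mul_of_nonneg_right (hC N) ((norm_nonneg _).trans (hB' 0)))
  have hlb : ∀ x ∈ K, |l x| ≤ C * B := fun x hx =>
    le_of_tendsto (hl x hx).abs (Eventually.of_forall fun N => hGb N x)
  have hlm : AEStronglyMeasurable l (volume.restrict K) :=
    aestronglyMeasurable_of_tendsto_ae atTop (fun N => (hGi N).1)
      ((ae_restrict_iff' hK.measurableSet).2 (Eventually.of_forall hl))
  have hli : IntegrableOn l K := by
    refine IntegrableOn.of_bound hK.measure_lt_top hlm (C * B) ?_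
    exact (ae_restrict_iff' hK.measurableSet).2 (Eventually.of_forall hlb)
  -- for the fixed kernel `κ k`, the mollifications are bounded and converge pointwise
  have h2 : Tendsto (fun N => ∫ x in K, |G N x - l x|) atTop (𝓝 0) := by
    have := tendsto_integral_of_dominated_convergence (μ := volume.restrict K)
      (F := fun N x => |G N x - l x|) (f := fun _ => 0) (fun _ => 2 * (C * B))
      (fun N => ((hGi N).sub hli).abs.1) (integrableOn_const hK.measure_lt_top.ne)
      (fun N => (ae_restrict_iff' hK.measurableSet).2 (Eventually.of_forall fun x hx => by
        rw [Real.norm_eq_abs, abs_abs]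
        refine (abs_sub _ _).trans ?_
        linarith [hGb N x, hlb x hx]))
      ((ae_restrict_iff' hK.measurableSet).2 (Eventually.of_forall fun x hx => by
        have := ((hl x hx).sub_const (l x)).abs
        simpa using this))
    simpa using this
  obtain ⟨N₀, hN₀⟩ := eventually_atTop.1 (h2.eventually (gt_mem_nhds (by positivity : 0 < δ / 4)))
  refine ⟨N₀, fun N hN M hM => ?_⟩
  have hci : ∀ N, IntegrableOn (cut K₂ (u N)) K := fun N => (hcut N).integrableOn
  have e1 : ∀ N, IntegrableOn (fun x => |G N x - cut K₂ (u N) x|) K := fun N =>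
    ((hGi N).sub (hci N)).abs
  have e2 : ∀ N, IntegrableOn (fun x => |G N x - l x|) K := fun N => ((hGi N).sub hli).abs
  calc ∫ x in K, |(u N x).toReal - (u M x).toReal|
      = ∫ x in K, |cut K₂ (u N) x - cut K₂ (u M) x| := by
        refine setIntegral_congr_fun hK.measurableSet fun x hx => ?_
        simp only [cut_of_mem (hKK₂ hx)]
    _ ≤ ∫ x in K, (((|G N x - cut K₂ (u N) x| + |G M x - cut K₂ (u M) x|) + |G N x - l x|)
          + |G M x - l x|) := by
        refine integral_mono ((hci N).sub (hci M)).abs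
          ((((e1 N).add (e1 M)).add (e2 N)).add (e2 M)) fun x => ?_
        change |cut K₂ (u N) x - cut K₂ (u M) x| ≤ _
        rw [show cut K₂ (u N) x - cut K₂ (u M) x
          = ((G M x - cut K₂ (u M) x) - (G N x - cut K₂ (u N) x)) + ((G N x - l x)
            - (G M x - l x)) by ring]
        refine (abs_add_le _ _).trans ?_
        have a1 := abs_sub (G M x - cut K₂ (u M) x) (G N x - cut K₂ (u N) x)
        have a2 := abs_sub (G N x - l x) (G M x - l x)
        linarith
    _ = (∫ x in K, |G N x - cut K₂ (u N) x|) + (∫ x in K, |G M x - cut K₂ (u M) x|)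
          + (∫ x in K, |G N x - l x|) + ∫ x in K, |G M x - l x| := by
        have e3 : IntegrableOn (fun x => |G N x - cut K₂ (u N) x| + |G M x - cut K₂ (u M) x|) K :=
          (e1 N).add (e1 M)
        have e4 : IntegrableOn (fun x => |G N x - cut K₂ (u N) x| + |G M x - cut K₂ (u M) x|
            + |G N x - l x|) K := e3.add (e2 N)
        rw [integral_add e4 (e2 M), integral_add e3 (e2 N), integral_add (e1 N) (e1 M)]
    _ ≤ δ := by linarith [h1 N, h1 M, hN₀ N hN, hN₀ M hM]

/-- By a diagonal argument, a bounded family in `L¹_loc(Ω)` has a subsequence whose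
regularizations converge pointwise: the convergence is arranged at the points of a countable dense
set, and the regularizations are equicontinuous. -/
lemma exists_subseq_tendsto_convolution (hL : ∀ N, InL1Loc Ω (u N)) (hΩ : IsOpen Ω)
    (hB : L1LocBdd Ω u) (hκ : ∀ k, IsRadialKernel (ε k) (κ k)) :
    ∃ s : ℕ → ℕ, StrictMono s ∧ ∀ k x, closedBall x (ε k) ⊆ Ω →
      ∃ l, Tendsto (fun m => ∫ y in Ω, (u (s m) y).toReal * κ k (x - y)) atTop (𝓝 l) := by
  classical
  set D : ℕ → QSpace n := TopologicalSpace.denseSeq (QSpace n)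
  set a : ℕ → ℕ × ℕ → ℝ := fun N i =>
    if closedBall (D i.2) (ε i.1) ⊆ Ω then ∫ y in Ω, (u N y).toReal * κ i.1 (D i.2 - y) else 0
  have hbd : ∀ i, ∃ R : ℝ, ∀ N, a N i ∈ Icc (-R) R := by
    intro i
    by_cases hi : closedBall (D i.2) (ε i.1) ⊆ Ω
    · obtain ⟨C, hC0, hC⟩ := hB.exists_integral_abs_cut_le hL (isCompact_closedBall _ _) hi
      obtain ⟨B, hB'⟩ := (hκ i.1).contDiff.continuous.bounded_above_of_compact_support
        (hκ i.1).hasCompactSupport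
      refine ⟨C * B, fun N => ?_⟩
      rw [mem_Icc, ← abs_le]
      simp only [a, if_pos hi]
      rw [setIntegral_mul_eq_convolution hΩ.measurableSet hi subset_rfl (hκ i.1).tsupport_subset]
      exact (abs_convolution_le ((hL N).integrable_cut (isCompact_closedBall _ _) hi) hB' _).trans
        (mul_le_mul_of_nonneg_right (hC N) ((norm_nonneg _).trans (hB' 0)))
    · exact ⟨0, fun N => by simp [a, hi]⟩
  choose R hR using hbd
  obtain ⟨b, -, s, hs, hsb⟩ := (isCompact_univ_pi fun i => isCompact_Icc (a := -R i) (b := R i))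
    |>.tendsto_subseq (x := a) fun N i _ => hR i N
  rw [tendsto_pi_nhds] at hsb
  refine ⟨s, hs, fun k x hx => ?_⟩
  refine cauchySeq_tendsto_of_complete (Metric.cauchySeq_iff.2 fun δ hδ => ?_)
  obtain ⟨ρ, hρ, hK, hKΩ⟩ := exists_cthickening_subset hΩ (isCompact_closedBall x (ε k)) hx
  set K := cthickening ρ (closedBall x (ε k))
  obtain ⟨C, hC0, hC⟩ := hB.exists_integral_abs_cut_le hL hK hKΩ
  obtain ⟨r, hr, huc⟩ := Metric.uniformContinuous_iff.1
    ((hκ k).hasCompactSupport.uniformContinuous_of_continuous (hκ k).contDiff.continuous)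
    (δ / (4 * (C + 1))) (by positivity)
  obtain ⟨d, hd⟩ := (TopologicalSpace.denseRange_denseSeq (QSpace n)).exists_dist_lt x
    (lt_min hρ hr)
  have hdK : closedBall (D d) (ε k) ⊆ K := fun y hy => by
    have hy' : y - D d + x ∈ closedBall x (ε k) := by
      rw [mem_closedBall, dist_eq_norm] at hy ⊢
      simpa using hy
    refine mem_cthickening_of_dist_le y _ ρ _ hy' ?_
    have : dist y (y - D d + x) = dist x (D d) := by
      rw [dist_comm, dist_eq_norm, dist_eq_norm]; congr 1; abel
    rw [this]
    exact hd.le.trans (min_le_left _ _)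
  have hxK : closedBall x (ε k) ⊆ K := self_subset_cthickening _
  have hclose : ∀ m, |(∫ y in Ω, (u (s m) y).toReal * κ k (x - y)) - a (s m) (k, d)| ≤ δ / 4 := by
    intro m
    have hcut := (hL (s m)).integrable_cut hK hKΩ
    simp only [a, if_pos (hdK.trans hKΩ)]
    rw [setIntegral_mul_eq_convolution hΩ.measurableSet hKΩ hxK (hκ k).tsupport_subset,
      setIntegral_mul_eq_convolution hΩ.measurableSet hKΩ hdK (hκ k).tsupport_subset]
    change |(cut K (u (s m)) ⋆ κ k) x - (cut K (u (s m)) ⋆ κ k) (D d)| ≤ _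
    rw [convolution_apply, convolution_apply, ← integral_sub
      (integrable_mul_comp_sub hcut (hκ k).contDiff.continuous (hκ k).hasCompactSupport x)
      (integrable_mul_comp_sub hcut (hκ k).contDiff.continuous (hκ k).hasCompactSupport _)]
    calc _ ≤ ∫ y, |cut K (u (s m)) y| * (δ / (4 * (C + 1))) := by
          rw [← Real.norm_eq_abs]
          refine norm_integral_le_of_norm_le (hcut.abs.mul_const _)
            (Eventually.of_forall fun y => ?_)
          rw [← mul_sub, norm_mul, Real.norm_eq_abs]
          refine mul_le_mul_of_nonneg_left ?_ (abs_nonneg _)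
          rw [← dist_eq_norm]
          refine (huc ?_).le
          rw [dist_sub_right]
          exact hd.trans_le (min_le_right _ _)
      _ = (∫ y, |cut K (u (s m)) y|) * (δ / (4 * (C + 1))) := integral_mul_const _ _
      _ ≤ (C + 1) * (δ / (4 * (C + 1))) := by gcongr; linarith [hC (s m)]
      _ = δ / 4 := by field_simp
  obtain ⟨N₀, hN₀⟩ := Metric.cauchySeq_iff.1 (hsb (k, d)).cauchySeq (δ / 4) (by positivity)
  refine ⟨N₀, fun m hm m' hm' => ?_⟩
  have h1 := hclose m
  have h2 := hclose m'
  have h3 := hN₀ m hm m' hm'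
  rw [Real.dist_eq] at h3 ⊢
  rw [abs_lt] at h3 ⊢
  rw [abs_le] at h1 h2
  simp only [Function.comp_apply] at h3
  constructor <;> linarith [h1.1, h1.2, h2.1, h2.2, h3.1, h3.2]

end LimitExistence

/-! ### Limits of psh functions in `L¹_loc` -/

section PshLimits

variable {n : ℕ} {Ω : Set (QSpace n)} {u : ℕ → QSpace n → EReal} {w : QSpace n → EReal}

/-- A sequence converging in `L¹` has a subsequence converging almost everywhere. -/
lemma exists_subseq_tendsto_ae {α : Type*} [MeasurableSpace α] {μ : Measure α}
    {g : ℕ → α → ℝ} {f : α → ℝ} (hg : ∀ N, Integrable (g N) μ) (hf : Integrable f μ)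
    (h : Tendsto (fun N => ∫ x, |g N x - f x| ∂μ) atTop (𝓝 0)) :
    ∃ s : ℕ → ℕ, StrictMono s ∧ ∀ᵐ x ∂μ, Tendsto (fun m => g (s m) x) atTop (𝓝 (f x)) := by
  have h1 : Tendsto (fun N => eLpNorm (g N - f) 1 μ) atTop (𝓝 0) := by
    have h2 := ENNReal.tendsto_ofReal h
    rw [ENNReal.ofReal_zero] at h2
    refine h2.congr fun N => ?_
    rw [eLpNorm_one_eq_lintegral_enorm,
      ← ofReal_integral_norm_eq_lintegral_enorm ((hg N).sub hf)]
    rfl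
  exact (tendstoInMeasure_of_tendsto_eLpNorm one_ne_zero (fun N => (hg N).1) hf.1
    h1).exists_seq_tendsto_ae

lemma TendstoL1Loc.tendsto_integral_abs_cut_sub (hT : TendstoL1Loc Ω u w) {K : Set (QSpace n)}
    (hK : IsCompact K) (hKΩ : K ⊆ Ω) :
    Tendsto (fun N => ∫ x, |cut K (u N) x - cut K w x|) atTop (𝓝 0) := by
  refine (hT.2.2 K hK hKΩ).congr fun N => ?_
  rw [← integral_indicator hK.measurableSet]
  congr 1
  ext x
  by_cases hx : x ∈ K <;> simp [cut, hx]

lemma abs_integral_mul_sub_le {f g h : QSpace n → ℝ} (hf : Integrable f) (hg : Integrable g)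
    (hh : Continuous h) {B : ℝ} (hB : ∀ x, |h x| ≤ B) :
    |(∫ x, f x * h x) - ∫ x, g x * h x| ≤ B * ∫ x, |f x - g x| := by
  have hi : ∀ {f : QSpace n → ℝ}, Integrable f → Integrable fun x => f x * h x := fun hf =>
    hf.mul_bdd (c := B) hh.aestronglyMeasurable (Eventually.of_forall hB)
  rw [← integral_sub (hi hf) (hi hg), ← integral_const_mul, ← Real.norm_eq_abs]
  refine norm_integral_le_of_norm_le ((hf.sub hg).abs.const_mul B)
    (Eventually.of_forall fun x => ?_)
  rw [← sub_mul, norm_mul, mul_comm]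
  exact mul_le_mul_of_nonneg_right (hB x) (norm_nonneg _)

lemma TendstoL1Loc.tendsto_integral_cut_mul (hT : TendstoL1Loc Ω u w) {K : Set (QSpace n)}
    (hK : IsCompact K) (hKΩ : K ⊆ Ω) {h : QSpace n → ℝ} (hh : Continuous h)
    (hhc : HasCompactSupport h) :
    Tendsto (fun N => ∫ x, cut K (u N) x * h x) atTop (𝓝 (∫ x, cut K w x * h x)) := by
  obtain ⟨B, hB⟩ := hh.bounded_above_of_compact_support hhc
  rw [tendsto_iff_dist_tendsto_zero]
  refine squeeze_zero (fun _ => dist_nonneg) (fun N => ?_)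
    (by simpa using (hT.tendsto_integral_abs_cut_sub hK hKΩ).const_mul B)
  exact abs_integral_mul_sub_le ((hT.1 N).integrable_cut hK hKΩ)
    (hT.2.1.integrable_cut hK hKΩ) hh hB

lemma continuous_convolution_kernel {f κ : QSpace n → ℝ} {ε : ℝ} (hf : Integrable f)
    (hκ : IsRadialKernel ε κ) : Continuous (f ⋆ κ) :=
  HasCompactSupport.continuous_convolution_right _ hκ.hasCompactSupport
      hf.locallyIntegrable hκ.contDiff.continuous

lemma TendstoL1Loc.tendsto_convolution (hT : TendstoL1Loc Ω u w) {K : Set (QSpace n)}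
    (hK : IsCompact K) (hKΩ : K ⊆ Ω) {κ : QSpace n → ℝ} {ε : ℝ} (hκ : IsRadialKernel ε κ)
    (x : QSpace n) :
    Tendsto (fun N => (cut K (u N) ⋆ κ) x) atTop (𝓝 ((cut K w ⋆ κ) x)) :=
  hT.tendsto_integral_cut_mul hK hKΩ (h := fun y => κ (x - y))
    (hκ.contDiff.continuous.comp (continuous_const.sub continuous_id))
    (hκ.hasCompactSupport.comp_homeomorph (Homeomorph.subLeft x))

/-- The limit in `L¹_loc` of psh functions lies below its regularizations almost everywhere. -/
lemma TendstoL1Loc.cut_le_convolution_ae (hΩ : IsOpen Ω) (hu : ∀ N, IsQPsh Ω (u N))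
    (hT : TendstoL1Loc Ω u w) {K : Set (QSpace n)} (hK : IsCompact K) (hKΩ : K ⊆ Ω)
    {κ : QSpace n → ℝ} {ε : ℝ} (hκ : IsRadialKernel ε κ) :
    ∀ᵐ x, closedBall x ε ⊆ K → cut K w x ≤ (cut K w ⋆ κ) x := by
  obtain ⟨s, hs, hae⟩ := exists_subseq_tendsto_ae
    (fun N => (hT.1 N).integrable_cut hK hKΩ) (hT.2.1.integrable_cut hK hKΩ)
    (hT.tendsto_integral_abs_cut_sub hK hKΩ)
  filter_upwards [hae, ae_all_iff.2 fun N =>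
    (hu N).cut_le_convolution_ae hΩ (hT.1 N) hκ hK hKΩ] with x hx hle hball
  exact le_of_tendsto_of_tendsto' hx ((hT.tendsto_convolution hK hKΩ hκ x).comp hs.tendsto_atTop)
    fun m => hle _ hball

lemma closedBall_subset_cthickening_closedBall {x y : QSpace n} {ε ρ : ℝ} (h : dist y x ≤ ρ) :
    closedBall y ε ⊆ cthickening ρ (closedBall x ε) := by
  intro z hz
  have hz' : z - y + x ∈ closedBall x ε := by
    rw [mem_closedBall, dist_eq_norm] at hz ⊢
    simpa using hz
  refine mem_cthickening_of_dist_le z _ ρ _ hz' ?_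
  have : dist z (z - y + x) = dist y x := by
    rw [dist_eq_norm, dist_eq_norm]; congr 1; abel
  rw [this]
  exact h

/-- The upper envelope of the regularizations `w ⋆ κ k`, defined as their infimum. -/
noncomputable def regularizedInf (Ω : Set (QSpace n)) (w : QSpace n → EReal)
    (κ : ℕ → QSpace n → ℝ) (ε : ℕ → ℝ) (x : QSpace n) : EReal :=
  ⨅ k, ⨅ (_ : closedBall x (ε k) ⊆ Ω), ((∫ y in Ω, (w y).toReal * κ k (x - y) : ℝ) : EReal)

variable {κ : ℕ → QSpace n → ℝ} {ε : ℕ → ℝ}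

lemma regularizedInf_le {x : QSpace n} {k : ℕ} (h : closedBall x (ε k) ⊆ Ω) :
    regularizedInf Ω w κ ε x ≤ ((∫ y in Ω, (w y).toReal * κ k (x - y) : ℝ) : EReal) :=
  iInf₂_le k h

lemma exists_closedBall_subset_of_tendsto (hΩ : IsOpen Ω) (hε : Tendsto ε atTop (𝓝 0))
    {x : QSpace n} (hx : x ∈ Ω) : ∀ᶠ k in atTop, closedBall x (ε k) ⊆ Ω := by
  obtain ⟨r, hr, hball⟩ := exists_closedBall_subset_of_isOpen hΩ hx
  filter_upwards [hε.eventually (gt_mem_nhds hr)] with k hk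
  exact (closedBall_subset_closedBall hk.le).trans hball

lemma upperSemicontinuousOn_regularizedInf (hΩ : IsOpen Ω) (hL : InL1Loc Ω w)
    (hκ : ∀ k, IsRadialKernel (ε k) (κ k)) :
    UpperSemicontinuousOn (regularizedInf Ω w κ ε) Ω := by
  intro x hx c hc
  refine mem_nhdsWithin_of_mem_nhds ?_
  obtain ⟨k, hk⟩ := iInf_lt_iff.1 hc
  obtain ⟨hball, hk⟩ := iInf_lt_iff.1 hk
  obtain ⟨ρ, hρ, hK, hKΩ⟩ := exists_cthickening_subset hΩ (isCompact_closedBall x (ε k)) hball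
  have heq : ∀ y ∈ ball x ρ, ∫ z in Ω, (w z).toReal * κ k (y - z)
      = (cut (cthickening ρ (closedBall x (ε k))) w ⋆ κ k) y := fun y hy =>
    setIntegral_mul_eq_convolution hΩ.measurableSet hKΩ
      (closedBall_subset_cthickening_closedBall (mem_ball.1 hy).le) (hκ k).tsupport_subset _
  have hcont : Continuous fun y =>
      (((cut (cthickening ρ (closedBall x (ε k))) w ⋆ κ k) y : ℝ) : EReal) :=
    continuous_coe_real_ereal.comp (continuous_convolution_kernel (hL.integrable_cut hK hKΩ) (hκ k))
  rw [heq x (mem_ball_self hρ)] at hk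
  filter_upwards [hcont.continuousAt.eventually (gt_mem_nhds hk), ball_mem_nhds x hρ] with y hy hyb
  refine lt_of_le_of_lt (regularizedInf_le (k := k) ?_) (by rw [heq y hyb]; exact hy)
  exact (closedBall_subset_cthickening_closedBall (mem_ball.1 hyb).le).trans hKΩ

/-- The infimum of the regularizations of `w` is a representative of `w`. -/
lemma regularizedInf_ae_eq (hΩ : IsOpen Ω) (hu : ∀ N, IsQPsh Ω (u N)) (hT : TendstoL1Loc Ω u w)
    (hκ : ∀ k, IsRadialKernel (ε k) (κ k)) (hε : Tendsto ε atTop (𝓝 0)) :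
    ∀ᵐ x, x ∈ Ω → regularizedInf Ω w κ ε x = w x := by
  have hL := hT.2.1
  have hle : ∀ k, ∀ᵐ x, closedBall x (ε k) ⊆ Ω →
      (w x).toReal ≤ ∫ y in Ω, (w y).toReal * κ k (x - y) := by
    intro k
    refine measure_null_of_locally_null _ fun x hx => ?_
    simp only [mem_compl_iff, mem_ofPred_eq, Classical.not_imp] at hx
    obtain ⟨ρ, hρ, hK, hKΩ⟩ := exists_cthickening_subset hΩ (isCompact_closedBall x (ε k)) hx.1
    refine ⟨_, inter_mem_nhdsWithin _ (ball_mem_nhds x hρ), ?_⟩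
    refine measure_mono_null ?_ (hT.cut_le_convolution_ae hΩ hu hK hKΩ (hκ k))
    rintro y ⟨hy, hyb⟩ hcon
    simp only [mem_compl_iff, mem_ofPred_eq, Classical.not_imp] at hy
    have hsub := closedBall_subset_cthickening_closedBall (ε := ε k) (mem_ball.1 hyb).le
    have := hcon hsub
    rw [cut_of_mem (hsub (mem_closedBall_self (hκ k).pos.le))] at this
    rw [setIntegral_mul_eq_convolution hΩ.measurableSet hKΩ hsub (hκ k).tsupport_subset] at hy
    exact hy.2 this
  -- along a subsequence the regularizations converge to `w` almost everywhere
  have hge : ∀ᵐ x, x ∈ Ω → regularizedInf Ω w κ ε x ≤ ((w x).toReal : EReal) := by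
    refine measure_null_of_locally_null _ fun x hx => ?_
    simp only [mem_compl_iff, mem_ofPred_eq, Classical.not_imp] at hx
    obtain ⟨r, hr, hball⟩ := exists_closedBall_subset_of_isOpen hΩ hx.1
    obtain ⟨η, hη, hηc, hηΩ, hη0, -, hη1⟩ := exists_cutoff hΩ (isCompact_closedBall x r) hball
    obtain ⟨ρ, hρ, hK₂, hK₂Ω⟩ := exists_cthickening_subset hΩ hηc.isCompact hηΩ
    set K₂ := cthickening ρ (tsupport η)
    have hKη : closedBall x r ⊆ tsupport η := fun x hx => subset_tsupport _ (by simp [hη1 x hx])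
    have hf : Integrable (cut K₂ w) := hL.integrable_cut hK₂ hK₂Ω
    have hlim : Tendsto (fun k => ∫ y in closedBall x r, |(cut K₂ w ⋆ κ k) y - cut K₂ w y|)
        atTop (𝓝 0) := by
      have h0 : ∀ k, 0 ≤ ∫ y in closedBall x r, |(cut K₂ w ⋆ κ k) y - cut K₂ w y| :=
        fun k => integral_nonneg fun _ => abs_nonneg _
      set I := ∫ y, |cut K₂ w y|
      have hI : 0 ≤ I := integral_nonneg fun _ => abs_nonneg _
      refine Metric.tendsto_atTop.2 fun δ hδ => ?_
      obtain ⟨ε₁, hε₁, happ⟩ := exists_forall_abs_convolution_sub_le hη.continuous hηc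
        (δ := δ / (2 * (I + 1))) (by positivity)
      obtain ⟨k₀, hk₀⟩ := eventually_atTop.1 (hε.eventually (gt_mem_nhds (lt_min hρ hε₁)))
      refine ⟨k₀, fun k hk => ?_⟩
      have hk' := hk₀ k hk
      rw [Real.dist_0_eq_abs, abs_of_nonneg (h0 k)]
      refine (setIntegral_abs_convolution_sub_le measurableSet_closedBall hf (hκ k) hη.continuous
        hηc hη0 hη1 ?_ (happ (ε k) (hk'.le.trans (min_le_right _ _)) (κ k) (hκ k))).trans_lt ?_
      · filter_upwards [hT.cut_le_convolution_ae hΩ hu hK₂ hK₂Ω (hκ k)] with y hy hy0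
        exact hy ((closedBall_subset_closedBall (hk'.le.trans (min_le_left _ _))).trans
          (closedBall_subset_cthickening (subset_tsupport _ hy0) ρ))
      · calc δ / (2 * (I + 1)) * I ≤ δ / (2 * (I + 1)) * (I + 1) := by gcongr; linarith
          _ = δ / 2 := by field_simp
          _ < δ := by linarith
    obtain ⟨s, hs, hae⟩ := exists_subseq_tendsto_ae
      (fun k => (continuous_convolution_kernel hf (hκ k)).continuousOn.integrableOn_compact
        (μ := volume) (isCompact_closedBall x r)) hf.integrableOn hlim
    rw [ae_restrict_iff' measurableSet_closedBall] at hae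
    refine ⟨_, inter_mem_nhdsWithin _ (closedBall_mem_nhds x hr), ?_⟩
    refine measure_mono_null ?_ hae
    rintro y ⟨hy, hyb⟩ hcon
    simp only [mem_compl_iff, mem_ofPred_eq, Classical.not_imp] at hy
    have hlim := hcon hyb
    rw [cut_of_mem (self_subset_cthickening _ (hKη hyb))] at hlim
    refine hy.2 (ge_of_tendsto (continuous_coe_real_ereal.continuousAt.tendsto.comp hlim) ?_)
    have hev := (hε.comp hs.tendsto_atTop).eventually (gt_mem_nhds hρ)
    filter_upwards [hev] with m hm
    have hsub : closedBall y (ε (s m)) ⊆ K₂ := (closedBall_subset_closedBall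
      (show ε (s m) ≤ ρ from le_of_lt hm)).trans (closedBall_subset_cthickening (hKη hyb) ρ)
    refine (regularizedInf_le (k := s m) (hsub.trans hK₂Ω)).trans (le_of_eq ?_)
    rw [setIntegral_mul_eq_convolution hΩ.measurableSet hK₂Ω hsub (hκ (s m)).tsupport_subset]
    rfl
  filter_upwards [ae_all_iff.2 hle, hge, hL.ae_ne hΩ] with x h1 h2 h3 hx
  have h4 := EReal.coe_toReal (h3 hx).2 (h3 hx).1
  refine le_antisymm ((h2 hx).trans_eq h4) ?_
  rw [← h4]
  exact le_iInf₂ fun k hk => by exact_mod_cast h1 k hk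

/-- Since `w ⋆ κ k` only depends on the class of `w`, upper semi-continuity of the infimum of the
regularizations implies that they converge to their infimum at every point. -/
lemma tendsto_regularizedInf (hΩ : IsOpen Ω) (hL : InL1Loc Ω w)
    (hκ : ∀ k, IsRadialKernel (ε k) (κ k)) (hε : Tendsto ε atTop (𝓝 0))
    (hae : ∀ᵐ x, x ∈ Ω → regularizedInf Ω w κ ε x = w x) {x : QSpace n} (hx : x ∈ Ω) :
    Tendsto (fun k => ((∫ y in Ω, (w y).toReal * κ k (x - y) : ℝ) : EReal)) atTop
      (𝓝 (regularizedInf Ω w κ ε x)) := by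
  refine tendsto_order.2 ⟨fun a ha => ?_, fun a ha => ?_⟩
  · filter_upwards [exists_closedBall_subset_of_tendsto hΩ hε hx] with k hk
    exact ha.trans_le (regularizedInf_le hk)
  · obtain ⟨c, hc, hca⟩ := EReal.lt_iff_exists_real_btwn.1 ha
    have husc := upperSemicontinuousOn_regularizedInf hΩ hL hκ x hx c hc
    rw [hΩ.nhdsWithin_eq hx] at husc
    obtain ⟨ρ, hρ, hball⟩ := nhds_basis_closedBall.mem_iff.1
      (Filter.inter_mem husc (hΩ.mem_nhds hx))
    filter_upwards [hε.eventually (gt_mem_nhds hρ)] with k hk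
    have hsub : closedBall x (ε k) ⊆ closedBall x ρ := closedBall_subset_closedBall hk.le
    have hKΩ : closedBall x ρ ⊆ Ω := fun y hy => (hball hy).2
    refine lt_of_le_of_lt ?_ hca
    rw [setIntegral_mul_eq_convolution hΩ.measurableSet hKΩ hsub (hκ k).tsupport_subset]
    have hone : ∫ y, κ k (x - y) = 1 := by
      rw [integral_sub_left_eq_self (κ k) volume x, (hκ k).integral_eq_one]
    have hle : (cut (closedBall x ρ) w ⋆ κ k) x ≤ ∫ y, c * κ k (x - y) := by
      refine integral_mono_ae (integrable_mul_comp_sub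
        (hL.integrable_cut (isCompact_closedBall _ _) hKΩ) (hκ k).contDiff.continuous
        (hκ k).hasCompactSupport x) (((hκ k).integrable.comp_sub_left x).const_mul c) ?_
      filter_upwards [hae, hL.ae_ne hΩ] with y hy hfin
      change cut (closedBall x ρ) w y * κ k (x - y) ≤ c * κ k (x - y)
      by_cases h0 : κ k (x - y) = 0
      · simp [h0]
      have hyK : y ∈ closedBall x ρ := hsub (by
        have := (hκ k).norm_le h0
        rwa [mem_closedBall, dist_comm, dist_eq_norm])
      refine mul_le_mul_of_nonneg_right ?_ ((hκ k).nonneg _)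
      rw [cut_of_mem hyK]
      have h1 : w y < c := by rw [← hy (hKΩ hyK)]; exact (hball hyK).1
      rw [← EReal.coe_toReal (hfin (hKΩ hyK)).2 (hfin (hKΩ hyK)).1] at h1
      exact_mod_cast h1.le
    rw [integral_const_mul, hone, mul_one] at hle
    exact_mod_cast hle

end PshLimits

section LimitIsPsh

variable {n : ℕ} {Ω : Set (QSpace n)} {u : ℕ → QSpace n → EReal} {w : QSpace n → EReal}
  {κ : ℕ → QSpace n → ℝ} {ε : ℕ → ℝ}

/-- The regularizations of an `L¹_loc` limit of psh functions satisfy the sub-mean value inequality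
along right quaternionic lines. -/
lemma TendstoL1Loc.convolution_le_integral_line (hΩ : IsOpen Ω) (hu : ∀ N, IsQPsh Ω (u N))
    (hT : TendstoL1Loc Ω u w) {K : Set (QSpace n)} (hK : IsCompact K) (hKΩ : K ⊆ Ω)
    {κ : QSpace n → ℝ} {ε : ℝ} (hκ : IsRadialKernel ε κ) {x ξ : QSpace n}
    (hx : ∀ q : Quaternion ℝ, ‖q‖ ≤ 1 → closedBall (x + rightMul ξ q) ε ⊆ K) :
    (cut K w ⋆ κ) x ≤ ∫ θ : sphere (0 : Quaternion ℝ) 1,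
      (cut K w ⋆ κ) (x + rightMul ξ (θ : Quaternion ℝ)) ∂unitQuaternionMeasure := by
  obtain ⟨B, hB⟩ := hκ.contDiff.continuous.bounded_above_of_compact_support hκ.hasCompactSupport
  have hf : ∀ N, Integrable (cut K (u N)) := fun N => (hT.1 N).integrable_cut hK hKΩ
  have hw : Integrable (cut K w) := hT.2.1.integrable_cut hK hKΩ
  have hdiff : ∀ N z, |(cut K (u N) ⋆ κ) z - (cut K w ⋆ κ) z|
      ≤ B * ∫ y, |cut K (u N) y - cut K w y| := fun N z =>
    abs_integral_mul_sub_le (h := fun y => κ (z - y)) (hf N) hw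
      (hκ.contDiff.continuous.comp (continuous_const.sub continuous_id)) fun y => hB _
  have hline : ∀ N, (cut K (u N) ⋆ κ) x ≤ ∫ θ : sphere (0 : Quaternion ℝ) 1,
      (cut K (u N) ⋆ κ) (x + rightMul ξ (θ : Quaternion ℝ)) ∂unitQuaternionMeasure := by
    intro N
    have h := (hu N).integral_le_integral_line hΩ (hT.1 N) hK hKΩ (φ := fun y => κ (x - y)) (ξ := ξ)
      (hκ.contDiff.continuous.comp (continuous_const.sub continuous_id))
      (hκ.hasCompactSupport.comp_homeomorph (Homeomorph.subLeft x)) (fun y => hκ.nonneg _)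
      (fun y hy q hq => hx q hq (by
        have := hκ.norm_le hy
        rw [mem_closedBall, dist_comm, dist_eq_norm]
        simpa using this))
    refine h.trans_eq (integral_congr_ae (Eventually.of_forall fun θ => ?_))
    simp only [convolution_apply]
    refine integral_congr_ae (Eventually.of_forall fun y => ?_)
    simp only
    congr 2
    abel
  have hci : ∀ {f : QSpace n → ℝ}, Integrable f → Integrable (fun θ : sphere (0 : Quaternion ℝ) 1 =>
      (f ⋆ κ) (x + rightMul ξ (θ : Quaternion ℝ))) unitQuaternionMeasure := by
    intro f hf
    have hc : Continuous fun θ : sphere (0 : Quaternion ℝ) 1 =>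
        (f ⋆ κ) (x + rightMul ξ (θ : Quaternion ℝ)) :=
      (continuous_convolution_kernel hf hκ).comp (by fun_prop)
    exact hc.integrable_of_hasCompactSupport (HasCompactSupport.of_compactSpace _)
  have hlim := (hT.tendsto_integral_abs_cut_sub hK hKΩ).const_mul B
  have hlim2 := (hlim.add hlim).const_add (∫ θ : sphere (0 : Quaternion ℝ) 1,
      (cut K w ⋆ κ) (x + rightMul ξ (θ : Quaternion ℝ)) ∂unitQuaternionMeasure)
  rw [mul_zero, add_zero, add_zero] at hlim2
  refine ge_of_tendsto' hlim2 fun N => ?_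
  have h1 := abs_le.1 (hdiff N x)
  have h2 : ∫ θ : sphere (0 : Quaternion ℝ) 1,
      (cut K (u N) ⋆ κ) (x + rightMul ξ (θ : Quaternion ℝ)) ∂unitQuaternionMeasure
      ≤ ∫ θ : sphere (0 : Quaternion ℝ) 1, ((cut K w ⋆ κ) (x + rightMul ξ (θ : Quaternion ℝ))
        + B * ∫ y, |cut K (u N) y - cut K w y|) ∂unitQuaternionMeasure := by
    refine integral_mono (hci (hf N)) ((hci hw).add (integrable_const _)) fun θ => ?_
    have := (abs_le.1 (hdiff N (x + rightMul ξ (θ : Quaternion ℝ)))).2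
    change (cut K (u N) ⋆ κ) _ ≤ (cut K w ⋆ κ) _ + _
    linarith
  rw [integral_add (hci hw) (integrable_const _)] at h2
  simp only [integral_const, probReal_univ, one_smul] at h2
  linarith [h1.1, hline N]

lemma UpperSemicontinuousOn.comp_rightLine {v : QSpace n → EReal}
    (hv : UpperSemicontinuousOn v Ω) (a ξ : QSpace n) :
    UpperSemicontinuousOn (fun q => v (rightLine a ξ q)) {q | rightLine a ξ q ∈ Ω} := by
  intro q hq c hc
  have hcont : Continuous fun q => rightLine a ξ q := by
    simp only [rightLine_eq_add]; fun_prop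
  have ht : Tendsto (fun q => rightLine a ξ q) (𝓝[{q | rightLine a ξ q ∈ Ω}] q)
      (𝓝[Ω] (rightLine a ξ q)) :=
    tendsto_nhdsWithin_iff.2 ⟨hcont.continuousAt.tendsto.mono_left nhdsWithin_le_nhds,
      self_mem_nhdsWithin⟩
  exact ht.eventually (hv _ hq c hc)

/-- The infimum of the regularizations of an `L¹_loc` limit `w` of psh functions that are locally
uniformly bounded above is psh. It is equal to `w` almost everywhere, by `regularizedInf_ae_eq`. -/
lemma isQPsh_regularizedInf (hΩ : IsOpen Ω) (hu : ∀ N, IsQPsh Ω (u N))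
    (hb : LocUniformlyBddAbove Ω u) (hT : TendstoL1Loc Ω u w)
    (hκ : ∀ k, IsRadialKernel (ε k) (κ k)) (hε : Tendsto ε atTop (𝓝 0)) :
    IsQPsh Ω (regularizedInf Ω w κ ε) := by
  have hL := hT.2.1
  have husc := upperSemicontinuousOn_regularizedInf hΩ hL hκ
  have hae := regularizedInf_ae_eq hΩ hu hT hκ hε
  have hne : ∀ x ∈ Ω, regularizedInf Ω w κ ε x ≠ ⊤ := by
    intro x hx
    obtain ⟨k, hk⟩ := (exists_closedBall_subset_of_tendsto hΩ hε hx).exists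
    exact ne_top_of_le_ne_top (EReal.coe_ne_top _) (regularizedInf_le hk)
  refine ⟨husc, hne, fun a ξ hξ => ⟨husc.comp_rightLine a ξ, fun q hq => hne _ hq,
    fun c r hr hball => ?_⟩⟩
  set x := rightLine a ξ c
  have hpt : ∀ q : Quaternion ℝ, rightLine a ξ (c + r • q) = x + rightMul (r • ξ) q := by
    intro q
    simp only [x, rightLine_eq_add, rightMul_add_right, rightMul_smul_left, rightMul_smul_right]
    abel
  have hdisc : ∀ q : Quaternion ℝ, ‖q‖ ≤ 1 → x + rightMul (r • ξ) q ∈ Ω := by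
    intro q hq
    rw [← hpt]
    refine hball ?_
    rw [mem_closedBall, dist_self_add_left, norm_smul, Real.norm_of_nonneg hr.le]
    exact mul_le_of_le_one_right hr.le hq
  have hx : x ∈ Ω := by simpa [rightMul_zero_right] using hdisc 0 (by simp)
  set S : Set (QSpace n) := (fun q => x + rightMul (r • ξ) q) '' closedBall (0 : Quaternion ℝ) 1
  have hS : IsCompact S := (isCompact_closedBall _ _).image (by fun_prop)
  have hSΩ : S ⊆ Ω := by
    rintro _ ⟨q, hq, rfl⟩
    exact hdisc q (by simpa using hq)
  have hmemS : ∀ q : Quaternion ℝ, ‖q‖ ≤ 1 → x + rightMul (r • ξ) q ∈ S := fun q hq =>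
    ⟨q, by simpa using hq, rfl⟩
  have hxS : x ∈ S := by simpa [rightMul_zero_right] using hmemS 0 (by simp)
  obtain ⟨ρ, hρ, hK, hKΩ⟩ := exists_cthickening_subset hΩ hS hSΩ
  set K := cthickening ρ S
  obtain ⟨M, hM, huM⟩ := hb.exists_nonneg hK hKΩ
  obtain ⟨k₀, hk₀⟩ := eventually_atTop.1 (hε.eventually (gt_mem_nhds hρ))
  have hsub : ∀ k ≥ k₀, ∀ y ∈ S, closedBall y (ε k) ⊆ K := fun k hk y hy =>
    (closedBall_subset_closedBall (hk₀ k hk).le).trans (closedBall_subset_cthickening hy ρ)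
  set G : ℕ → QSpace n → ℝ := fun k => cut K w ⋆ κ k
  have hGeq : ∀ k ≥ k₀, ∀ y ∈ S, ∫ z in Ω, (w z).toReal * κ k (y - z) = G k y :=
    fun k hk y hy => setIntegral_mul_eq_convolution hΩ.measurableSet hKΩ (hsub k hk y hy)
      (hκ k).tsupport_subset _
  have hGc : ∀ k, Continuous (G k) := fun k =>
    continuous_convolution_kernel (hL.integrable_cut hK hKΩ) (hκ k)
  have hGM : ∀ k ≥ k₀, ∀ y ∈ S, G k y ≤ M := by
    intro k hk y hy
    refine le_of_tendsto' (hT.tendsto_convolution hK hKΩ (hκ k) y) fun N => ?_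
    have hone : ∫ z, κ k (y - z) = 1 := by
      rw [integral_sub_left_eq_self (κ k) volume y, (hκ k).integral_eq_one]
    calc (cut K (u N) ⋆ κ k) y ≤ ∫ z, M * κ k (y - z) := by
          refine integral_mono (integrable_mul_comp_sub ((hT.1 N).integrable_cut hK hKΩ)
            (hκ k).contDiff.continuous (hκ k).hasCompactSupport y)
            (((hκ k).integrable.comp_sub_left y).const_mul M) fun z => ?_
          refine mul_le_mul_of_nonneg_right ?_ ((hκ k).nonneg _)
          by_cases hz : z ∈ K
          · rw [cut_of_mem hz]
            by_cases hbot : u N z = ⊥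
            · simpa [hbot] using hM
            · have := EReal.toReal_le_toReal (huM N z hz) hbot (EReal.coe_ne_top M)
              simpa using this
          · simpa [cut, hz] using hM
      _ = M := by rw [integral_const_mul, hone, mul_one]
  have hvG : ∀ k ≥ k₀, ∀ y ∈ S, regularizedInf Ω w κ ε y ≤ (G k y : EReal) := fun k hk y hy => by
    rw [← hGeq k hk y hy]
    exact regularizedInf_le ((hsub k hk y hy).trans hKΩ)
  -- `M - G k` is non-negative on the disc `S` and converges there to the gap of the infimum, so that
  -- Fatou's lemma carries the sub-mean value inequality over to the limit
  have hvM : ∀ y ∈ S, regularizedInf Ω w κ ε y ≤ M := fun y hy =>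
    (hvG k₀ le_rfl y hy).trans (by exact_mod_cast hGM k₀ le_rfl y hy)
  have hGlim : ∀ y ∈ S, Tendsto (fun m => ENNReal.ofReal (M - G (m + k₀) y)) atTop
      (𝓝 ((M : EReal) - regularizedInf Ω w κ ε y).toENNReal) := by
    intro y hy
    have h1 := (tendsto_regularizedInf hΩ hL hκ hε hae (hSΩ hy)).comp (tendsto_add_atTop_nat k₀)
    have h2 : Tendsto (fun m => ((G (m + k₀) y : ℝ) : EReal)) atTop
        (𝓝 (regularizedInf Ω w κ ε y)) := by
      refine h1.congr fun m => ?_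
      simp only [Function.comp_apply]
      rw [hGeq _ (Nat.le_add_left _ _) y hy]
    have h3 : Tendsto (fun m => (M : EReal) - ((G (m + k₀) y : ℝ) : EReal)) atTop
        (𝓝 ((M : EReal) - regularizedInf Ω w κ ε y)) := by
      have hcont := EReal.continuousAt_add (p := ((M : EReal), -regularizedInf Ω w κ ε y))
        (Or.inl (EReal.coe_ne_top M)) (Or.inl (EReal.coe_ne_bot M))
      exact hcont.tendsto.comp (tendsto_const_nhds.prodMk_nhds h2.neg)
    exact (EReal.continuous_toENNReal.tendsto _).comp h3
  have hGline : ∀ k ≥ k₀, G k x ≤ ∫ θ : sphere (0 : Quaternion ℝ) 1,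
      G k (x + rightMul (r • ξ) (θ : Quaternion ℝ)) ∂unitQuaternionMeasure := fun k hk =>
    hT.convolution_le_integral_line hΩ hu hK hKΩ (hκ k) (x := x) (ξ := r • ξ)
      fun q hq => hsub k hk _ (hmemS q hq)
  clear_value G
  rw [sphereMean]
  have hpt' : ∀ θ : sphere (0 : Quaternion ℝ) 1,
      rightLine a ξ (c + r • (θ : Quaternion ℝ)) = x + rightMul (r • ξ) (θ : Quaternion ℝ) :=
    fun θ => hpt θ
  have hθS : ∀ θ : sphere (0 : Quaternion ℝ) 1, x + rightMul (r • ξ) (θ : Quaternion ℝ) ∈ S :=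
    fun θ => hmemS _ (norm_unitQuaternion θ).le
  simp only [hpt']
  have hline : Continuous fun θ : sphere (0 : Quaternion ℝ) 1 =>
      x + rightMul (r • ξ) (θ : Quaternion ℝ) := by fun_prop
  have hmeas : Measurable fun θ : sphere (0 : Quaternion ℝ) 1 =>
      regularizedInf Ω w κ ε (x + rightMul (r • ξ) (θ : Quaternion ℝ)) :=
    husc.measurable_comp hline fun θ => hSΩ (hθS θ)
  refine (le_erealIntegral_iff unitQuaternionMeasure hmeas hM (fun θ => hvM _ (hθS θ))
    (hvM x hxS)).2 ?_
  have hGm : ∀ m, Measurable fun θ : sphere (0 : Quaternion ℝ) 1 => ENNReal.ofReal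
      (M - G (m + k₀) (x + rightMul (r • ξ) (θ : Quaternion ℝ))) := fun m =>
    (continuous_const.sub ((hGc _).comp hline)).measurable.ennreal_ofReal
  calc ∫⁻ θ : sphere (0 : Quaternion ℝ) 1, ((M : EReal) - regularizedInf Ω w κ ε
          (x + rightMul (r • ξ) (θ : Quaternion ℝ))).toENNReal ∂unitQuaternionMeasure
      = ∫⁻ θ : sphere (0 : Quaternion ℝ) 1, liminf (fun m => ENNReal.ofReal
          (M - G (m + k₀) (x + rightMul (r • ξ) (θ : Quaternion ℝ)))) atTop
          ∂unitQuaternionMeasure :=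
        lintegral_congr fun θ => (hGlim _ (hθS θ)).liminf_eq.symm
    _ ≤ liminf (fun m => ∫⁻ θ : sphere (0 : Quaternion ℝ) 1, ENNReal.ofReal
          (M - G (m + k₀) (x + rightMul (r • ξ) (θ : Quaternion ℝ))) ∂unitQuaternionMeasure)
          atTop :=
        lintegral_liminf_le hGm
    _ ≤ liminf (fun _ => ((M : EReal) - regularizedInf Ω w κ ε x).toENNReal) (atTop : Filter ℕ) := by
        refine liminf_le_liminf (Eventually.of_forall fun m => ?_)
        have hm : k₀ ≤ m + k₀ := Nat.le_add_left _ _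
        have hGi : Integrable (fun θ : sphere (0 : Quaternion ℝ) 1 =>
            G (m + k₀) (x + rightMul (r • ξ) (θ : Quaternion ℝ))) unitQuaternionMeasure :=
          ((hGc _).comp hline).integrable_of_hasCompactSupport (HasCompactSupport.of_compactSpace _)
        have hGi' : Integrable (fun θ : sphere (0 : Quaternion ℝ) 1 =>
            M - G (m + k₀) (x + rightMul (r • ξ) (θ : Quaternion ℝ))) unitQuaternionMeasure :=
          (integrable_const _).sub hGi
        rw [← ofReal_integral_eq_lintegral_ofReal hGi' (Eventually.of_forall fun θ =>
          sub_nonneg.2 (hGM _ hm _ (hθS θ))), integral_sub (integrable_const _) hGi]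
        simp only [integral_const, probReal_univ, one_smul]
        have h1 := hGline _ hm
        calc _ ≤ ENNReal.ofReal (M - G (m + k₀) x) := ENNReal.ofReal_le_ofReal (by linarith)
          _ ≤ _ := by
              rw [← EReal.real_coe_toENNReal, EReal.coe_sub]
              exact EReal.toENNReal_le_toENNReal (EReal.sub_le_sub le_rfl (hvG _ hm x hxS))
    _ = _ := by simp [liminf_const]

end LimitIsPsh

/-! ### Compactness of families of psh functions -/

section Compactness

variable {n : ℕ} {u : ℕ → QSpace n → EReal}

lemma exists_radialKernel_seq (n : ℕ) : ∃ (κ : ℕ → QSpace n → ℝ) (ε : ℕ → ℝ),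
    (∀ k, IsRadialKernel (ε k) (κ k)) ∧ Tendsto ε atTop (𝓝 0) := by
  obtain ⟨χ, hχ⟩ := exists_isSmoothingKernel n
  exact ⟨fun k => scaledKernel χ (1 / ((k : ℝ) + 1)), fun k => 1 / ((k : ℝ) + 1),
    fun k => hχ.isRadialKernel (by positivity), tendsto_one_div_add_atTop_nhds_zero_nat⟩

/-- A psh function that is not identically `-∞` on the connected set `Ω` is in `L¹_loc(Ω)`. -/
lemma IsQPsh.inL1Loc {Ω : Set (QSpace n)} (hΩ : IsOpen Ω) (hconn : IsPreconnected Ω)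
    {v : QSpace n → EReal} (hv : IsQPsh Ω v) (hne : ∃ x ∈ Ω, v x ≠ ⊥) : InL1Loc Ω v := by
  obtain ⟨x, hx, hxv⟩ := hne
  have hb : LocUniformlyBddAbove Ω fun _ : ℕ => v := fun K hK hKΩ => by
    obtain ⟨M, -, hM⟩ := hv.exists_bound hK hKΩ
    exact ⟨M, fun _ => hM⟩
  obtain ⟨r₀, hr₀, hball⟩ := exists_closedBall_subset_of_isOpen hΩ hx
  obtain ⟨r, hr, rfl⟩ : ∃ r > 0, r₀ = 5 * r := ⟨r₀ / 5, by positivity, by ring⟩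
  obtain ⟨M, hM, hvM⟩ := hv.exists_bound (isCompact_closedBall x (5 * r)) hball
  have h₀ : LocGapBdd Ω (fun _ : ℕ => v) x :=
    locGapBdd_of_le hΩ (fun _ => hv) hr hM hball (fun _ => hvM) (c := (v x).toReal) fun _ =>
      ⟨x, mem_closedBall_self (by positivity), EReal.coe_toReal_le hxv⟩
  exact inL1Loc_of_locGapBdd hΩ (fun _ => hv)
    (locGapBdd_of_isPreconnected hΩ hconn (fun _ => hv) hb hx h₀) 0

lemma LocUniformlyBddAbove.comp {Ω : Set (QSpace n)} (hb : LocUniformlyBddAbove Ω u) (s : ℕ → ℕ) :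
    LocUniformlyBddAbove Ω fun m => u (s m) := fun K hK hKΩ => by
  obtain ⟨M, hM⟩ := hb K hK hKΩ
  exact ⟨M, fun m => hM (s m)⟩

/-- A sequence of psh functions that is locally uniformly bounded above and does not tend to `-∞`
locally uniformly has a subsequence converging in `L¹_loc(Ω)`. -/
lemma exists_subseq_tendstoL1Loc {Ω : Set (QSpace n)} (hΩ : IsOpen Ω) (hconn : IsPreconnected Ω)
    (hu : ∀ N, IsQPsh Ω (u N)) (hb : LocUniformlyBddAbove Ω u)
    (hbot : ¬ TendstoBotLocUniformly Ω u) :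
    ∃ k : ℕ → ℕ, StrictMono k ∧ ∃ v : QSpace n → EReal, TendstoL1Loc Ω (fun m => u (k m)) v := by
  unfold TendstoBotLocUniformly at hbot
  push Not at hbot
  obtain ⟨K, hK, hKΩ, c, hfreq⟩ := hbot
  obtain ⟨s, hs, hsx⟩ := extraction_of_frequently_atTop hfreq
  choose x hxK hxc using hsx
  obtain ⟨x₀, hx₀K, t, ht, hlim⟩ := hK.tendsto_subseq hxK
  have hx₀ := hKΩ hx₀K
  obtain ⟨r₀, hr₀, hball⟩ := exists_closedBall_subset_of_isOpen hΩ hx₀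
  obtain ⟨r, hr, rfl⟩ : ∃ r > 0, r₀ = 5 * r := ⟨r₀ / 5, by positivity, by ring⟩
  obtain ⟨m₀, hm₀⟩ := eventually_atTop.1
    (hlim.eventually (closedBall_mem_nhds x₀ (by positivity : 0 < 2 * r)))
  obtain ⟨M, hM, huM⟩ := hb.exists_nonneg (isCompact_closedBall x₀ (5 * r)) hball
  set k : ℕ → ℕ := fun m => s (t (m + m₀))
  have hk : StrictMono k := fun a b hab => hs (ht (by omega))
  have hu' : ∀ m, IsQPsh Ω (u (k m)) := fun m => hu (k m)
  have h₀ : LocGapBdd Ω (fun m => u (k m)) x₀ :=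
    locGapBdd_of_le hΩ hu' hr hM hball (fun m => huM (k m)) (c := c) fun m =>
      ⟨x (t (m + m₀)), hm₀ _ (Nat.le_add_left _ _), hxc _⟩
  have hloc := locGapBdd_of_isPreconnected hΩ hconn hu' (hb.comp k) hx₀ h₀
  have hL := inL1Loc_of_locGapBdd hΩ hu' hloc
  have hB := l1LocBdd_of_locGapBdd hloc
  obtain ⟨κ, ε, hκ, hε⟩ := exists_radialKernel_seq n
  obtain ⟨j, hj, hconv⟩ := exists_subseq_tendsto_convolution hL hΩ hB hκ
  have hB' : L1LocBdd Ω fun m => u (k (j m)) := fun K hK hKΩ => by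
    obtain ⟨C, hC, h⟩ := hB K hK hKΩ
    exact ⟨C, hC, fun m => h (j m)⟩
  obtain ⟨w, hw⟩ := exists_tendstoL1Loc hΩ (fun m => hu' (j m)) (fun m => hL (j m)) hB' hκ hε hconv
  exact ⟨fun m => k (j m), hk.comp hj, _, hw⟩

lemma pairing_eq_integral_cut {Ω K : Set (QSpace n)} (hΩ : MeasurableSet Ω) (hKΩ : K ⊆ Ω)
    {v : QSpace n → EReal} {φ : QSpace n → ℝ} (hφ : ∀ x, φ x ≠ 0 → x ∈ K) :
    pairing Ω v φ = ∫ x, cut K v x * φ x := by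
  rw [pairing, ← integral_indicator hΩ]
  refine integral_congr_ae (Eventually.of_forall fun x => ?_)
  by_cases h0 : φ x = 0
  · simp [indicator, h0]
  · simp [indicator, hKΩ (hφ x h0), cut, hφ x h0]

/-- If psh functions converge in the sense of distributions, the limit is a psh function, and the
convergence holds in `L¹_loc(Ω)`: the pairing with a cutoff function gives a local bound, and the
regularizations converge because `y ↦ κ (x - y)` is a test function. -/
lemma exists_isQPsh_of_tendsto_distribution (Ω : TopologicalSpace.Opens (QSpace n))
    (hconn : IsConnected (Ω : Set (QSpace n))) (hu : ∀ N, IsQPsh (Ω : Set (QSpace n)) (u N))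
    (hb : LocUniformlyBddAbove (Ω : Set (QSpace n)) u) (hne : ∀ N, ∃ x ∈ Ω, u N x ≠ ⊥)
    (U : 𝓓(Ω, ℝ) → ℝ)
    (hU : ∀ φ : 𝓓(Ω, ℝ), Tendsto (fun N => pairing (Ω : Set (QSpace n)) (u N) φ) atTop (𝓝 (U φ))) :
    ∃ v : QSpace n → EReal, IsQPsh (Ω : Set (QSpace n)) v ∧
      (∀ φ : 𝓓(Ω, ℝ), U φ = pairing (Ω : Set (QSpace n)) v φ) ∧
      TendstoL1Loc (Ω : Set (QSpace n)) u v := by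
  have hΩ : IsOpen (Ω : Set (QSpace n)) := Ω.isOpen
  have hL : ∀ N, InL1Loc (Ω : Set (QSpace n)) (u N) := fun N =>
    (hu N).inL1Loc hΩ hconn.isPreconnected (hne N)
  obtain ⟨x₀, hx₀⟩ := hconn.nonempty
  have hloc₀ : LocGapBdd (Ω : Set (QSpace n)) u x₀ := by
    obtain ⟨r, hr, hball⟩ := exists_closedBall_subset_of_isOpen hΩ hx₀
    obtain ⟨η, hη, hηc, hηΩ, hη0, -, hη1⟩ := exists_cutoff hΩ (isCompact_closedBall x₀ r) hball
    obtain ⟨M, hM, huM⟩ := hb.exists_nonneg hηc.isCompact hηΩ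
    have hηK : closedBall x₀ r ⊆ tsupport η := fun x hx => subset_tsupport _ (by simp [hη1 x hx])
    -- a convergent sequence of pairings is bounded below, which bounds the gaps in `L¹`
    obtain ⟨R, hR⟩ := (hU ⟨η, by simpa using hη, hηc, hηΩ⟩).bddBelow_range
    refine ⟨r, hr, M, hM, hball, fun N y hy => huM N y (hηK hy),
      ENNReal.ofReal (M * (∫ x, η x) - R), ENNReal.ofReal_ne_top, fun N => ?_⟩
    have hN : R ≤ pairing (Ω : Set (QSpace n)) (u N) η := hR ⟨N, rfl⟩
    have hsupp : ∀ y, η y ≠ 0 → y ∈ tsupport η := fun y hy => subset_tsupport _ hy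
    rw [pairing_eq_integral_cut hΩ.measurableSet hηΩ hsupp] at hN
    calc ∫⁻ y in closedBall x₀ r, gap (Ω : Set (QSpace n)) (u N) M y
        ≤ ∫⁻ y, ENNReal.ofReal (η y) * gap (Ω : Set (QSpace n)) (u N) M y := by
          rw [← lintegral_indicator measurableSet_closedBall]
          refine lintegral_mono fun y => ?_
          by_cases hy : y ∈ closedBall x₀ r
          · rw [indicator_of_mem hy, hη1 y hy, ENNReal.ofReal_one, one_mul]
          · rw [indicator_of_notMem hy]; exact zero_le
      _ = ENNReal.ofReal (M * (∫ x, η x) - ∫ x, cut (tsupport η) (u N) x * η x) :=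
          ((hL N).lintegral_mul_gap hΩ hηc.isCompact hηΩ (huM N) hη.continuous hηc hη0 hsupp).1
      _ ≤ _ := ENNReal.ofReal_le_ofReal (by linarith)
  have hB := l1LocBdd_of_locGapBdd
    (locGapBdd_of_isPreconnected hΩ hconn.isPreconnected hu hb hx₀ hloc₀)
  obtain ⟨κ, ε, hκ, hε⟩ := exists_radialKernel_seq n
  obtain ⟨w, hw⟩ := exists_tendstoL1Loc hΩ hu hL hB hκ hε fun k x hx => by
    have hcont : ContDiff ℝ ∞ fun y => κ k (x - y) :=
      (hκ k).contDiff.comp (contDiff_const.sub contDiff_id)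
    have hsub : tsupport (fun y => κ k (x - y)) ⊆ closedBall x (ε k) := by
      refine closure_minimal (fun y hy => ?_) isClosed_closedBall
      have := (hκ k).norm_le hy
      rwa [mem_closedBall, dist_comm, dist_eq_norm]
    exact ⟨_, hU ⟨fun y => κ k (x - y), by simpa using hcont,
      (hκ k).hasCompactSupport.comp_homeomorph (Homeomorph.subLeft x), hsub.trans hx⟩⟩
  set v := regularizedInf (Ω : Set (QSpace n)) (fun x => (w x : EReal)) κ ε
  have hv : IsQPsh (Ω : Set (QSpace n)) v := isQPsh_regularizedInf hΩ hu hb hw hκ hε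
  have hae : ∀ᵐ x, x ∈ (Ω : Set (QSpace n)) → v x = w x := regularizedInf_ae_eq hΩ hu hw hκ hε
  have hcongr : ∀ K : Set (QSpace n), IsCompact K → K ⊆ Ω →
      ∀ᵐ x ∂(volume.restrict K), v x = w x := fun K hK hKΩ => by
    rw [ae_restrict_iff' hK.measurableSet]
    filter_upwards [hae] with x hx hxK using hx (hKΩ hxK)
  have hvL : TendstoL1Loc (Ω : Set (QSpace n)) u v := by
    refine ⟨hL, ⟨?_, fun K hK hKΩ => ?_⟩, fun K hK hKΩ => ?_⟩
    · rw [ae_restrict_iff' hΩ.measurableSet]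
      filter_upwards [hae] with x hx hxΩ
      rw [hx hxΩ]
      exact ⟨EReal.coe_ne_bot _, EReal.coe_ne_top _⟩
    · refine (hw.2.1.2 K hK hKΩ).congr ?_
      filter_upwards [hcongr K hK hKΩ] with x hx
      rw [hx]
    · refine (hw.2.2 K hK hKΩ).congr fun N => ?_
      refine integral_congr_ae ?_
      filter_upwards [hcongr K hK hKΩ] with x hx
      rw [hx]
  refine ⟨v, hv, fun φ => ?_, hvL⟩
  refine tendsto_nhds_unique (hU φ) ?_
  have hsupp : ∀ y, φ y ≠ 0 → y ∈ tsupport φ := fun y hy => subset_tsupport _ hy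
  have h := hvL.tendsto_integral_cut_mul φ.hasCompactSupport.isCompact φ.tsupport_subset
    φ.continuous φ.hasCompactSupport
  rw [pairing_eq_integral_cut hΩ.measurableSet φ.tsupport_subset hsupp]
  refine h.congr fun N => ?_
  rw [pairing_eq_integral_cut hΩ.measurableSet φ.tsupport_subset hsupp]

end Compactness

/-! ### The Laplacian along right quaternionic lines -/

section LineLaplacian

variable {n : ℕ}

/-- The Laplacian of `q ↦ f (x + ξ q)` at `q = 0`. -/
noncomputable def lineLap (ξ : QSpace n) (f : QSpace n → ℝ) (x : QSpace n) : ℝ :=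
  ∑ c : Fin 4, secondDeriv (rightMul ξ (qUnit c)) (rightMul ξ (qUnit c)) f x

lemma secondDeriv_eq {f : QSpace n → ℝ} (hf : ContDiff ℝ ∞ f) (v w x : QSpace n) :
    secondDeriv v w f x = fderiv ℝ (fderiv ℝ f) x v w := by
  have hd : DifferentiableAt ℝ (fderiv ℝ f) x :=
    ((hf.fderiv_right (m := ∞) (by simp)).differentiable (by simp)) x
  rw [secondDeriv, fderiv_clm_apply hd (differentiableAt_const w)]
  simp

lemma fderiv_fderiv_symm {f : QSpace n → ℝ} (hf : ContDiff ℝ ∞ f) (v w x : QSpace n) :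
    fderiv ℝ (fderiv ℝ f) x v w = fderiv ℝ (fderiv ℝ f) x w v :=
  (hf.contDiffAt.isSymmSndFDerivAt (by
    simp only [minSmoothness_of_isRCLikeNormedField]
    exact WithTop.coe_le_coe.2 (le_top : (2 : ℕ∞) ≤ ⊤))) v w

lemma contDiff_lineLap {f : QSpace n → ℝ} (hf : ContDiff ℝ ∞ f) (ξ : QSpace n) :
    ContDiff ℝ ∞ (lineLap ξ f) := by
  unfold lineLap
  exact ContDiff.sum fun c _ => contDiff_secondDeriv hf _ _

lemma tsupport_lineLap_subset (f : QSpace n → ℝ) (ξ : QSpace n) :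
    tsupport (lineLap ξ f) ⊆ tsupport f := by
  refine closure_minimal (fun x hx => ?_) (isClosed_tsupport _)
  obtain ⟨c, -, hc⟩ := Finset.exists_ne_zero_of_sum_ne_zero hx
  exact tsupport_secondDeriv_subset f _ _ (subset_tsupport _ hc)

lemma hasCompactSupport_lineLap {f : QSpace n → ℝ} (hf : HasCompactSupport f) (ξ : QSpace n) :
    HasCompactSupport (lineLap ξ f) :=
  hf.of_isClosed_subset (isClosed_tsupport _) (tsupport_lineLap_subset f ξ)

lemma lineLap_convolution {f h : QSpace n → ℝ} (hf : LocallyIntegrable f) (hh : ContDiff ℝ ∞ h)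
    (hhc : HasCompactSupport h) (ξ : QSpace n) :
    lineLap ξ (f ⋆ h) = f ⋆ lineLap ξ h := by
  ext x
  have hi : ∀ c : Fin 4, Integrable fun y =>
      f y * secondDeriv (rightMul ξ (qUnit c)) (rightMul ξ (qUnit c)) h (x - y) := fun c =>
    HasCompactSupport.convolutionExists_right (ContinuousLinearMap.lsmul ℝ ℝ) (μ := volume)
      (hhc.of_isClosed_subset (isClosed_tsupport _) (tsupport_secondDeriv_subset h _ _)) hf
      (contDiff_secondDeriv hh _ _).continuous x
  rw [lineLap, convolution_apply]
  simp only [lineLap, Finset.mul_sum]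
  rw [integral_finsetSum _ fun c _ => hi c]
  refine Finset.sum_congr rfl fun c _ => ?_
  rw [secondDeriv_convolution hf hh hhc, convolution_apply]

lemma lineLap_add {f g : QSpace n → ℝ} (hf : ContDiff ℝ ∞ f) (hg : ContDiff ℝ ∞ g)
    (ξ : QSpace n) : lineLap ξ (f + g) = lineLap ξ f + lineLap ξ g := by
  ext x
  have h1 : fderiv ℝ (f + g) = fderiv ℝ f + fderiv ℝ g := funext fun y =>
    fderiv_add ((hf.differentiable (by simp)) y) ((hg.differentiable (by simp)) y)
  have h2 : fderiv ℝ (fderiv ℝ (f + g)) x = fderiv ℝ (fderiv ℝ f) x + fderiv ℝ (fderiv ℝ g) x := by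
    rw [h1]
    exact fderiv_add (((hf.fderiv_right (m := ∞) (by simp)).differentiable (by simp)) x)
      (((hg.fderiv_right (m := ∞) (by simp)).differentiable (by simp)) x)
  have hfg : ContDiff ℝ ∞ (f + g) := hf.add hg
  simp only [lineLap, Pi.add_apply, secondDeriv_eq hf, secondDeriv_eq hg,
    secondDeriv_eq hfg, h2, add_apply, Finset.sum_add_distrib]

lemma lineLap_smul {f : QSpace n → ℝ} (hf : ContDiff ℝ ∞ f) (c : ℝ)
    (ξ : QSpace n) : lineLap ξ (c • f) = c • lineLap ξ f := by
  ext x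
  have h1 : fderiv ℝ (c • f) = c • fderiv ℝ f := funext fun y =>
    fderiv_const_smul ((hf.differentiable (by simp)) y) c
  have h2 : fderiv ℝ (fderiv ℝ (c • f)) x = c • fderiv ℝ (fderiv ℝ f) x := by
    rw [h1]
    exact fderiv_const_smul (((hf.fderiv_right (m := ∞) (by simp)).differentiable (by simp)) x) c
  have hcf : ContDiff ℝ ∞ (c • f) := hf.const_smul c
  simp only [lineLap, Pi.smul_apply, secondDeriv_eq hf,
    secondDeriv_eq hcf, h2, smul_apply, Finset.smul_sum]

@[simp] lemma re_qUnit (a : Fin 4) : (qUnit a).re = if a = 0 then 1 else 0 := by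
  fin_cases a <;> simp [qUnit]

@[simp] lemma imI_qUnit (a : Fin 4) : (qUnit a).imI = if a = 1 then 1 else 0 := by
  fin_cases a <;> simp [qUnit]

@[simp] lemma imJ_qUnit (a : Fin 4) : (qUnit a).imJ = if a = 2 then 1 else 0 := by
  fin_cases a <;> simp [qUnit]

@[simp] lemma imK_qUnit (a : Fin 4) : (qUnit a).imK = if a = 3 then 1 else 0 := by
  fin_cases a <;> simp [qUnit]

lemma quaternion_eq_sum (q : Quaternion ℝ) : q = q.re • qUnit 0 + q.imI • qUnit 1 +
    q.imJ • qUnit 2 + q.imK • qUnit 3 := by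
  ext <;> simp

/-- The trace of a bilinear form on `ℍ` in the orthonormal basis `θ, θ i, θ j, θ k`. -/
lemma sum_bilin_mul_qUnit (B : Quaternion ℝ →ₗ[ℝ] Quaternion ℝ →ₗ[ℝ] ℝ) {θ : Quaternion ℝ}
    (hθ : ‖θ‖ = 1) :
    ∑ c : Fin 4, B (θ * qUnit c) (θ * qUnit c) = ∑ c : Fin 4, B (qUnit c) (qUnit c) := by
  have hn : θ.re * θ.re + θ.imI * θ.imI + θ.imJ * θ.imJ + θ.imK * θ.imK = 1 := by
    have h1 := Quaternion.normSq_eq_norm_mul_self θ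
    rw [hθ, Quaternion.normSq_def'] at h1
    linarith
  have hB : ∀ q : Quaternion ℝ, B q q = B (q.re • qUnit 0 + q.imI • qUnit 1 +
    q.imJ • qUnit 2 + q.imK • qUnit 3) (q.re • qUnit 0 + q.imI • qUnit 1 +
    q.imJ • qUnit 2 + q.imK • qUnit 3) := fun q => by rw [← quaternion_eq_sum]
  have h0 : θ * qUnit 0 = θ := by ext <;> simp
  have h1 : θ * qUnit 1 = ⟨-θ.imI, θ.re, θ.imK, -θ.imJ⟩ := by ext <;> simp
  have h2 : θ * qUnit 2 = ⟨-θ.imJ, -θ.imK, θ.re, θ.imI⟩ := by ext <;> simp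
  have h3 : θ * qUnit 3 = ⟨-θ.imK, θ.imJ, -θ.imI, θ.re⟩ := by ext <;> simp
  simp only [Fin.sum_univ_four, h0, h1, h2, h3]
  rw [hB θ, hB ⟨-θ.imI, θ.re, θ.imK, -θ.imJ⟩, hB ⟨-θ.imJ, -θ.imK, θ.re, θ.imI⟩,
    hB ⟨-θ.imK, θ.imJ, -θ.imI, θ.re⟩]
  simp only [map_add, map_smul, LinearMap.add_apply, LinearMap.smul_apply, smul_eq_mul]
  linear_combination (B (qUnit 0) (qUnit 0) + B (qUnit 1) (qUnit 1) + B (qUnit 2) (qUnit 2)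
    + B (qUnit 3) (qUnit 3)) * hn

/-- The second derivative of `f` at `x`, pulled back to the line through `x` with direction `ξ`. -/
noncomputable def lineHessian (f : QSpace n → ℝ) (x ξ : QSpace n) :
    Quaternion ℝ →ₗ[ℝ] Quaternion ℝ →ₗ[ℝ] ℝ :=
  LinearMap.mk₂ ℝ (fun p q => fderiv ℝ (fderiv ℝ f) x (rightMul ξ p) (rightMul ξ q))
    (fun p p' q => by simp [rightMul_add_right])
    (fun c p q => by simp [rightMul_smul_right])
    (fun p q q' => by simp [rightMul_add_right])
    (fun c p q => by simp [rightMul_smul_right])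

lemma lineLap_rightMul {f : QSpace n → ℝ} (hf : ContDiff ℝ ∞ f) (ξ x : QSpace n)
    {θ : Quaternion ℝ} (hθ : ‖θ‖ = 1) : lineLap (rightMul ξ θ) f x = lineLap ξ f x := by
  have := sum_bilin_mul_qUnit (lineHessian f x ξ) hθ
  simp only [lineLap, secondDeriv_eq hf, ← rightMul_mul]
  exact this

/-! #### Second differences -/

lemma tendsto_second_difference {f : QSpace n → ℝ} (hf : ContDiff ℝ ∞ f) (x v : QSpace n) :
    Tendsto (fun t : ℝ => (f (x + t • v) + f (x - t • v) - 2 * f x) / t ^ 2) (𝓝[>] 0)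
      (𝓝 (fderiv ℝ (fderiv ℝ f) x v v)) := by
  have hline : ∀ (s t : ℝ), HasDerivAt (fun t : ℝ => x + (s * t) • v) (s • v) t := by
    intro s t
    have h := (((hasDerivAt_id t).const_mul s).smul_const v).const_add x
    simpa using h
  have hd1 : ∀ (s t : ℝ), HasDerivAt (fun t : ℝ => f (x + (s * t) • v))
      (fderiv ℝ f (x + (s * t) • v) (s • v)) t := fun s t =>
    ((hf.differentiable (by simp)) _).hasFDerivAt.comp_hasDerivAt t (hline s t)
  have hf' : ContDiff ℝ ∞ (fderiv ℝ f) := hf.fderiv_right (m := ∞) (by simp)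
  have hd2 : ∀ (s t : ℝ), HasDerivAt (fun t : ℝ => fderiv ℝ f (x + (s * t) • v))
      (fderiv ℝ (fderiv ℝ f) (x + (s * t) • v) (s • v)) t := fun s t =>
    ((hf'.differentiable (by simp)) _).hasFDerivAt.comp_hasDerivAt t (hline s t)
  have hnum : ∀ t : ℝ, HasDerivAt (fun t : ℝ => f (x + t • v) + f (x - t • v) - 2 * f x)
      (fderiv ℝ f (x + t • v) v - fderiv ℝ f (x - t • v) v) t := by
    intro t
    have h := ((hd1 1 t).add (hd1 (-1) t)).sub_const (2 * f x)
    simp only [one_mul, one_smul, neg_mul, neg_smul, map_neg, ← sub_eq_add_neg] at h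
    exact h
  have hder : HasDerivAt (fun t : ℝ => fderiv ℝ f (x + t • v) v - fderiv ℝ f (x - t • v) v)
      (2 * fderiv ℝ (fderiv ℝ f) x v v) 0 := by
    have h := ((hd2 1 0).clm_apply (hasDerivAt_const 0 v)).sub
      ((hd2 (-1) 0).clm_apply (hasDerivAt_const 0 v))
    simp only [one_mul, one_smul, neg_mul, neg_smul, map_neg, ← sub_eq_add_neg, zero_smul,
      add_zero, map_zero, neg_apply, mul_zero] at h
    exact h.congr_deriv (by ring)
  refine HasDerivAt.lhopital_zero_nhdsGT (f' := fun t : ℝ =>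
    fderiv ℝ f (x + t • v) v - fderiv ℝ f (x - t • v) v) (g' := fun t => 2 * t)
    (Eventually.of_forall hnum) (Eventually.of_forall fun t => by simpa using hasDerivAt_pow 2 t)
    ?_ ?_ ?_ ?_
  · filter_upwards [self_mem_nhdsWithin] with t ht
    have : (0 : ℝ) < t := ht
    positivity
  · have h := (hnum 0).continuousAt.tendsto
    have h0 : f (x + (0 : ℝ) • v) + f (x - (0 : ℝ) • v) - 2 * f x = 0 := by simp; ring
    rw [h0] at h
    exact h.mono_left nhdsWithin_le_nhds
  · have h : Tendsto (fun t : ℝ => t ^ 2) (𝓝 0) (𝓝 (0 ^ 2)) := (continuous_pow 2).tendsto 0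
    rw [zero_pow two_ne_zero] at h
    exact h.mono_left nhdsWithin_le_nhds
  · have h := hasDerivAt_iff_tendsto_slope_zero.1 hder
    have hle : 𝓝[>] (0 : ℝ) ≤ 𝓝[≠] 0 := nhdsWithin_mono 0 fun t ht => (mem_Ioi.1 ht).ne'
    have h' := (h.mono_left hle).const_mul (1 / 2)
    simp only [zero_add, zero_smul, add_zero, sub_zero, sub_self, smul_eq_mul] at h'
    convert h' using 2
    · field_simp
    · ring

lemma exists_second_difference_bound {E : Type*} [NormedAddCommGroup E] [NormedSpace ℝ E]
    {f : E → ℝ} (hf : ContDiff ℝ ∞ f)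
    (hfc : HasCompactSupport f) : ∃ C : ℝ, 0 ≤ C ∧ ∀ x v : E,
      |f (x + v) + f (x - v) - 2 * f x| ≤ C * ‖v‖ ^ 2 := by
  have hf' : ContDiff ℝ ∞ (fderiv ℝ f) := hf.fderiv_right (m := ∞) (by simp)
  obtain ⟨L, hL⟩ := ContDiff.lipschitzWith_of_hasCompactSupport (hfc.fderiv ℝ) hf' (by simp)
  refine ⟨2 * L, by positivity, fun x v => ?_⟩
  have hline : ∀ (w : E) (t : ℝ), HasDerivAt (fun t : ℝ => x + t • w) w t := by
    intro w t
    simpa using ((hasDerivAt_id t).smul_const w).const_add x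
  have hd1 : ∀ (w : E) (t : ℝ), HasDerivAt (fun t : ℝ => f (x + t • w))
      (fderiv ℝ f (x + t • w) w) t := fun w t =>
    ((hf.differentiable (by simp)) _).hasFDerivAt.comp_hasDerivAt t (hline w t)
  have hd : ∀ t ∈ Icc (0 : ℝ) 1, HasDerivWithinAt
      (fun t : ℝ => f (x + t • v) + f (x + t • -v))
      (fderiv ℝ f (x + t • v) v + fderiv ℝ f (x + t • -v) (-v)) (Icc 0 1) t :=
    fun t _ => ((hd1 v t).add (hd1 (-v) t)).hasDerivWithinAt
  have hbound : ∀ t ∈ Ico (0 : ℝ) 1,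
      ‖fderiv ℝ f (x + t • v) v + fderiv ℝ f (x + t • -v) (-v)‖ ≤ 2 * L * ‖v‖ ^ 2 := by
    intro t ht
    have h1 : fderiv ℝ f (x + t • v) v + fderiv ℝ f (x + t • -v) (-v) =
        (fderiv ℝ f (x + t • v) - fderiv ℝ f (x + t • -v)) v := by
      rw [map_neg, ← sub_eq_add_neg, sub_apply]
    have h2 : ‖x + t • v - (x + t • -v)‖ ≤ 2 * ‖v‖ := by
      have : x + t • v - (x + t • -v) = (2 * t) • v := by module
      rw [this, norm_smul, Real.norm_of_nonneg (by linarith [ht.1])]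
      exact mul_le_mul_of_nonneg_right (by linarith [ht.2]) (norm_nonneg _)
    rw [h1]
    calc _ ≤ ‖fderiv ℝ f (x + t • v) - fderiv ℝ f (x + t • -v)‖ * ‖v‖ :=
          ContinuousLinearMap.le_opNorm _ _
      _ ≤ (L * (2 * ‖v‖)) * ‖v‖ := by
          refine mul_le_mul_of_nonneg_right ((hL.norm_sub_le _ _).trans ?_) (norm_nonneg _)
          exact mul_le_mul_of_nonneg_left h2 L.2
      _ = _ := by ring
  have h := norm_image_sub_le_of_norm_deriv_le_segment_01' hd hbound
  simp only [one_smul, zero_smul, add_zero, ← sub_eq_add_neg, Real.norm_eq_abs] at h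
  rwa [two_mul (f x)]

end LineLaplacian

/-! ### Positivity of the line Laplacians of a psh function -/

section Positivity

variable {n : ℕ} {Ω K : Set (QSpace n)} {u : QSpace n → EReal} {φ : QSpace n → ℝ}

lemma norm_qUnit (c : Fin 4) : ‖qUnit c‖ = 1 := by
  have h := Quaternion.normSq_eq_norm_mul_self (qUnit c)
  rw [Quaternion.normSq_def'] at h
  have h1 : ‖qUnit c‖ * ‖qUnit c‖ = 1 := by
    rw [← h]
    fin_cases c <;> simp
  nlinarith [norm_nonneg (qUnit c)]

/-- The distributional Laplacian of a psh function along right quaternionic lines is non-negative.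

For small `t`, the sub-mean value inequality on the spheres of radius `t` in the lines `y + ξ q`
bounds the average over unit quaternions `θ` of the second differences in the direction `ξ θ`
from below by `0`. In the limit `t → 0` this is the average of `D²φ(ξ θ, ξ θ)`, which by rotation
invariance is a quarter of the Laplacian along the line. -/
lemma IsQPsh.integral_cut_mul_lineLap_nonneg (hΩ : IsOpen Ω) (hu : IsQPsh Ω u) (hL : InL1Loc Ω u)
    (hK : IsCompact K) (hKΩ : K ⊆ Ω) (hφ : ContDiff ℝ ∞ φ) (hφc : HasCompactSupport φ)
    (hφ0 : ∀ y, 0 ≤ φ y) {ρ : ℝ} (hρ : 0 < ρ) (hφK : cthickening ρ (tsupport φ) ⊆ K)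
    (ξ : QSpace n) : 0 ≤ ∫ y, cut K u y * lineLap ξ φ y := by
  set f := cut K u
  have hf : Integrable f := hL.integrable_cut hK hKΩ
  let S := sphere (0 : Quaternion ℝ) 1
  let v : S → QSpace n := fun θ => rightMul ξ (θ : Quaternion ℝ)
  have hv : Continuous v := continuous_const.rightMul continuous_subtype_val
  have hvn : ∀ θ, ‖v θ‖ = ‖ξ‖ := fun θ => by
    simp only [v, norm_rightMul, norm_unitQuaternion, mul_one]
  let A : QSpace n → ℝ := fun w => ∫ y, f y * φ (y - w)
  have hA : Continuous A := continuous_integral_mul_comp_sub hf hφ.continuous hφc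
  have hfi : ∀ w, Integrable fun y => f y * φ (y - w) := fun w => by
    obtain ⟨C, hC⟩ := hφ.continuous.bounded_above_of_compact_support hφc
    exact hf.mul_bdd (c := C) (by fun_prop) (Eventually.of_forall fun y => hC _)
  obtain ⟨C, hC0, hC⟩ := exists_second_difference_bound hφ hφc
  let G : ℝ → S → ℝ := fun t θ =>
    ∫ y, f y * ((φ (y + t • v θ) + φ (y - t • v θ) - 2 * φ y) / t ^ 2)
  let J : S → ℝ := fun θ => ∫ y, f y * fderiv ℝ (fderiv ℝ φ) y (v θ) (v θ)
  have hGA : ∀ t θ, G t θ = (A (-(t • v θ)) + A (t • v θ) - 2 * A 0) / t ^ 2 := by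
    intro t θ
    have e : ∀ y, f y * ((φ (y + t • v θ) + φ (y - t • v θ) - 2 * φ y) / t ^ 2) =
        (f y * φ (y - -(t • v θ)) + f y * φ (y - t • v θ) - 2 * (f y * φ (y - 0))) / t ^ 2 := by
      intro y
      rw [sub_neg_eq_add, sub_zero]; ring
    simp only [G, A, e]
    rw [integral_div, integral_sub, integral_add (hfi _) (hfi _), integral_const_mul]
    · exact (hfi _).add (hfi _)
    · exact (hfi _).const_mul 2
  have hGc : ∀ t, Continuous (G t) := fun t => by
    simp only [funext (hGA t)]
    fun_prop
  have hGle : ∀ t, 0 < t → ∀ θ y,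
      ‖f y * ((φ (y + t • v θ) + φ (y - t • v θ) - 2 * φ y) / t ^ 2)‖
        ≤ |f y| * (C * ‖ξ‖ ^ 2) := by
    intro t ht θ y
    rw [norm_mul, Real.norm_eq_abs, Real.norm_eq_abs, abs_div, abs_of_pos (pow_pos ht 2)]
    refine mul_le_mul_of_nonneg_left ?_ (abs_nonneg _)
    rw [div_le_iff₀ (pow_pos ht 2)]
    refine (hC y (t • v θ)).trans (le_of_eq ?_)
    rw [norm_smul, hvn, Real.norm_of_nonneg ht.le]; ring
  -- both limits `t → 0`, in `y` and then in `θ`, are dominated by the bound for second differences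
  have hpos : ∀ᶠ t : ℝ in 𝓝[>] 0, 0 < t := self_mem_nhdsWithin
  have hGJ : ∀ θ, Tendsto (fun t => G t θ) (𝓝[>] 0) (𝓝 (J θ)) := by
    intro θ
    refine tendsto_integral_filter_of_dominated_convergence (fun y => |f y| * (C * ‖ξ‖ ^ 2)) ?_ ?_
      (hf.abs.mul_const _) ?_
    · refine Eventually.of_forall fun t => hf.aestronglyMeasurable.mul ?_
      have := hφ.continuous
      exact Continuous.aestronglyMeasurable (by fun_prop)
    · filter_upwards [hpos] with t ht
      exact Eventually.of_forall fun y => hGle t ht θ y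
    · exact Eventually.of_forall fun y => (tendsto_second_difference hφ y (v θ)).const_mul (f y)
  have hGb : ∀ t, 0 < t → ∀ θ, ‖G t θ‖ ≤ (∫ y, |f y|) * (C * ‖ξ‖ ^ 2) := by
    intro t ht θ
    rw [← integral_mul_const]
    exact norm_integral_le_of_norm_le (hf.abs.mul_const _)
      (Eventually.of_forall fun y => hGle t ht θ y)
  have hJm : AEStronglyMeasurable J unitQuaternionMeasure :=
    aestronglyMeasurable_of_tendsto_ae (𝓝[>] (0 : ℝ)) (fun t => (hGc t).aestronglyMeasurable)
      (Eventually.of_forall hGJ)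
  have hJb : ∀ θ, ‖J θ‖ ≤ (∫ y, |f y|) * (C * ‖ξ‖ ^ 2) := fun θ =>
    le_of_tendsto (hGJ θ).norm (by filter_upwards [hpos] with t ht using hGb t ht θ)
  have hJi : Integrable J unitQuaternionMeasure :=
    (integrable_const _).mono' hJm (Eventually.of_forall hJb)
  have hlim : Tendsto (fun t => ∫ θ, G t θ ∂unitQuaternionMeasure) (𝓝[>] 0)
      (𝓝 (∫ θ, J θ ∂unitQuaternionMeasure)) := by
    refine tendsto_integral_filter_of_dominated_convergence
      (fun _ => (∫ y, |f y|) * (C * ‖ξ‖ ^ 2)) ?_ ?_ (integrable_const _) ?_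
    · exact Eventually.of_forall fun t => (hGc t).aestronglyMeasurable
    · filter_upwards [hpos] with t ht using Eventually.of_forall fun θ => hGb t ht θ
    · exact Eventually.of_forall hGJ
  -- the sub-mean value inequality along the line, for the directions `t ξ` and `-t ξ`
  have hmean : ∀ s : ℝ, |s| * ‖ξ‖ ≤ ρ →
      A 0 ≤ ∫ θ : S, A (s • v θ) ∂unitQuaternionMeasure := by
    intro s hs
    have h := hu.integral_le_integral_line hΩ hL hK hKΩ hφ.continuous hφc hφ0 (ξ := s • ξ)
      (fun y hy q hq => hφK (by
        refine mem_cthickening_of_dist_le _ y ρ _ (subset_tsupport _ hy) ?_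
        rw [dist_eq_norm, add_sub_cancel_left, norm_rightMul, norm_smul, Real.norm_eq_abs]
        exact (mul_le_of_le_one_right (by positivity) hq).trans hs))
    simp only [A, v, sub_zero]
    simpa only [rightMul_smul_left] using h
  have hI : ∀ s : ℝ, Integrable (fun θ : S => A (s • v θ)) unitQuaternionMeasure := fun s =>
    Continuous.integrable_of_hasCompactSupport (by fun_prop) (HasCompactSupport.of_compactSpace _)
  have hGnn : ∀ᶠ t : ℝ in 𝓝[>] 0, 0 ≤ ∫ θ, G t θ ∂unitQuaternionMeasure := by
    have hsmall : ∀ᶠ t : ℝ in 𝓝[>] 0, t * ‖ξ‖ < ρ := by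
      have : Tendsto (fun t : ℝ => t * ‖ξ‖) (𝓝 0) (𝓝 (0 * ‖ξ‖)) :=
        (continuous_id.mul continuous_const).tendsto 0
      rw [zero_mul] at this
      exact (this.mono_left nhdsWithin_le_nhds).eventually (gt_mem_nhds hρ)
    filter_upwards [hpos, hsmall] with t ht hts
    have h1 := hmean t (by rw [abs_of_pos ht]; exact hts.le)
    have h2 := hmean (-t) (by rw [abs_neg, abs_of_pos ht]; exact hts.le)
    have h3 : ∫ θ, G t θ ∂unitQuaternionMeasure =
        ((∫ θ : S, A ((-t) • v θ) ∂unitQuaternionMeasure) +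
          (∫ θ : S, A (t • v θ) ∂unitQuaternionMeasure) - 2 * A 0) / t ^ 2 := by
      simp only [hGA, ← neg_smul]
      have hadd : Integrable (fun θ : S => A (-t • v θ) + A (t • v θ)) unitQuaternionMeasure :=
        (hI _).add (hI _)
      rw [integral_div, integral_sub hadd (integrable_const _), integral_add (hI _) (hI _),
        integral_const]
      simp
    rw [h3]
    exact div_nonneg (by linarith) (by positivity)
  have hJnn : 0 ≤ ∫ θ, J θ ∂unitQuaternionMeasure := ge_of_tendsto hlim hGnn
  -- averaging over the orthonormal frames `θ, θ i, θ j, θ k`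
  let e : Fin 4 → S := fun c => ⟨qUnit c, mem_sphere_zero_iff_norm.2 (norm_qUnit c)⟩
  have hrot : ∀ c, Integrable (fun θ => J (θ * e c)) unitQuaternionMeasure ∧
      ∫ θ, J (θ * e c) ∂unitQuaternionMeasure = ∫ θ, J θ ∂unitQuaternionMeasure := by
    intro c
    have hmp := measurePreserving_mul_unitQuaternion (e c)
    refine ⟨hmp.integrable_comp_of_integrable hJi, ?_⟩
    rw [← integral_map hmp.measurable.aemeasurable (by rw [hmp.map_eq]; exact hJm), hmp.map_eq]
  have hsum : ∀ θ, ∑ c, J (θ * e c) = ∫ y, f y * lineLap ξ φ y := by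
    intro θ
    have hi : ∀ c, Integrable fun y =>
        f y * fderiv ℝ (fderiv ℝ φ) y (v (θ * e c)) (v (θ * e c)) := fun c => by
      simp only [← secondDeriv_eq hφ]
      have hc := (contDiff_secondDeriv hφ (v (θ * e c)) (v (θ * e c))).continuous
      obtain ⟨D, hD⟩ := hc.bounded_above_of_compact_support
        (hφc.of_isClosed_subset (isClosed_tsupport _) (tsupport_secondDeriv_subset φ _ _))
      exact hf.mul_bdd (c := D) hc.aestronglyMeasurable (Eventually.of_forall hD)
    simp only [J]
    rw [← integral_finsetSum _ fun c _ => hi c]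
    refine integral_congr_ae (Eventually.of_forall fun y => ?_)
    simp only
    rw [← lineLap_rightMul hφ ξ y (norm_unitQuaternion θ), lineLap, Finset.mul_sum]
    refine Finset.sum_congr rfl fun c _ => ?_
    have hve : v (θ * e c) = rightMul (rightMul ξ (θ : Quaternion ℝ)) (qUnit c) :=
      rightMul_mul ξ _ _
    rw [secondDeriv_eq hφ, hve]
  have h4 : ∫ y, f y * lineLap ξ φ y = 4 * ∫ θ, J θ ∂unitQuaternionMeasure := by
    calc ∫ y, f y * lineLap ξ φ y
        = ∫ _θ : S, (∫ y, f y * lineLap ξ φ y) ∂unitQuaternionMeasure := by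
          rw [integral_const]; simp
      _ = ∫ θ : S, ∑ c, J (θ * e c) ∂unitQuaternionMeasure :=
          integral_congr_ae (Eventually.of_forall fun θ => (hsum θ).symm)
      _ = ∑ c, ∫ θ : S, J (θ * e c) ∂unitQuaternionMeasure :=
          integral_finsetSum _ fun c _ => (hrot c).1
      _ = _ := by rw [Finset.sum_congr rfl fun c _ => (hrot c).2]; simp
  rw [h4]
  positivity

lemma IsQPsh.pairing_lineLap_nonneg (hΩ : IsOpen Ω) (hu : IsQPsh Ω u) (hL : InL1Loc Ω u)
    (hφ : ContDiff ℝ ∞ φ) (hφc : HasCompactSupport φ) (hφΩ : tsupport φ ⊆ Ω)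
    (hφ0 : ∀ y, 0 ≤ φ y) (ξ : QSpace n) : 0 ≤ pairing Ω u (lineLap ξ φ) := by
  obtain ⟨ρ, hρ, hK, hKΩ⟩ := exists_cthickening_subset hΩ hφc.isCompact hφΩ
  rw [pairing_eq_integral_cut hΩ.measurableSet hKΩ fun x hx =>
    self_subset_cthickening _ (tsupport_lineLap_subset φ ξ (subset_tsupport _ hx))]
  exact hu.integral_cut_mul_lineLap_nonneg hΩ hL hK hKΩ hφ hφc hφ0 hρ subset_rfl ξ

end Positivity

/-! ### Positive distributions are measures -/

section PositiveDistribution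

variable {n : ℕ} {Ω : Set (QSpace n)}

/-- `φ` is a smooth function with compact support in `Ω`. -/
structure IsSmoothTest (Ω : Set (QSpace n)) (φ : QSpace n → ℝ) : Prop where
  contDiff : ContDiff ℝ ∞ φ
  hasCompactSupport : HasCompactSupport φ
  tsupport_subset : tsupport φ ⊆ Ω

lemma IsSmoothTest.isCcTest {φ : QSpace n → ℝ} (h : IsSmoothTest Ω φ) : IsCcTest Ω φ :=
  ⟨h.contDiff.continuous, h.hasCompactSupport, h.tsupport_subset⟩

lemma IsSmoothTest.zero : IsSmoothTest Ω (0 : QSpace n → ℝ) :=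
  ⟨contDiff_const, HasCompactSupport.zero, by simp [tsupport]⟩

lemma IsSmoothTest.add {f g : QSpace n → ℝ} (hf : IsSmoothTest Ω f) (hg : IsSmoothTest Ω g) :
    IsSmoothTest Ω (f + g) :=
  ⟨hf.contDiff.add hg.contDiff, hf.hasCompactSupport.add hg.hasCompactSupport,
    (tsupport_add f g).trans (union_subset hf.tsupport_subset hg.tsupport_subset)⟩

lemma IsSmoothTest.smul {f : QSpace n → ℝ} (hf : IsSmoothTest Ω f) (c : ℝ) :
    IsSmoothTest Ω (c • f) :=
  ⟨hf.contDiff.const_smul c, hf.hasCompactSupport.smul_left (f := fun _ => c),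
    (tsupport_smul_subset_right (fun _ => c) f).trans hf.tsupport_subset⟩

open scoped CompactlySupported in
/-- A linear functional on the smooth functions with compact support in `Ω` that is non-negative on
non-negative functions is given by a measure: by M. Riesz' extension theorem it extends to a
positive functional on the continuous functions with compact support in `Ω`, to which the
Riesz–Markov–Kakutani theorem applies. -/
lemma exists_measure_of_nonneg (hΩ : IsOpen Ω) {T : (QSpace n → ℝ) → ℝ}
    (hadd : ∀ f g, IsSmoothTest Ω f → IsSmoothTest Ω g → T (f + g) = T f + T g)
    (hsmul : ∀ (c : ℝ) f, IsSmoothTest Ω f → T (c • f) = c * T f)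
    (hpos : ∀ f, IsSmoothTest Ω f → (∀ x, 0 ≤ f x) → 0 ≤ T f) :
    ∃ μ : Measure (QSpace n), SigmaFinite μ ∧ (∀ K, IsCompact K → K ⊆ Ω → μ K < ⊤) ∧
      ∀ f, IsSmoothTest Ω f → ∫ x, f x ∂μ = T f := by
  have : LocallyCompactSpace Ω := hΩ.locallyCompactSpace
  let ext : C_c(Ω, ℝ) → QSpace n → ℝ := fun f => Subtype.val.extend f 0
  have ext_coe : ∀ f (x : Ω), ext f x = f x := fun f x =>
    Subtype.val_injective.extend_apply f 0 x
  have ext_not : ∀ f x, x ∉ Ω → ext f x = 0 := fun f x hx =>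
    Function.extend_apply' _ _ _ (by rintro ⟨y, rfl⟩; exact hx y.2)
  have ext_eq : ∀ f g, (∀ x : Ω, f x = g x) → (∀ x ∉ Ω, g x = 0) → ext f = g := by
    intro f g h1 h2
    ext x
    by_cases hx : x ∈ Ω
    · exact (ext_coe f ⟨x, hx⟩).trans (h1 ⟨x, hx⟩)
    · rw [ext_not f x hx, h2 x hx]
  have ext_add : ∀ f g, ext (f + g) = ext f + ext g := fun f g =>
    ext_eq _ _ (fun x => by simp [ext_coe]) (fun x hx => by simp [ext_not _ x hx])
  have ext_smul : ∀ (c : ℝ) f, ext (c • f) = c • ext f := fun c f =>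
    ext_eq _ _ (fun x => by simp [ext_coe]) (fun x hx => by simp [ext_not _ x hx])
  -- the restriction of a continuous function with compact support in `Ω`
  have res : ∀ g : QSpace n → ℝ, IsCcTest Ω g → ∃ f : C_c(Ω, ℝ), ext f = g := by
    intro g hg
    have hc : IsCompact (Subtype.val ⁻¹' tsupport g : Set Ω) :=
      Topology.IsInducing.subtypeVal.isCompact_preimage_iff
        (by simpa using hg.tsupport_subset) |>.2 hg.hasCompactSupport.isCompact
    let f : C_c(Ω, ℝ) := ⟨⟨fun x => g x, hg.continuous.comp continuous_subtype_val⟩,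
      HasCompactSupport.of_support_subset_isCompact hc fun x hx => subset_tsupport _ hx⟩
    refine ⟨f, ext_eq f g (fun x => rfl) fun x hx => ?_⟩
    by_contra h
    exact hx (hg.tsupport_subset (subset_tsupport _ h))
  let D : Submodule ℝ C_c(Ω, ℝ) :=
    { carrier := {f | IsSmoothTest Ω (ext f)}
      add_mem' := fun {f g} hf hg => by
        change IsSmoothTest Ω (ext (f + g))
        rw [ext_add]; exact IsSmoothTest.add hf hg
      zero_mem' := by
        change IsSmoothTest Ω (ext 0)
        rw [ext_eq 0 0 (fun x => rfl) (fun x _ => rfl)]; exact IsSmoothTest.zero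
      smul_mem' := fun c f hf => by
        change IsSmoothTest Ω (ext (c • f))
        rw [ext_smul]; exact IsSmoothTest.smul hf c }
  let T' : D →ₗ[ℝ] ℝ :=
    { toFun := fun f => T (ext f)
      map_add' := fun f g => by
        rw [Submodule.coe_add, ext_add]; exact hadd _ _ f.2 g.2
      map_smul' := fun c f => by
        rw [Submodule.coe_smul, ext_smul]; exact hsmul _ _ f.2 }
  let P : PointedCone ℝ C_c(Ω, ℝ) :=
    { carrier := {f | ∀ x, 0 ≤ f x}
      add_mem' := fun {f g} hf hg x => add_nonneg (hf x) (hg x)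
      zero_mem' := fun x => le_rfl
      smul_mem' := fun c f hf x => mul_nonneg c.2 (hf x) }
  obtain ⟨Λ, hΛT, hΛ⟩ := riesz_extension P ⟨D, T'⟩
    (fun f hf => hpos _ f.2 fun x => by
      by_cases hx : x ∈ Ω
      · rw [ext_coe f ⟨x, hx⟩]; exact hf _
      · rw [ext_not _ x hx])
    (fun f => by
      -- a large multiple of a smooth cutoff function makes `f` non-negative
      obtain ⟨C, hC⟩ := f.1.2.bounded_above_of_compact_support f.2
      obtain ⟨η, hη, hηc, hηΩ, hη0, -, hη1⟩ := exists_cutoff hΩ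
        (f.hasCompactSupport.isCompact.image continuous_subtype_val)
        (by rintro _ ⟨x, -, rfl⟩; exact x.2)
      have hCη : IsSmoothTest Ω (|C| • η) := IsSmoothTest.smul ⟨hη, hηc, hηΩ⟩ _
      obtain ⟨g, hg⟩ := res _ hCη.isCcTest
      refine ⟨⟨g, by change IsSmoothTest Ω (ext g); rwa [hg]⟩, fun x => ?_⟩
      change 0 ≤ g x + f x
      have hgx : g x = |C| * η x := by rw [← ext_coe, hg]; rfl
      rw [hgx]
      by_cases hx : x ∈ tsupport f
      · rw [hη1 x ⟨x, hx, rfl⟩]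
        have h1 : |f x| ≤ C := hC x
        have h2 := neg_abs_le (f x)
        have h3 := le_abs_self C
        linarith
      · rw [image_eq_zero_of_notMem_tsupport hx, add_zero]
        exact mul_nonneg (abs_nonneg _) (hη0 _))
  let Λ' : C_c(Ω, ℝ) →ₚ[ℝ] ℝ := PositiveLinearMap.mk₀ Λ fun f hf => hΛ f hf
  have hemb : MeasurableEmbedding (Subtype.val : Ω → QSpace n) :=
    MeasurableEmbedding.subtype_coe hΩ.measurableSet
  refine ⟨(RealRMK.rieszMeasure Λ').map Subtype.val, hemb.sigmaFinite_map, ?_, ?_⟩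
  · intro K hK hKΩ
    rw [hemb.map_apply]
    exact (Topology.IsInducing.subtypeVal.isCompact_preimage_iff (by simpa using hKΩ) |>.2
      hK).measure_lt_top
  · intro f hf
    obtain ⟨g, hg⟩ := res f hf.isCcTest
    have hgD : g ∈ D := by change IsSmoothTest Ω (ext g); rwa [hg]
    rw [hemb.integral_map, ← hg]
    simp only [ext_coe]
    rw [RealRMK.integral_rieszMeasure]
    exact hΛT ⟨g, hgD⟩

end PositiveDistribution

/-! ### The line Laplacians of a psh function as measures -/

section LineMeasure

variable {n : ℕ} {Ω : Set (QSpace n)} {u : QSpace n → EReal} {φ : QSpace n → ℝ}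

lemma IsSmoothTest.lineLap {ψ : QSpace n → ℝ} (h : IsSmoothTest Ω ψ) (ξ : QSpace n) :
    IsSmoothTest Ω (lineLap ξ ψ) :=
  ⟨contDiff_lineLap h.contDiff ξ, hasCompactSupport_lineLap h.hasCompactSupport ξ,
    (tsupport_lineLap_subset ψ ξ).trans h.tsupport_subset⟩

/-- A compactly supported continuous function is approximated by its smooth mollifications, up to
arbitrarily small multiples of a fixed test function. -/
lemma IsCcTest.exists_dominating (hΩ : IsOpen Ω) (hφ : IsCcTest Ω φ) :
    ∃ η, IsSmoothTest Ω η ∧ ∀ δ > 0, ∃ ε₀ > 0, ∀ ε ≤ ε₀, ∀ κ : QSpace n → ℝ,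
      IsRadialKernel ε κ → IsSmoothTest Ω (φ ⋆ κ) ∧ ∀ x, |(φ ⋆ κ) x - φ x| ≤ δ * η x := by
  obtain ⟨ρ, hρ, hK, hKΩ⟩ := exists_cthickening_subset hΩ hφ.hasCompactSupport.isCompact
    hφ.tsupport_subset
  obtain ⟨η, hη, hηc, hηΩ, hη0, -, hη1⟩ := exists_cutoff hΩ hK hKΩ
  refine ⟨η, ⟨hη, hηc, hηΩ⟩, fun δ hδ => ?_⟩
  obtain ⟨ε₁, hε₁, hmoll⟩ :=
    exists_forall_abs_convolution_sub_le hφ.continuous hφ.hasCompactSupport hδ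
  refine ⟨min ε₁ ρ, lt_min hε₁ hρ, fun ε hε κ hκ => ?_⟩
  have hsub : tsupport (φ ⋆ κ) ⊆ cthickening ρ (tsupport φ) :=
    (tsupport_convolution_subset hκ.tsupport_subset).trans
      (cthickening_mono (hε.trans (min_le_right _ _)) _)
  refine ⟨⟨?_, hasCompactSupport_convolution hφ.hasCompactSupport hκ.hasCompactSupport,
    hsub.trans hKΩ⟩, fun x => ?_⟩
  · exact HasCompactSupport.contDiff_convolution_right _ hκ.hasCompactSupport
      (hφ.continuous.integrable_of_hasCompactSupport hφ.hasCompactSupport).locallyIntegrable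
      hκ.contDiff
  · by_cases hx : x ∈ cthickening ρ (tsupport φ)
    · rw [hη1 x hx, mul_one]
      exact hmoll ε (hε.trans (min_le_left _ _)) κ hκ x
    · rw [image_eq_zero_of_notMem_tsupport fun h => hx (hsub h),
        image_eq_zero_of_notMem_tsupport fun h => hx (self_subset_cthickening _ h)]
      simpa using mul_nonneg hδ.le (hη0 x)

lemma IsCcTest.integrable {μ : Measure (QSpace n)} (hφ : IsCcTest Ω φ)
    (hμ : ∀ K, IsCompact K → K ⊆ Ω → μ K < ⊤) : Integrable φ μ := by
  rw [← integrableOn_iff_integrable_of_support_subset (subset_tsupport φ)]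
  obtain ⟨C, hC⟩ := hφ.continuous.bounded_above_of_compact_support hφ.hasCompactSupport
  exact Measure.integrableOn_of_bounded (hμ _ hφ.hasCompactSupport hφ.tsupport_subset).ne
    hφ.continuous.aestronglyMeasurable (Eventually.of_forall hC)

lemma abs_integral_sub_le_of_le {μ : Measure (QSpace n)} {ψ η : QSpace n → ℝ} {δ : ℝ}
    (hμ : ∀ K, IsCompact K → K ⊆ Ω → μ K < ⊤) (hφ : IsCcTest Ω φ) (hψ : IsCcTest Ω ψ)
    (hη : IsCcTest Ω η) (h : ∀ x, |ψ x - φ x| ≤ δ * η x) :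
    |(∫ x, ψ x ∂μ) - ∫ x, φ x ∂μ| ≤ δ * ∫ x, η x ∂μ := by
  rw [← integral_sub (hψ.integrable hμ) (hφ.integrable hμ), ← integral_const_mul]
  exact norm_integral_le_of_norm_le ((hη.integrable hμ).const_mul δ)
    (Eventually.of_forall fun x => (Real.norm_eq_abs _).trans_le (h x))

/-- Convergence on smooth test functions implies weak convergence of measures. -/
lemma tendsto_integral_of_smoothTest (hΩ : IsOpen Ω) {μ : ℕ → Measure (QSpace n)}
    {ν : Measure (QSpace n)} (hμ : ∀ N K, IsCompact K → K ⊆ Ω → μ N K < ⊤)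
    (hν : ∀ K, IsCompact K → K ⊆ Ω → ν K < ⊤)
    (h : ∀ ψ, IsSmoothTest Ω ψ → Tendsto (fun N => ∫ x, ψ x ∂(μ N)) atTop (𝓝 (∫ x, ψ x ∂ν)))
    (hφ : IsCcTest Ω φ) : Tendsto (fun N => ∫ x, φ x ∂(μ N)) atTop (𝓝 (∫ x, φ x ∂ν)) := by
  obtain ⟨η, hη, happ⟩ := hφ.exists_dominating hΩ
  obtain ⟨κ, ε, hκ, hε⟩ := exists_radialKernel_seq n
  rw [Metric.tendsto_atTop']
  intro δ hδ
  set A := |∫ x, η x ∂ν| + 1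
  have hA : 0 < A := by positivity
  obtain ⟨ε₀, hε₀, happ⟩ := happ (δ / (4 * A)) (by positivity)
  obtain ⟨k, hk⟩ := (hε.eventually (gt_mem_nhds hε₀)).exists
  obtain ⟨hψ, hψφ⟩ := happ (ε k) (le_of_lt hk) (κ k) (hκ k)
  have h1 := (h _ hη).eventually (gt_mem_nhds
    (show ∫ x, η x ∂ν < A from (le_abs_self _).trans_lt (lt_add_one _)))
  have h2 := Metric.tendsto_nhds.1 (h _ hψ) (δ / 2) (half_pos hδ)
  obtain ⟨N₀, hN₀⟩ := eventually_atTop.1 (h1.and h2)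
  refine ⟨N₀, fun N hN => ?_⟩
  obtain ⟨hN1, hN2⟩ := hN₀ N hN.le
  have e1 := abs_integral_sub_le_of_le (hμ N) hφ hψ.isCcTest hη.isCcTest hψφ
  have e2 := abs_integral_sub_le_of_le hν hφ hψ.isCcTest hη.isCcTest hψφ
  have e3 : δ / (4 * A) * ∫ x, η x ∂(μ N) < δ / 4 := by
    calc _ < δ / (4 * A) * A := mul_lt_mul_of_pos_left hN1 (by positivity)
      _ = δ / 4 := by field_simp
  have e4 : δ / (4 * A) * ∫ x, η x ∂ν < δ / 4 := by
    calc _ < δ / (4 * A) * A := mul_lt_mul_of_pos_left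
          ((le_abs_self _).trans_lt (lt_add_one _)) (by positivity)
      _ = δ / 4 := by field_simp
  rw [Real.dist_eq] at hN2 ⊢
  rw [abs_lt] at hN2 ⊢
  rw [abs_le] at e1 e2
  constructor <;> linarith [e1.1, e1.2, e2.1, e2.2, hN2.1, hN2.2]

lemma InL1Loc.integrable_mul (hL : InL1Loc Ω u) (hφ : IsCcTest Ω φ) :
    IntegrableOn (fun x => (u x).toReal * φ x) Ω := by
  obtain ⟨C, hC⟩ := hφ.continuous.bounded_above_of_compact_support hφ.hasCompactSupport
  have h1 : IntegrableOn (fun x => (u x).toReal * φ x) (tsupport φ) :=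
    (hL.2 _ hφ.hasCompactSupport hφ.tsupport_subset).mul_bdd (c := C)
      hφ.continuous.aestronglyMeasurable (Eventually.of_forall hC)
  refine ((integrableOn_iff_integrable_of_support_subset fun x hx => ?_).1 h1).integrableOn
  exact subset_tsupport φ (right_ne_zero_of_mul hx)

/-- The Laplacian of a psh function along the right quaternionic lines of direction `ξ` is a
measure. -/
lemma IsQPsh.exists_lineMeasure (hΩ : IsOpen Ω) (hu : IsQPsh Ω u) (hL : InL1Loc Ω u)
    (ξ : QSpace n) : ∃ μ : Measure (QSpace n), SigmaFinite μ ∧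
      (∀ K, IsCompact K → K ⊆ Ω → μ K < ⊤) ∧
      ∀ ψ, IsSmoothTest Ω ψ → ∫ x, ψ x ∂μ = pairing Ω u (lineLap ξ ψ) := by
  refine exists_measure_of_nonneg hΩ (fun f g hf hg => ?_) (fun c f hf => ?_) fun f hf hf0 => ?_
  · rw [lineLap_add hf.contDiff hg.contDiff]
    simp only [pairing, Pi.add_apply, mul_add]
    exact integral_add (hL.integrable_mul (hf.lineLap ξ).isCcTest)
      (hL.integrable_mul (hg.lineLap ξ).isCcTest)
  · rw [lineLap_smul hf.contDiff]
    simp only [pairing, Pi.smul_apply, smul_eq_mul, ← integral_const_mul]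
    exact integral_congr_ae (Eventually.of_forall fun x => by simp only; ring)
  · exact hu.pairing_lineLap_nonneg hΩ hL hf.contDiff hf.hasCompactSupport hf.tsupport_subset
      hf0 ξ

/-- The Laplacians along lines of the regularizations of `u` converge weakly to the measure `μ` that
represents the distributional Laplacian. -/
lemma tendsto_integral_mul_lineLap_convolution (hΩ : IsOpen Ω) (hL : InL1Loc Ω u) {ξ : QSpace n}
    {μ : Measure (QSpace n)} (hμ : ∀ K, IsCompact K → K ⊆ Ω → μ K < ⊤)
    (hμu : ∀ ψ, IsSmoothTest Ω ψ → ∫ x, ψ x ∂μ = pairing Ω u (lineLap ξ ψ))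
    (hφ : IsCcTest Ω φ) {ρ : ℝ} (hρ : 0 < ρ) (hK : IsCompact (cthickening ρ (tsupport φ)))
    (hKΩ : cthickening ρ (tsupport φ) ⊆ Ω) {χ : QSpace n → ℝ} (hχ : IsSmoothingKernel χ) :
    Tendsto (fun ε => ∫ x, φ x *
        lineLap ξ (cut (cthickening ρ (tsupport φ)) u ⋆ scaledKernel χ ε) x)
      (𝓝[>] 0) (𝓝 (∫ x, φ x ∂μ)) := by
  obtain ⟨η, hη, happ⟩ := hφ.exists_dominating hΩ
  set f := cut (cthickening ρ (tsupport φ)) u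
  have hf : Integrable f := hL.integrable_cut hK hKΩ
  have hφi : Integrable φ := hφ.continuous.integrable_of_hasCompactSupport hφ.hasCompactSupport
  rw [Metric.tendsto_nhds]
  intro δ hδ
  set A := |∫ x, η x ∂μ| + 1
  have hA : 0 < A := by positivity
  obtain ⟨ε₀, hε₀, happ⟩ := happ (δ / A) (by positivity)
  filter_upwards [Ioo_mem_nhdsGT (lt_min hε₀ hρ)] with ε hε
  have hκ := hχ.isRadialKernel hε.1
  obtain ⟨hψ, hψφ⟩ := happ ε (hε.2.le.trans (min_le_left _ _)) _ hκ
  -- the Laplacian and the convolution are moved over to `φ`, because the kernel is even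
  have heq : ∫ x, φ x * lineLap ξ (f ⋆ scaledKernel χ ε) x = ∫ x, (φ ⋆ scaledKernel χ ε) x ∂μ := by
    rw [hμu _ hψ, pairing_eq_integral_cut (K := cthickening ρ (tsupport φ)) hΩ.measurableSet hKΩ
        fun x hx => cthickening_mono (hε.2.le.trans (min_le_right _ _)) _
          (tsupport_convolution_subset hκ.tsupport_subset
            (tsupport_lineLap_subset _ ξ (subset_tsupport _ hx))),
      lineLap_convolution hf.locallyIntegrable hκ.contDiff hκ.hasCompactSupport,
      lineLap_convolution hφi.locallyIntegrable hκ.contDiff hκ.hasCompactSupport]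
    refine integral_mul_convolution hf hφi (contDiff_lineLap hκ.contDiff ξ).continuous
      (hasCompactSupport_lineLap hκ.hasCompactSupport ξ) fun x => ?_
    exact Finset.sum_congr rfl fun c _ => secondDeriv_neg_of_even hκ.neg _ _ x
  rw [heq, Real.dist_eq]
  refine (abs_integral_sub_le_of_le hμ hφ hψ.isCcTest hη.isCcTest hψφ).trans_lt ?_
  calc δ / A * ∫ x, η x ∂μ < δ / A * A := mul_lt_mul_of_pos_left
          ((le_abs_self _).trans_lt (lt_add_one _)) (by positivity)
      _ = δ := by field_simp

/-- The measures `Δ_ξ u` depend continuously on `u` in `L¹_loc`. -/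
lemma TendstoL1Loc.tendsto_integral_lineMeasure (hΩ : IsOpen Ω) {w : ℕ → QSpace n → EReal}
    (hT : TendstoL1Loc Ω w u) {ξ : QSpace n} {μ : ℕ → Measure (QSpace n)}
    {ν : Measure (QSpace n)} (hμ : ∀ N K, IsCompact K → K ⊆ Ω → μ N K < ⊤)
    (hμw : ∀ N ψ, IsSmoothTest Ω ψ → ∫ x, ψ x ∂(μ N) = pairing Ω (w N) (lineLap ξ ψ))
    (hν : ∀ K, IsCompact K → K ⊆ Ω → ν K < ⊤)
    (hνu : ∀ ψ, IsSmoothTest Ω ψ → ∫ x, ψ x ∂ν = pairing Ω u (lineLap ξ ψ))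
    (hφ : IsCcTest Ω φ) : Tendsto (fun N => ∫ x, φ x ∂(μ N)) atTop (𝓝 (∫ x, φ x ∂ν)) := by
  refine tendsto_integral_of_smoothTest hΩ hμ hν (fun ψ hψ => ?_) hφ
  have hl := (hψ.lineLap ξ)
  have hs : ∀ x, lineLap ξ ψ x ≠ 0 → x ∈ tsupport (lineLap ξ ψ) := fun x hx =>
    subset_tsupport _ hx
  simp only [hνu ψ hψ, hμw _ ψ hψ, pairing_eq_integral_cut hΩ.measurableSet hl.tsupport_subset hs]
  exact hT.tendsto_integral_cut_mul hl.hasCompactSupport hl.tsupport_subset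
    hl.contDiff.continuous hl.hasCompactSupport

end LineMeasure

/-! ### The quaternionic Hessian in terms of line Laplacians -/

section QuaternionicHessian

variable {n : ℕ} {F : QSpace n → ℝ}

lemma rightMul_coordVec (i : Fin n) (p q : Quaternion ℝ) :
    rightMul (coordVec i p) q = coordVec i (p * q) := by
  ext1 k
  by_cases h : k = i
  · subst h; simp [coordVec]
  · simp [coordVec, h]

lemma fderiv_coe_quaternion {f : QSpace n → ℝ} (hf : ContDiff ℝ ∞ f) (x v : QSpace n) :
    fderiv ℝ (fun y => (f y : Quaternion ℝ)) x v = ((fderiv ℝ f x v : ℝ) : Quaternion ℝ) := by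
  have h := (((Algebra.linearMap ℝ (Quaternion ℝ)).toContinuousLinearMap).hasFDerivAt.comp x
    ((hf.differentiable (by simp)) x).hasFDerivAt).fderiv
  have h' := congrArg (fun L : QSpace n →L[ℝ] Quaternion ℝ => L v) h
  exact h'

/-- `∂²F / ∂q_i ∂q̄_j` in terms of real second derivatives. -/
lemma qHessian_eq_sum_sum (hF : ContDiff ℝ ∞ F) (x : QSpace n) (i j : Fin n) :
    qHessian F x i j = ∑ a, ∑ b,
      secondDeriv (coordVec i (qUnit a)) (coordVec j (qUnit b)) F x •
        (qUnit b * star (qUnit a)) := by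
  have hbar : dqBar j (fun y => (F y : Quaternion ℝ)) = fun y =>
      ∑ b, fderiv ℝ F y (coordVec j (qUnit b)) • qUnit b := by
    ext1 y
    refine Finset.sum_congr rfl fun b _ => ?_
    rw [fderiv_coe_quaternion hF, Quaternion.mul_coe_eq_smul]
  have hd : ∀ b, HasFDerivAt (fun y => fderiv ℝ F y (coordVec j (qUnit b)) • qUnit b)
      ((fderiv ℝ (fun y => fderiv ℝ F y (coordVec j (qUnit b))) x).smulRight (qUnit b)) x :=
    fun b => (((contDiff_fderiv_apply hF (coordVec j (qUnit b))).differentiable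
      (by simp)) x).hasFDerivAt.smul_const (qUnit b)
  simp only [qHessian, Matrix.of_apply, dq, hbar]
  refine Finset.sum_congr rfl fun a _ => ?_
  rw [(HasFDerivAt.fun_sum fun b _ => hd b).fderiv, sum_apply, Finset.sum_mul]
  refine Finset.sum_congr rfl fun b _ => ?_
  rw [ContinuousLinearMap.smulRight_apply, smul_mul_assoc]
  rfl

lemma isHermitian_qHessian (hF : ContDiff ℝ ∞ F) (x : QSpace n) :
    (qHessian F x).IsHermitian := by
  ext1 i j
  rw [Matrix.conjTranspose_apply, qHessian_eq_sum_sum hF, qHessian_eq_sum_sum hF,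
    Finset.sum_comm]
  simp only [star_sum]
  refine Finset.sum_congr rfl fun a _ => Finset.sum_congr rfl fun b _ => ?_
  rw [Quaternion.star_smul, star_mul, star_star, secondDeriv_eq hF, secondDeriv_eq hF,
    fderiv_fderiv_symm hF]

lemma sum_apply_star_mul_smul (ℓ : Quaternion ℝ →ₗ[ℝ] ℝ) (q : Quaternion ℝ) :
    ∑ a, ℓ (star (qUnit a) * q) • qUnit a = ∑ d, ℓ (qUnit d) • (q * star (qUnit d)) := by
  have hℓ : ∀ p, ℓ p = p.re * ℓ (qUnit 0) + p.imI * ℓ (qUnit 1) + p.imJ * ℓ (qUnit 2) +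
      p.imK * ℓ (qUnit 3) := fun p => by
    conv_lhs => rw [quaternion_eq_sum p]
    simp
  simp only [hℓ (star _ * q)]
  ext <;> simp [Fin.sum_univ_four] <;> ring

/-- The direction of the lines along which the Laplacians enter the `a`-th component of
`∂²F / ∂q_i ∂q̄_j`, with a sign. -/
noncomputable def hessDir (i j : Fin n) (a : Fin 4) (s : ℝ) : QSpace n :=
  coordVec i (star (qUnit a)) + s • coordVec j 1

lemma lineLap_sub_lineLap (hF : ContDiff ℝ ∞ F) (ξ η x : QSpace n) :
    lineLap (ξ + (1 : ℝ) • η) F x - lineLap (ξ + (-1 : ℝ) • η) F x =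
      4 * ∑ c, secondDeriv (rightMul ξ (qUnit c)) (rightMul η (qUnit c)) F x := by
  simp only [lineLap, Finset.mul_sum, ← Finset.sum_sub_distrib, secondDeriv_eq hF]
  refine Finset.sum_congr rfl fun c _ => ?_
  rw [rightMul_add_left, rightMul_add_left, rightMul_smul_left, rightMul_smul_left]
  have hs := fderiv_fderiv_symm hF (rightMul ξ (qUnit c)) (rightMul η (qUnit c)) x
  simp only [map_add, map_smul, add_apply, smul_apply, smul_eq_mul]
  linarith

/-- Polarization: each entry of the quaternionic Hessian is a combination of Laplacians along
right quaternionic lines. -/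
lemma qHessian_eq_sum_lineLap (hF : ContDiff ℝ ∞ F) (x : QSpace n) (i j : Fin n) :
    qHessian F x i j = ∑ a, (4⁻¹ * (lineLap (hessDir i j a 1) F x -
      lineLap (hessDir i j a (-1)) F x)) • qUnit a := by
  have h1 : ∀ a, 4⁻¹ * (lineLap (hessDir i j a 1) F x - lineLap (hessDir i j a (-1)) F x) =
      ∑ c, fderiv ℝ (fderiv ℝ F) x (coordVec i (star (qUnit a) * qUnit c))
        (coordVec j (qUnit c)) := fun a => by
    rw [hessDir, hessDir, lineLap_sub_lineLap hF, inv_mul_cancel_left₀ (by norm_num)]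
    simp only [secondDeriv_eq hF, rightMul_coordVec, one_mul]
  simp only [h1, Finset.sum_smul]
  rw [qHessian_eq_sum_sum hF, Finset.sum_comm,
    Finset.sum_comm (f := fun a c => fderiv ℝ (fderiv ℝ F) x
      (coordVec i (star (qUnit a) * qUnit c)) (coordVec j (qUnit c)) • qUnit a)]
  refine Finset.sum_congr rfl fun c _ => ?_
  let ℓ : Quaternion ℝ →ₗ[ℝ] ℝ :=
    { toFun := fun p => fderiv ℝ (fderiv ℝ F) x (coordVec i p) (coordVec j (qUnit c))
      map_add' := fun p q => by
        have : coordVec i (p + q) = coordVec i p + coordVec i q := by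
          simp [coordVec, Pi.single_add]
        simp [this]
      map_smul' := fun r p => by
        have : coordVec i (r • p) = r • coordVec i p := by
          simp [coordVec, Pi.single_smul]
        simp [this] }
  simp only [secondDeriv_eq hF]
  exact (sum_apply_star_mul_smul ℓ (qUnit c)).symm

lemma qHessian_congr {f g : QSpace n → ℝ} {x : QSpace n} (h : f =ᶠ[𝓝 x] g) :
    qHessian f x = qHessian g x := by
  ext1 i j
  have hc : (fun y => (f y : Quaternion ℝ)) =ᶠ[𝓝 x] fun y => (g y : Quaternion ℝ) :=
    h.fun_comp fun r : ℝ => (r : Quaternion ℝ)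
  have hb : dqBar j (fun y => (f y : Quaternion ℝ)) =ᶠ[𝓝 x]
      dqBar j (fun y => (g y : Quaternion ℝ)) := by
    filter_upwards [hc.eventuallyEq_nhds] with y hy
    simp only [dqBar, hy.fderiv_eq]
  simp only [qHessian, Matrix.of_apply, dq, hb.fderiv_eq]

end QuaternionicHessian

/-! ### The Hessian measure of a psh function -/

section HessianMeasure

variable {n : ℕ} {Ω : Set (QSpace n)} {u : QSpace n → EReal} {φ : QSpace n → ℝ}

/-- `m ξ` is, for every direction `ξ`, the measure on `Ω` that represents the distributional
Laplacian of `u` along the right quaternionic lines of direction `ξ`. -/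
structure IsLineMeasure (Ω : Set (QSpace n)) (u : QSpace n → EReal)
    (m : QSpace n → Measure (QSpace n)) : Prop where
  sigmaFinite : ∀ ξ, SigmaFinite (m ξ)
  lt_top : ∀ ξ K, IsCompact K → K ⊆ Ω → m ξ K < ⊤
  integral_eq : ∀ ξ ψ, IsSmoothTest Ω ψ → ∫ x, ψ x ∂(m ξ) = pairing Ω u (lineLap ξ ψ)

lemma IsQPsh.exists_isLineMeasure (hΩ : IsOpen Ω) (hu : IsQPsh Ω u) (hL : InL1Loc Ω u) :
    ∃ m, IsLineMeasure Ω u m := by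
  choose m h1 h2 h3 using hu.exists_lineMeasure hΩ hL
  exact ⟨m, h1, h2, h3⟩

/-- The entry `∫ φ ∂²u / ∂q_i ∂q̄_j` in terms of the measures `m ξ`, by polarization. -/
noncomputable def hessIntegral (m : QSpace n → Measure (QSpace n)) (φ : QSpace n → ℝ)
    (i j : Fin n) : Quaternion ℝ :=
  ∑ a, (4⁻¹ * ((∫ x, φ x ∂(m (hessDir i j a 1))) - ∫ x, φ x ∂(m (hessDir i j a (-1))))) • qUnit a

/-- Near the support of a test function, the regularizations of `u` are smooth functions on the
whole space, namely convolutions with a truncation of `u`. -/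
lemma eventually_smul_qHessian_regularize {ρ : ℝ} (hρ : 0 < ρ) (hΩ : IsOpen Ω)
    (hKΩ : cthickening ρ (tsupport φ) ⊆ Ω) {χ : QSpace n → ℝ} (hχ : IsSmoothingKernel χ) :
    ∀ᶠ ε in 𝓝[>] (0 : ℝ), ∀ x, φ x • qHessian (regularize χ Ω u ε) x =
      φ x • qHessian (cut (cthickening ρ (tsupport φ)) u ⋆ scaledKernel χ ε) x := by
  filter_upwards [Ioo_mem_nhdsGT hρ] with ε hε x
  by_cases hx : φ x = 0
  · rw [hx, zero_smul, zero_smul]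
  congr 1
  refine qHessian_congr ?_
  have hxs : x ∈ tsupport φ := subset_tsupport _ hx
  filter_upwards [ball_mem_nhds x (sub_pos.2 hε.2)] with y hy
  rw [regularize_eq]
  refine setIntegral_mul_eq_convolution hΩ.measurableSet hKΩ (fun z hz => ?_)
    (hχ.isRadialKernel hε.1).tsupport_subset _
  refine mem_cthickening_of_dist_le z x ρ _ hxs ?_
  have h1 := dist_triangle z y x
  have h2 : dist y x < ρ - ε := hy
  have h3 : dist z y ≤ ε := hz
  linarith

lemma integrable_mul_lineLap {F : QSpace n → ℝ} (hφ : IsCcTest Ω φ) (hF : ContDiff ℝ ∞ F)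
    (ξ : QSpace n) : Integrable fun x => φ x * lineLap ξ F x :=
  (hφ.continuous.mul (contDiff_lineLap hF ξ).continuous).integrable_of_hasCompactSupport
    hφ.hasCompactSupport.mul_right

lemma integral_smul_qHessian {F : QSpace n → ℝ} (hφ : IsCcTest Ω φ) (hF : ContDiff ℝ ∞ F)
    (i j : Fin n) : Integrable (fun x => φ x • qHessian F x i j) ∧
      ∫ x in Ω, φ x • qHessian F x i j =
      ∑ a, (4⁻¹ * ((∫ x, φ x * lineLap (hessDir i j a 1) F x) -
        ∫ x, φ x * lineLap (hessDir i j a (-1)) F x)) • qUnit a := by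
  rw [setIntegral_eq_integral_of_forall_compl_eq_zero fun x hx => by
    rw [image_eq_zero_of_notMem_tsupport fun h => hx (hφ.tsupport_subset h), zero_smul]]
  have hi : ∀ ξ, Integrable fun x => φ x * lineLap ξ F x := integrable_mul_lineLap hφ hF
  have e : ∀ x, φ x • qHessian F x i j = ∑ a, (4⁻¹ * (φ x * lineLap (hessDir i j a 1) F x -
      φ x * lineLap (hessDir i j a (-1)) F x)) • qUnit a := fun x => by
    rw [qHessian_eq_sum_lineLap hF, Finset.smul_sum]
    refine Finset.sum_congr rfl fun a _ => ?_
    rw [smul_smul]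
    congr 1
    ring
  have hi' : ∀ a, Integrable fun x => (4⁻¹ * (φ x * lineLap (hessDir i j a 1) F x -
      φ x * lineLap (hessDir i j a (-1)) F x)) • qUnit a := fun a =>
    (((hi _).sub (hi _)).const_mul 4⁻¹).smul_const (qUnit a)
  simp only [e]
  refine ⟨integrable_finsetSum _ fun a _ => hi' a, ?_⟩
  rw [integral_finsetSum _ fun a _ => hi' a]
  refine Finset.sum_congr rfl fun a _ => ?_
  rw [integral_smul_const, integral_const_mul, integral_sub (hi _) (hi _)]

variable {m : QSpace n → Measure (QSpace n)}

lemma IsLineMeasure.tendsto_integral_qHessian (hm : IsLineMeasure Ω u m) (hΩ : IsOpen Ω)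
    (hL : InL1Loc Ω u) (hφ : IsCcTest Ω φ) {χ : QSpace n → ℝ} (hχ : IsSmoothingKernel χ)
    (i j : Fin n) :
    Tendsto (fun ε : ℝ => ∫ x in Ω, φ x • qHessian (regularize χ Ω u ε) x i j)
      (𝓝[>] (0 : ℝ)) (𝓝 (hessIntegral m φ i j)) := by
  obtain ⟨ρ, hρ, hK, hKΩ⟩ := exists_cthickening_subset hΩ hφ.hasCompactSupport.isCompact
    hφ.tsupport_subset
  have hf : Integrable (cut (cthickening ρ (tsupport φ)) u) := hL.integrable_cut hK hKΩ
  have hlim := fun ξ => tendsto_integral_mul_lineLap_convolution hΩ hL (hm.lt_top ξ)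
    (hm.integral_eq ξ) hφ hρ hK hKΩ hχ
  refine (tendsto_finsetSum Finset.univ fun a _ => (((hlim (hessDir i j a 1)).sub
    (hlim (hessDir i j a (-1)))).const_mul 4⁻¹).smul_const (qUnit a)).congr' ?_
  filter_upwards [eventually_smul_qHessian_regularize (u := u) hρ hΩ hKΩ hχ, self_mem_nhdsWithin]
    with ε hε hε0
  have hκ := hχ.isRadialKernel hε0
  rw [← (integral_smul_qHessian hφ (HasCompactSupport.contDiff_convolution_right _
    hκ.hasCompactSupport hf.locallyIntegrable hκ.contDiff) i j).2]
  exact integral_congr_ae (Eventually.of_forall fun x => (congrFun₂ (hε x) i j).symm)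

lemma integrable_star {μ : Measure (QSpace n)} {f : QSpace n → Quaternion ℝ}
    (hf : Integrable f μ) : Integrable (fun x => star (f x)) μ ∧
      ∫ x, star (f x) ∂μ = star (∫ x, f x ∂μ) := by
  let S : Quaternion ℝ →L[ℝ] Quaternion ℝ := LinearMap.toContinuousLinearMap
    { toFun := star, map_add' := star_add, map_smul' := fun r q => Quaternion.star_smul r q }
  exact ⟨S.integrable_comp hf, S.integral_comp_comm hf⟩

/-- The matrix `hessIntegral m φ` is hyperhermitian, as a limit of hyperhermitian matrices. -/
lemma IsLineMeasure.star_hessIntegral (hm : IsLineMeasure Ω u m) (hΩ : IsOpen Ω)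
    (hL : InL1Loc Ω u) (hφ : IsCcTest Ω φ) (i j : Fin n) :
    star (hessIntegral m φ j i) = hessIntegral m φ i j := by
  obtain ⟨χ, hχ⟩ := exists_isSmoothingKernel n
  obtain ⟨ρ, hρ, hK, hKΩ⟩ := exists_cthickening_subset hΩ hφ.hasCompactSupport.isCompact
    hφ.tsupport_subset
  have hf : Integrable (cut (cthickening ρ (tsupport φ)) u) := hL.integrable_cut hK hKΩ
  refine tendsto_nhds_unique ((hm.tendsto_integral_qHessian hΩ hL hφ hχ j i).star)
    ((hm.tendsto_integral_qHessian hΩ hL hφ hχ i j).congr' ?_)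
  filter_upwards [eventually_smul_qHessian_regularize (u := u) hρ hΩ hKΩ hχ, self_mem_nhdsWithin]
    with ε hε hε0
  have hκ := hχ.isRadialKernel hε0
  have hF : ContDiff ℝ ∞ (cut (cthickening ρ (tsupport φ)) u ⋆ scaledKernel χ ε) :=
    HasCompactSupport.contDiff_convolution_right _
      hκ.hasCompactSupport hf.locallyIntegrable hκ.contDiff
  have e : ∀ k l, (fun x => φ x • qHessian (regularize χ Ω u ε) x k l) = fun x =>
      φ x • qHessian (cut (cthickening ρ (tsupport φ)) u ⋆ scaledKernel χ ε) x k l :=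
    fun k l => funext fun x => congrFun₂ (hε x) k l
  rw [e, e, ← (integrable_star (integral_smul_qHessian hφ hF j i).1.integrableOn).2]
  refine integral_congr_ae (Eventually.of_forall fun x => ?_)
  simp only
  rw [Quaternion.star_smul, (isHermitian_qHessian hF x).apply]

/-- A common dominating measure for the measures `m ξ` that enter `hessIntegral m`. -/
noncomputable def hessBase (m : QSpace n → Measure (QSpace n)) : Measure (QSpace n) :=
  Measure.sum fun p : Fin n × Fin n × Fin 4 =>
    m (hessDir p.1 p.2.1 p.2.2 1) + m (hessDir p.1 p.2.1 p.2.2 (-1))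

/-- The density of `hessIntegral m` with respect to `hessBase m`. -/
noncomputable def hessDensity (m : QSpace n → Measure (QSpace n)) (i j : Fin n) (x : QSpace n) :
    Quaternion ℝ :=
  ∑ a, (4⁻¹ * (((m (hessDir i j a 1)).rnDeriv (hessBase m) x).toReal -
    ((m (hessDir i j a (-1))).rnDeriv (hessBase m) x).toReal)) • qUnit a

lemma absolutelyContinuous_hessBase (m : QSpace n → Measure (QSpace n)) (i j : Fin n)
    (a : Fin 4) : m (hessDir i j a 1) ≪ hessBase m ∧ m (hessDir i j a (-1)) ≪ hessBase m := by
  have h := (Measure.le_sum (fun p : Fin n × Fin n × Fin 4 =>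
    m (hessDir p.1 p.2.1 p.2.2 1) + m (hessDir p.1 p.2.1 p.2.2 (-1))) (i, j, a)).absolutelyContinuous
  exact ⟨(Measure.le_add_right le_rfl).absolutelyContinuous.trans h,
    (Measure.le_add_left le_rfl).absolutelyContinuous.trans h⟩

lemma IsLineMeasure.sigmaFinite_hessBase (hm : IsLineMeasure Ω u m) : SigmaFinite (hessBase m) := by
  have := hm.sigmaFinite
  unfold hessBase
  infer_instance

lemma IsLineMeasure.integrableOn_hessDensity (hm : IsLineMeasure Ω u m) {K : Set (QSpace n)}
    (hK : IsCompact K) (hKΩ : K ⊆ Ω) (i j : Fin n) :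
    IntegrableOn (hessDensity m i j) K (hessBase m) := by
  have h : ∀ ξ, IntegrableOn (fun x => ((m ξ).rnDeriv (hessBase m) x).toReal) K (hessBase m) :=
    fun ξ => Measure.integrableOn_toReal_rnDeriv (hm.lt_top ξ K hK hKΩ).ne
  exact integrable_finsetSum _ fun a _ => (((h _).sub (h _)).const_mul 4⁻¹).smul_const (qUnit a)

lemma IsLineMeasure.integral_hessDensity (hm : IsLineMeasure Ω u m) (hφ : IsCcTest Ω φ)
    (i j : Fin n) : Integrable (fun x => φ x • hessDensity m i j x) (hessBase m) ∧
      ∫ x, φ x • hessDensity m i j x ∂(hessBase m) = hessIntegral m φ i j := by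
  have := hm.sigmaFinite
  have := hm.sigmaFinite_hessBase
  have h : ∀ ξ, m ξ ≪ hessBase m →
      Integrable (fun x => ((m ξ).rnDeriv (hessBase m) x).toReal • φ x) (hessBase m) ∧
      ∫ x, ((m ξ).rnDeriv (hessBase m) x).toReal • φ x ∂(hessBase m) = ∫ x, φ x ∂(m ξ) :=
    fun ξ hξ => ⟨(integrable_rnDeriv_smul_iff hξ).2 (hφ.integrable (hm.lt_top ξ)),
      integral_rnDeriv_smul hξ⟩
  have hp := fun a => h _ (absolutelyContinuous_hessBase m i j a).1
  have hn := fun a => h _ (absolutelyContinuous_hessBase m i j a).2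
  have e : (fun x => φ x • hessDensity m i j x) = fun x => ∑ a,
      (4⁻¹ * (((m (hessDir i j a 1)).rnDeriv (hessBase m) x).toReal • φ x -
        ((m (hessDir i j a (-1))).rnDeriv (hessBase m) x).toReal • φ x)) • qUnit a := by
    ext1 x
    rw [hessDensity, Finset.smul_sum]
    refine Finset.sum_congr rfl fun a _ => ?_
    rw [smul_smul, smul_eq_mul, smul_eq_mul]
    congr 1
    ring
  have hi : ∀ a, Integrable (fun x =>
      (4⁻¹ * (((m (hessDir i j a 1)).rnDeriv (hessBase m) x).toReal • φ x -
        ((m (hessDir i j a (-1))).rnDeriv (hessBase m) x).toReal • φ x)) • qUnit a)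
      (hessBase m) := fun a => (((hp a).1.sub (hn a).1).const_mul 4⁻¹).smul_const (qUnit a)
  rw [e]
  refine ⟨integrable_finsetSum _ fun a _ => hi a, ?_⟩
  rw [integral_finsetSum _ fun a _ => hi a]
  refine Finset.sum_congr rfl fun a _ => ?_
  rw [integral_smul_const, integral_const_mul, integral_sub (hp a).1 (hn a).1, (hp a).2, (hn a).2]

/-- The matrix measure with the entries `hessIntegral m`. Its density is symmetrized, because
`hessDensity m` is hyperhermitian only almost everywhere. -/
noncomputable def IsLineMeasure.hermMeasure (hm : IsLineMeasure Ω u m) : HermMeasure Ω where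
  base := hessBase m
  density x := Matrix.of fun i j =>
    (2⁻¹ : ℝ) • (hessDensity m i j x + star (hessDensity m j i x))
  base_lt_top K hK hKΩ := by
    rw [hessBase, Measure.sum_apply _ hK.measurableSet, tsum_fintype]
    exact ENNReal.sum_lt_top.2 fun p _ =>
      ENNReal.add_lt_top.2 ⟨hm.lt_top _ K hK hKΩ, hm.lt_top _ K hK hKΩ⟩
  isHermitian x := by
    ext1 i j
    rw [Matrix.conjTranspose_apply, Matrix.of_apply, Matrix.of_apply, Quaternion.star_smul,
      star_add, star_star, add_comm]
  integrableOn K hK hKΩ i j := by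
    have h1 := hm.integrableOn_hessDensity hK hKΩ i j
    have h2 := (integrable_star (hm.integrableOn_hessDensity hK hKΩ j i)).1
    exact (h1.add h2).smul (2⁻¹ : ℝ)

lemma IsLineMeasure.integral_hermMeasure (hm : IsLineMeasure Ω u m) (hΩ : IsOpen Ω)
    (hL : InL1Loc Ω u) (hφ : IsCcTest Ω φ) (i j : Fin n) :
    hm.hermMeasure.integral φ i j = hessIntegral m φ i j := by
  obtain ⟨h1, h2⟩ := hm.integral_hessDensity hφ i j
  obtain ⟨h3, h4⟩ := hm.integral_hessDensity hφ j i
  obtain ⟨h5, h6⟩ := integrable_star h3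
  calc hm.hermMeasure.integral φ i j
      = ∫ x, φ x • hm.hermMeasure.density x i j ∂(hessBase m) :=
        setIntegral_eq_integral_of_forall_compl_eq_zero fun x hx => by
          rw [image_eq_zero_of_notMem_tsupport fun h => hx (hφ.tsupport_subset h), zero_smul]
    _ = ∫ x, (2⁻¹ : ℝ) • (φ x • hessDensity m i j x + star (φ x • hessDensity m j i x))
          ∂(hessBase m) := integral_congr_ae (Eventually.of_forall fun x => by
        simp only [IsLineMeasure.hermMeasure, Matrix.of_apply, Quaternion.star_smul, ← smul_add]
        rw [smul_comm])
    _ = (2⁻¹ : ℝ) • (hessIntegral m φ i j + star (hessIntegral m φ j i)) := by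
        rw [integral_smul, integral_add h1 h5, h6, h2, h4]
    _ = hessIntegral m φ i j := by
        rw [hm.star_hessIntegral hΩ hL hφ, ← two_smul ℝ, smul_smul]
        norm_num

lemma IsLineMeasure.isHessianMeasure (hm : IsLineMeasure Ω u m) (hΩ : IsOpen Ω)
    (hL : InL1Loc Ω u) : IsHessianMeasure Ω u hm.hermMeasure := fun χ hχ φ hφ i j => by
  rw [hm.integral_hermMeasure hΩ hL hφ]
  exact hm.tendsto_integral_qHessian hΩ hL hφ hχ i j

/-- Every Hessian measure of `u` has the integrals `hessIntegral m`, by uniqueness of limits. -/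
lemma IsHessianMeasure.integral_eq {μ : HermMeasure Ω} (hμ : IsHessianMeasure Ω u μ)
    (hm : IsLineMeasure Ω u m) (hΩ : IsOpen Ω) (hL : InL1Loc Ω u) (hφ : IsCcTest Ω φ)
    (i j : Fin n) : μ.integral φ i j = hessIntegral m φ i j := by
  obtain ⟨χ, hχ⟩ := exists_isSmoothingKernel n
  exact tendsto_nhds_unique (hμ χ hχ φ hφ i j) (hm.tendsto_integral_qHessian hΩ hL hφ hχ i j)

lemma TendstoL1Loc.tendstoWeakly (hΩ : IsOpen Ω) {w : ℕ → QSpace n → EReal}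
    (hT : TendstoL1Loc Ω w u) (hw : ∀ N, IsQPsh Ω (w N)) (hu : IsQPsh Ω u)
    {ν : ℕ → HermMeasure Ω} {μ : HermMeasure Ω} (hν : ∀ N, IsHessianMeasure Ω (w N) (ν N))
    (hμ : IsHessianMeasure Ω u μ) : HermMeasure.TendstoWeakly ν μ := by
  intro φ hφ i j
  choose l hl using fun N => (hw N).exists_isLineMeasure hΩ (hT.1 N)
  obtain ⟨m, hm⟩ := hu.exists_isLineMeasure hΩ hT.2.1
  simp only [hμ.integral_eq hm hΩ hT.2.1 hφ, (hν _).integral_eq (hl _) hΩ (hT.1 _) hφ]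
  have h := fun ξ => hT.tendsto_integral_lineMeasure hΩ (fun N => (hl N).lt_top ξ)
    (fun N => (hl N).integral_eq ξ) (hm.lt_top ξ) (hm.integral_eq ξ) hφ
  exact tendsto_finsetSum _ fun a _ => (((h _).sub (h _)).const_mul 4⁻¹).smul_const (qUnit a)

end HessianMeasure

theorem theorem3p1p7 (n : ℕ) (hn : 1 ≤ n) (Ω : TopologicalSpace.Opens (QSpace n))
    (hΩ : IsConnected (Ω : Set (QSpace n))) :
    -- (i)
    (∀ u : ℕ → QSpace n → EReal, (∀ N, IsQPsh (Ω : Set (QSpace n)) (u N)) →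
      LocUniformlyBddAbove (Ω : Set (QSpace n)) u →
      (TendstoBotLocUniformly (Ω : Set (QSpace n)) u ∨
        ∃ k : ℕ → ℕ, StrictMono k ∧ ∃ v : QSpace n → EReal,
          TendstoL1Loc (Ω : Set (QSpace n)) (fun m => u (k m)) v) ∧
      ((∀ N, ∃ x ∈ Ω, u N x ≠ ⊥) →
        ∀ U : 𝓓'(Ω, ℝ),
          (∀ φ : 𝓓(Ω, ℝ),
            Tendsto (fun N => pairing (Ω : Set (QSpace n)) (u N) φ) atTop (𝓝 (U φ))) →
          ∃ v : QSpace n → EReal, IsQPsh (Ω : Set (QSpace n)) v ∧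
            (∀ φ : 𝓓(Ω, ℝ), U φ = pairing (Ω : Set (QSpace n)) v φ) ∧
            TendstoL1Loc (Ω : Set (QSpace n)) u v)) ∧
    -- (ii)
    (∀ (u : ℕ → QSpace n → EReal) (v : QSpace n → EReal),
      (∀ N, IsQPsh (Ω : Set (QSpace n)) (u N)) → IsQPsh (Ω : Set (QSpace n)) v →
      TendstoL1Loc (Ω : Set (QSpace n)) u v →
      (∀ N, ∃ ν : HermMeasure (Ω : Set (QSpace n)), IsHessianMeasure Ω (u N) ν) ∧
      (∃ μ : HermMeasure (Ω : Set (QSpace n)), IsHessianMeasure Ω v μ) ∧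
      ∀ (ν : ℕ → HermMeasure (Ω : Set (QSpace n))) (μ : HermMeasure (Ω : Set (QSpace n))),
        (∀ N, IsHessianMeasure Ω (u N) (ν N)) → IsHessianMeasure Ω v μ →
        HermMeasure.TendstoWeakly ν μ) := by
  have hO : IsOpen (Ω : Set (QSpace n)) := Ω.isOpen
  refine ⟨fun u hu hb => ⟨?_, fun hne U hU => ?_⟩, fun u v hu hv hT => ⟨fun N => ?_, ?_, ?_⟩⟩
  · by_cases h : TendstoBotLocUniformly (Ω : Set (QSpace n)) u
    · exact Or.inl h
    · exact Or.inr (exists_subseq_tendstoL1Loc hO hΩ.isPreconnected hu hb h)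
  · exact exists_isQPsh_of_tendsto_distribution Ω hΩ hu hb hne U hU
  · obtain ⟨m, hm⟩ := (hu N).exists_isLineMeasure hO (hT.1 N)
    exact ⟨hm.hermMeasure, hm.isHessianMeasure hO (hT.1 N)⟩
  · obtain ⟨m, hm⟩ := hv.exists_isLineMeasure hO hT.2.1
    exact ⟨hm.hermMeasure, hm.isHessianMeasure hO hT.2.1⟩
  · exact fun ν μ hν hμ => hT.tendstoWeakly hO hu hv hν hμ
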